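/- **Lozenge tilings and weights.** Work on the triangular lattice with horizontal lattice lines. Use coordinates in which one unit on the horizontal $i$-axis is half a lattice edge, and one unit on the vertical $j$-axis is the height of a unit triangle. A lozenge is the union of two unit triangles sharing an edge; it is *vertical* if the shared edge is horizontal. The weight $\mathrm{wt}_2$ gives a vertical lozenge with center $(i,j)$ the weight $\frac{q^i+q^{-i}}2$, except that vertical lozenges crossed by the $j$-axis ($i=0$) get weight $\frac12$; all other lozenges have weight $1$. The weight of a tiling is the product of the weights of its lozenges, and $\mathrm M(R)$ is the sum of the weights of all lozenge tilings of $R$ (so $\mathrm M(\emptyset)=1$). Here $q$ is an indeterminate or, more generally, a non-zero element of a field of characteristic $0$ such that $[k]_{q^2}\ne 0$ for all $k\ge 1$, where $[k]_q=1+q+\dots+q^{k-1}$ and $[k]_q!=[1]_q\cdots[k]_q$. **The region.** Let $x,u,d,m,n$ be non-negative integers with $m\le d$, $n\le u$, and let $1\le l_1<\dots<l_m\le d$ and $1\le h_1<\dots<h_n\le u$ be integers. Put $e'=\min(u-n,\,d-m+1)$. Consider the halved hexagon whose north, northeast, southeast and south sides follow lattice lines and have lengths $$x+d-m+1-e',\quad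 2u+m-n,\quad 2d-m+n+1,\quad x+u-n-e',$$ and whose west side is a vertical zigzag of $2u+2d+1$ unit steps. The base lies on $j=0$. Going up from $(1,0)$, the west side alternates between $i=1$ and $i=0$ for $2d$ steps, then makes one step from $(1,2d)$ to $(0,2d+1)$, and then alternates between $i=0$ and $i=-1$ for $2u$ steps, ending at the upper-left vertex $(0,2u+2d+1)$. The upper part has $u$ bumps to the left, numbered $1,\dots,u$ from bottom to top, and the lower part has $d$ bumps to the left, numbered $1,\dots,d$ from top to bottom. From the upper bumps whose number is not among the $h_j$ remove the up-pointing unit triangle at the west side; from the lower bumps whose number is not among the $l_i$ remove the down-pointing unit triangle at the west side; and remove the only down-pointing unit triangle at the west side between the first upper and the first lower bump (the one lying along the extra unit step). The resulting region, weighted by $\mathrm{wt}_2$, is $T_{x,u,d}((l_i)_{i=1}^m;(h_j)_{j=1}^n)$. **The product.** Put $\tilde x=x+u-n+d-m-e'=x+\max(u-n,d-m+1)-1$, $t'_1=2(x+u-n-e')+1$, $t'_2=2(x+d-m+1-e')$, $f(t,a,b)=\frac{ab(2t+a-b)}2$, $\left\langle{b\atop a}\right\rangle=a+(a+1)+\dots+b$,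 and $$E'=f(t'_1+2d-m,n+1,m)+\sum_{i=1}^m\left\langle{t'_1+2d-m-(m-i+1)\atop t'_1+2(d-l_i)-2(m-i)}\right\rangle+\sum_{i=1}^n\left\langle{t'_2+2u-n-(n-i+1)\atop t'_2+2(u-h_i)-2(n-i)}\right\rangle,$$ $$F'=(n+1)m+\sum_{i=1}^m(2l_i-i)+\sum_{i=1}^n(2h_i-i),$$ $$\begin{aligned} Q(x,u,d,(l_i),(h_j))={}&2^{-F'}q^{-E'}\frac{\prod_{1\le i<j\le m}[2(l_j-l_i)]_{q^2}\prod_{1\le i<j\le n}[2(h_j-h_i)]_{q^2}}{\prod_{i=1}^m\prod_{j=1}^n[2(l_i+h_j)]_{q^2}\prod_{i=1}^m[2l_i]_{q^2}!\prod_{j=1}^n[2h_j-1]_{q^2}!}\\ &\times\prod_{i=1}^{\lceil n/2\rceil}\prod_{j=1}^{2n-4i+3}[2\tilde x+2i+j]_{q^2}\\ &\times\prod_{i=1}^m[2(\tilde x+n+i)]_{q^2}[2(\tilde x+n+i+1)]_{q^2}\prod_{i=1}^m\prod_{j=1}^{n+i-1}[2\tilde x+n+i+j+1]_{q^2}\\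 &\times\prod_{i=1}^n\prod_{j=1}^m\frac{[2(\tilde x+i+j-1)]_{q^2}}{[2(\tilde x+i+j-1)+1]_{q^2}}\\ &\times\prod_{i=1}^m\prod_{j=1}^{l_i-i}[2(\tilde x+i+j+n+1)]_{q^2}[2(\tilde x-i-j+m+1)]_{q^2}\\ &\times\prod_{i=1}^n\prod_{j=1}^{h_i-i}[2(\tilde x+i+j+m)]_{q^2}[2(\tilde x-i-j+n+2)]_{q^2}. \end{aligned}$$ **Theorem (Formula for region of type T).** With these notations, $$\mathrm M\big(T_{x,u,d}((l_i)_{i=1}^m;(h_j)_{j=1}^n)\big)=Q\big(x,u,d,(l_i)_{i=1}^m,(h_j)_{j=1}^n\big).$$ -/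

import Mathlib

namespace HalvedHexagon

/- Coordinates.  One unit on the `i`-axis is half the length of a lattice edge; one unit on the
`j`-axis is the height of a unit triangle.  The base of the region lies on `j = 0`, and the
`j`-axis passes through the upper-left vertex of the region.  The lattice vertices are the
integer points `(i, j)` with `i + j` odd. -/

/-- A unit triangle lying in the horizontal strip between heights `j` and `j + 1`, whose vertical
symmetry axis has first coordinate `i`; `up` records whether it is up-pointing. -/
structure UnitTriangle where
  up : Bool
  i : ℤ
  j : ℤ
deriving DecidableEq

/-- The three corners of a unit triangle. -/
def UnitTriangle.vertices (t : UnitTriangle) : Finset (ℤ × ℤ) :=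
  if t.up then {(t.i - 1, t.j), (t.i + 1, t.j), (t.i, t.j + 1)}
  else {(t.i - 1, t.j + 1), (t.i + 1, t.j + 1), (t.i, t.j)}

/-- The pair `(a, b)` of an up-pointing and a down-pointing triangle sharing a horizontal edge:
a vertical lozenge.  Its center is the midpoint `(a.i, a.j)` of the common edge. -/
def IsVertical (p : UnitTriangle × UnitTriangle) : Prop :=
  p.1.up = true ∧ p.2.up = false ∧ p.2.i = p.1.i ∧ p.2.j + 1 = p.1.j

/-- The pair `(a, b)` of an up-pointing and a down-pointing triangle sharing a slanted edge. -/
def IsTilted (p : UnitTriangle × UnitTriangle) : Prop :=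
  p.1.up = true ∧ p.2.up = false ∧ p.2.j = p.1.j ∧ (p.2.i = p.1.i - 1 ∨ p.2.i = p.1.i + 1)

/-- A lozenge, recorded as the pair (up-pointing triangle, down-pointing triangle) of
edge-adjacent unit triangles of which it consists. -/
def IsLozenge (p : UnitTriangle × UnitTriangle) : Prop :=
  IsVertical p ∨ IsTilted p

/-- A lozenge tiling of a finite region `R`: a set of lozenges contained in `R` such that every
unit triangle of `R` belongs to exactly one of them. -/
def IsTiling (R : Finset UnitTriangle) (T : Finset (UnitTriangle × UnitTriangle)) : Prop :=
  (∀ p ∈ T, IsLozenge p ∧ p.1 ∈ R ∧ p.2 ∈ R) ∧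
    ∀ t ∈ R, ∃! p, p ∈ T ∧ (p.1 = t ∨ p.2 = t)

open Classical in
/-- The tiling generating function `M(R)` of the weighted region `(R, wt)`. -/
noncomputable def tilingGF {K : Type*} [Field K] (R : Finset UnitTriangle)
    (wt : UnitTriangle × UnitTriangle → K) : K :=
  ∑ T ∈ (R ×ˢ R).powerset with IsTiling R T, ∏ p ∈ T, wt p

open Classical in
/-- The weight `wt_2`: a vertical lozenge with center `(i, j)` has weight `(q^i + q^(-i)) / 2`,
except that it has weight `1 / 2` if the `j`-axis passes through it (equivalently, through its
center, `i = 0`); all other lozenges have weight `1`. -/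
noncomputable def wt2 {K : Type*} [Field K] (q : K) (p : UnitTriangle × UnitTriangle) : K :=
  if IsVertical p then
    if p.1.i = 0 then 1 / 2 else (q ^ p.1.i + q ^ (-p.1.i)) / 2
  else 1

/-! ### The region of type `T` -/

/-- `e' = min (u - n, d - m + 1)`. -/
def e' (u d m n : ℕ) : ℤ := min ((u : ℤ) - n) ((d : ℤ) - m + 1)

/-- Length of the north side of the base halved hexagon. -/
def northSide (x u d m n : ℕ) : ℤ := x + d - m + 1 - e' u d m n

/-- Length of the northeast side. -/
def northeastSide (u m n : ℕ) : ℤ := 2 * u + m - n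

/-- Length of the southeast side. -/
def southeastSide (d m n : ℕ) : ℤ := 2 * d - m + n + 1

/-- Length of the south side. -/
def southSide (x u d m n : ℕ) : ℤ := x + u - n - e' u d m n

/-- Number of unit steps of the west side. -/
def westSide (u d : ℕ) : ℤ := 2 * u + 2 * d + 1

/-- First coordinate of the vertex of the west side at height `j`.  The lower zigzag (`2d` steps)
alternates between `1` and `0`, starting at `1` for `j = 0`; the additional unit step leads from
`(1, 2d)` to `(0, 2d + 1)`; the upper zigzag (`2u` steps) alternates between `0` and `-1`. -/
def west (d : ℕ) (j : ℤ) : ℤ :=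
  if j ≤ 2 * d then (if Even j then 1 else 0) else (if Even j then -1 else 0)

/-- First coordinate of the point of the east boundary (southeast side followed by northeast
side) at height `j`.  It starts at the right end of the south side. -/
def east (x u d m n : ℕ) (j : ℤ) : ℤ :=
  if j ≤ southeastSide d m n then 1 + 2 * southSide x u d m n + j
  else 1 + 2 * southSide x u d m n + 2 * southeastSide d m n - j

/-- The northeast and southeast sides together have the height of the west side. -/
theorem northeastSide_add_southeastSide (u d m n : ℕ) :
    northeastSide u m n + southeastSide d m n = westSide u d := by
  simp only [northeastSide, southeastSide, westSide]; ring

/-- The boundary closes up: at the top, the west and the east boundary are at distance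
`northSide` (one lattice edge being two units). -/
theorem east_sub_west_top (x u d m n : ℕ) (hn : n ≤ u) :
    east x u d m n (westSide u d) - west d (westSide u d) = 2 * northSide x u d m n := by
  have h1 : ¬ Even (westSide u d) := by
    simp only [westSide, Int.not_even_iff_odd]
    exact ⟨(u : ℤ) + d, by ring⟩
  have h2 : west d (westSide u d) = 0 := by simp [west, h1]
  rw [h2]
  simp only [east, northSide, southSide, southeastSide, westSide]
  split_ifs <;> omega

/-- The unit triangles of the lattice contained in the base halved hexagon: those all of whose
corners lie weakly between the base and the top, and between the west and the east boundary. -/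
noncomputable def baseHexagon (x u d m n : ℕ) : Finset UnitTriangle :=
  ((Finset.univ ×ˢ
      (Finset.Icc (-1) (1 + 2 * southSide x u d m n + southeastSide d m n) ×ˢ
        Finset.Icc 0 (westSide u d))).image
    (fun p : Bool × ℤ × ℤ => UnitTriangle.mk p.1 p.2.1 p.2.2)).filter
    fun t => ∀ v ∈ t.vertices, Odd (v.1 + v.2) ∧ 0 ≤ v.2 ∧ v.2 ≤ westSide u d ∧
      west d v.2 ≤ v.1 ∧ v.1 ≤ east x u d m n v.2

/-- The up-pointing unit triangle in the `b`-th bump of the upper part of the west side (bumps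
numbered `1, …, u` from bottom to top).  The bump consists of the boundary vertices
`(0, 2d + 2b - 1)`, `(-1, 2d + 2b)`, `(0, 2d + 2b + 1)`. -/
def upperDent (d b : ℕ) : UnitTriangle := ⟨true, 0, 2 * d + 2 * b⟩

/-- The down-pointing unit triangle in the `b`-th bump of the lower part of the west side (bumps
numbered `1, …, d` from top to bottom).  The bump consists of the boundary vertices
`(1, 2d - 2b + 2)`, `(0, 2d - 2b + 1)`, `(1, 2d - 2b)`. -/
def lowerDent (d b : ℕ) : UnitTriangle := ⟨false, 1, 2 * d - 2 * b⟩

/-- The only down-pointing unit triangle along the west side between the first upper and the first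
lower bump; it lies along the additional unit step from `(1, 2d)` to `(0, 2d + 1)`. -/
def middleDent (d : ℕ) : UnitTriangle := ⟨false, 1, 2 * d⟩

/-- The region `T_{x,u,d}((l_i)_{i=1}^m; (h_j)_{j=1}^n)`.  The `l_i` and `h_j` are the positions of
the bumps from which no triangle is removed. -/
noncomputable def regionT (x u d m n : ℕ) (l h : ℕ → ℕ) : Finset UnitTriangle :=
  baseHexagon x u d m n \
    (((Finset.Icc 1 u \ (Finset.Icc 1 n).image h).image (upperDent d) ∪
      (Finset.Icc 1 d \ (Finset.Icc 1 m).image l).image (lowerDent d)) ∪ {middleDent d})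

/-! ### The product formula -/

/-- The `q`-integer `[n]_q = 1 + q + ⋯ + q^(n-1)`, for `n ≥ 0`. -/
def qInt {K : Type*} [Field K] (q : K) (n : ℤ) : K := ∑ k ∈ Finset.range n.toNat, q ^ k

/-- The `q`-factorial `[n]_q! = [1]_q [2]_q ⋯ [n]_q`. -/
noncomputable def qFact {K : Type*} [Field K] (q : K) (n : ℤ) : K := ∏ k ∈ Finset.Icc 1 n, qInt q k

/-- The sum `a + (a+1) + ⋯ + b`. -/
noncomputable def bracket (b a : ℤ) : ℤ := ∑ k ∈ Finset.Icc a b, k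

/-- `f(t,x,y) = xy(2t+x-y)/2`; the division is exact. -/
def f (t x y : ℤ) : ℤ := x * y * (2 * t + x - y) / 2

theorem two_mul_f (t x y : ℤ) : 2 * f t x y = x * y * (2 * t + x - y) := by
  have h : (2 : ℤ) ∣ x * y * (2 * t + x - y) := by
    rw [← even_iff_two_dvd]
    rcases Int.even_or_odd x with hx | hx <;> rcases Int.even_or_odd y with hy | hy <;>
      simp [Int.even_sub, Int.even_add, hx, hy, Int.not_even_iff_odd.mpr]
  exact Int.mul_ediv_cancel' h

/-- `t'_1 = 2(x+u-n-e')+1`. -/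
def t1 (x u d m n : ℕ) : ℤ := 2 * (x + u - n - e' u d m n) + 1

/-- `t'_2 = 2(x+d-m+1-e')`. -/
def t2 (x u d m n : ℕ) : ℤ := 2 * (x + d - m + 1 - e' u d m n)

/-- The exponent `E'`. -/
noncomputable def expE (x u d m n : ℕ) (l h : ℕ → ℕ) : ℤ :=
  f (t1 x u d m n + 2 * d - m) (n + 1) m
  + ∑ i ∈ Finset.Icc 1 m,
      bracket (t1 x u d m n + 2 * d - m - (m - i + 1))
        (t1 x u d m n + 2 * (d - l i) - 2 * (m - i))
  + ∑ i ∈ Finset.Icc 1 n,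
      bracket (t2 x u d m n + 2 * u - n - (n - i + 1))
        (t2 x u d m n + 2 * (u - h i) - 2 * (n - i))

/-- The exponent `F'`. -/
def expF (m n : ℕ) (l h : ℕ → ℕ) : ℤ :=
  ((n : ℤ) + 1) * m + ∑ i ∈ Finset.Icc 1 m, (2 * (l i : ℤ) - i)
    + ∑ i ∈ Finset.Icc 1 n, (2 * (h i : ℤ) - i)

/-- `x̃ = x + u - n + d - m - e'`. -/
def xTilde (x u d m n : ℕ) : ℤ := x + u - n + d - m - e' u d m n

theorem xTilde_eq_max (x u d m n : ℕ) :
    xTilde x u d m n = x + max ((u : ℤ) - n) ((d : ℤ) - m + 1) - 1 := by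
  simp only [xTilde, e']; omega

open Finset in
/-- The product `Q(x, u, d, (l_i)_{i=1}^m, (h_j)_{j=1}^n)`.  `⌈n/2⌉` is `(n + 1) / 2`.  The
exponent of `2` is `-F'` and the exponent of `q` is `-E'`. -/
noncomputable def Q {K : Type*} [Field K] (q : K) (x u d m n : ℕ) (l h : ℕ → ℕ) : K :=
  let X := xTilde x u d m n
  let br : ℤ → K := qInt (q ^ 2)
  let fact : ℤ → K := qFact (q ^ 2)
  (2 : K) ^ (-expF m n l h) * q ^ (-expE x u d m n l h)
    * (((∏ j ∈ Icc 1 m, ∏ i ∈ Ico 1 j, br (2 * ((l j : ℤ) - l i)))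
          * ∏ j ∈ Icc 1 n, ∏ i ∈ Ico 1 j, br (2 * ((h j : ℤ) - h i)))
        / ((∏ i ∈ Icc 1 m, ∏ j ∈ Icc 1 n, br (2 * ((l i : ℤ) + h j)))
          * (∏ i ∈ Icc 1 m, fact (2 * l i))
          * ∏ j ∈ Icc 1 n, fact (2 * h j - 1)))
    * (∏ i ∈ Icc 1 ((n + 1) / 2), ∏ j ∈ Icc (1 : ℤ) (2 * n - 4 * i + 3), br (2 * X + 2 * i + j))
    * (∏ i ∈ Icc 1 m, br (2 * (X + n + i)) * br (2 * (X + n + i + 1)))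
    * (∏ i ∈ Icc 1 m, ∏ j ∈ Icc (1 : ℤ) (n + i - 1), br (2 * X + n + i + j + 1))
    * (∏ i ∈ Icc 1 n, ∏ j ∈ Icc 1 m,
        br (2 * (X + i + j - 1)) / br (2 * (X + i + j - 1) + 1))
    * (∏ i ∈ Icc 1 m, ∏ j ∈ Icc (1 : ℤ) ((l i : ℤ) - i),
        br (2 * (X + i + j + n + 1)) * br (2 * (X - i - j + m + 1)))
    * (∏ i ∈ Icc 1 n, ∏ j ∈ Icc (1 : ℤ) ((h i : ℤ) - i),
        br (2 * (X + i + j + m)) * br (2 * (X - i - j + n + 2)))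

end HalvedHexagon

namespace HalvedHexagon

open Finset

/-! ### Balanced q-integers -/

variable {K : Type*} [Field K]

/-! Cut the region along every horizontal lattice line and call the centers of the vertical lozenges
crossed by a line its particles. Once its particles are removed, the strip between two consecutive
lines has exactly one tiling or none (`tilingGF_strip`), and it has one exactly when the particles
on the two lines interlace (`pairable_iff`). A tiling is therefore an interlacing sequence of
particle configurations, weighted by the positions of the particles.

Summation over interlacing configurations acts simply on determinants det(φ_r(a_c)): every function
φ_r is replaced by its weighted partial sums, and an intact bump adds one particle together with the
constant function 1 (`transfer_new`, `transfer_old`). The weight (q^i + q^(-i))/2 is exactly what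
arises from central differences of balanced q-integers, so the partial sums of `lowFun q t`, a
q-analogue of x^t/t!, are `lowFun q (t + 1)`. Above the extra step, where the j-axis meets the
region and the weight 1/2 occurs, `upFun` plays this role. On the line at height 2d+1 the state sums
of the two halves are thus determinants in the functions `lowFun q (2 * l i)` and `upFun q (2 * h j
- 1)` (`lowSum_eq_detAt`, `upSum_eq_detAt`).

The determinants belong to halves that are full wedges on the right, but the east boundary turns at
height 2d-m+n+1 rather than 2d+1. If m and n differ, one half has to be enlarged to its wedge; the
enlargement carries forced particles of known weight. The other half then has |m-n| functions too
few, and it is given additional ones that vanish at all smaller odd positions, hence are triangular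
on the forced positions (`det_extend`). A Cauchy–Binet argument (`sum_detAt_mul_detAt`) turns the
sum over the middle line into one determinant whose entries are sums of weight × `lowFun` × `upFun`.
These telescope to a row factor times a column factor over [2L+2H] (`sum_lowFun_mul_upFun`), and the
Cauchy determinant (`det_inv_bal`) gives a product.

What remains is algebra: the contributions of the forced particles and of the added functions cancel
(`prod_continued`, `prod_evenFact_mul_triangle`), the result is matched with the stated product by
an identity valid for any function g that is nonzero at positive integers (`const_eq`,
`productForm_eq_normalForm`), and the powers of 2 and q are counted (`prod_pow_two`,
`normalExp_eq_expE`). -/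

/-- The balanced `q`-integer `(q^k - q^(-k)) / (q - q⁻¹)`, extended to `q = ±1`. -/
noncomputable def bal (q : K) (k : ℤ) : K :=
  open Classical in
  if q ^ 2 = 1 then k * q ^ (k - 1) else (q ^ k - q ^ (-k)) / (q - q⁻¹)

section
variable {q : K}

theorem zpow_even_of_sq_eq_one (h : q ^ 2 = 1) {a b : ℤ} (hab : Even (a - b)) : q ^ a = q ^ b := by
  have hq : q ≠ 0 := by rintro rfl; simp at h
  obtain ⟨c, hc⟩ := hab
  have : a = b + 2 * c := by omega
  rw [this, zpow_add₀ hq, zpow_mul]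
  have h2 : q ^ (2 : ℤ) = 1 := by exact_mod_cast h
  rw [h2, one_zpow, mul_one]

theorem sub_inv_ne_zero (hq : q ≠ 0) (h : ¬ q ^ 2 = 1) : q - q⁻¹ ≠ 0 := by
  intro h0
  apply h
  have : q = q⁻¹ := sub_eq_zero.mp h0
  rw [pow_two]
  nth_rewrite 2 [this]
  exact mul_inv_cancel₀ hq

@[simp] theorem bal_zero : bal q 0 = 0 := by
  unfold bal; split_ifs <;> simp

theorem bal_one (hq : q ≠ 0) : bal q 1 = 1 := by
  unfold bal; split_ifs with h
  · simp
  · have := sub_inv_ne_zero hq h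
    simp [this]

theorem bal_neg (k : ℤ) : bal q (-k) = - bal q k := by
  unfold bal; split_ifs with h
  · rw [zpow_even_of_sq_eq_one h (a := -k - 1) (b := k - 1) ⟨-k, by ring⟩]
    push_cast; ring
  · rw [neg_neg]; ring

/-- The product-to-sum form of the three term relation. -/
theorem bal_mul_sub_mul (hq : q ≠ 0) {a b c d e f : ℤ} (h1 : a + b - (c + d) = 2 * f)
    (h2 : a + b + (c + d) = 2 * e) (h3 : a - b = d - c ∨ a - b = c - d) :
    bal q a * bal q b - bal q c * bal q d = bal q e * bal q f := by
  unfold bal; split_ifs with h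
  -- For q² = 1 the three products carry the same power of q, since the exponents agree modulo 2;
  -- what is left is the integer identity ab - cd = ef.
  · have e1 : q ^ (c - 1) * q ^ (d - 1) = q ^ (a - 1) * q ^ (b - 1) := by
      rw [← zpow_add₀ hq, ← zpow_add₀ hq]
      exact zpow_even_of_sq_eq_one h ⟨-f, by linarith⟩
    have e2 : q ^ (e - 1) * q ^ (f - 1) = q ^ (a - 1) * q ^ (b - 1) := by
      rw [← zpow_add₀ hq, ← zpow_add₀ hq]
      refine zpow_even_of_sq_eq_one h ?_
      have : e + f = a + b := by linarith
      exact ⟨0, by linarith⟩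
    have e3 : a * b - c * d = e * f := by
      have hf : e + f = a + b := by linarith
      have hg : e - f = c + d := by linarith
      have : 4 * (a * b - c * d) = 4 * (e * f) := by
        rcases h3 with h3 | h3 <;> nlinarith [congrArg (· ^ 2) h3, congrArg (· ^ 2) hf, congrArg (· ^ 2) hg]
      linarith
    have e4 : (a : K) * b - c * d = e * f := by
      have := congrArg (Int.cast : ℤ → K) e3
      push_cast at this; exact this
    calc _ = (a * b - c * d) * (q ^ (a - 1) * q ^ (b - 1)) := by
          rw [show (a : K) * q ^ (a - 1) * (b * q ^ (b - 1)) - c * q ^ (c - 1) * (d * q ^ (d - 1))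
            = a * b * (q ^ (a - 1) * q ^ (b - 1)) - c * d * (q ^ (c - 1) * q ^ (d - 1)) by ring, e1]
          ring
      _ = _ := by rw [e4, ← e2]; ring
  · have hd := sub_inv_ne_zero hq h
    rw [div_mul_div_comm, div_mul_div_comm, div_mul_div_comm, ← sub_div]
    congr 1
    -- A product of two numerators depends only on the sum and, up to sign, the difference of the
    -- arguments. The terms in a - b and c - d cancel by `h3`.
    have key : ∀ x y : ℤ, (q ^ x - q ^ (-x)) * (q ^ y - q ^ (-y))
        = q ^ (x + y) + q ^ (-(x + y)) - q ^ (x - y) - q ^ (-(x - y)) := by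
      intro x y
      rw [zpow_add₀ hq, zpow_sub₀ hq, neg_add, zpow_add₀ hq, neg_sub, zpow_sub₀ hq]
      simp only [zpow_neg]
      field_simp
      ring
    rw [key, key, key, show e + f = a + b by linarith, show e - f = c + d by linarith]
    rcases h3 with h3 | h3
    · rw [h3, show d - c = -(c - d) by ring, neg_neg]; ring
    · rw [h3]; ring

/-- This is sinh(b+t) - sinh(b-t) = 2 sinh t cosh b. The last factor is twice the generic weight of
a vertical lozenge at b, which is why these weights can be summed by telescoping. -/
theorem bal_add_sub_bal_sub (hq : q ≠ 0) (b t : ℤ) :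
    bal q (b + t) - bal q (b - t) = bal q t * (q ^ b + q ^ (-b)) := by
  unfold bal; split_ifs with h
  · rw [zpow_even_of_sq_eq_one h (a := b + t - 1) (b := b - t - 1) ⟨t, by ring⟩,
      zpow_even_of_sq_eq_one h (a := -b) (b := b) ⟨-b, by ring⟩,
      show b - t - 1 = (t - 1) + b + 2 * (-t) by ring, zpow_add₀ hq, zpow_add₀ hq,
      zpow_even_of_sq_eq_one h (a := 2 * (-t)) (b := 0) ⟨-t, by ring⟩]
    push_cast; simp; ring
  · rw [← sub_div, div_mul_eq_mul_div]
    congr 1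
    rw [zpow_add₀ hq, zpow_sub₀ hq, neg_add, zpow_add₀ hq, neg_sub, zpow_sub₀ hq]
    simp only [zpow_neg]
    field_simp
    ring

theorem bal_two_mul (hq : q ≠ 0) (b : ℤ) : bal q (2 * b) = bal q b * (q ^ b + q ^ (-b)) := by
  have := bal_add_sub_bal_sub hq b b
  rw [sub_self, bal_zero, sub_zero, ← two_mul] at this
  exact this

/-- The bridge to the q-integers of the statement. The powers q^(k-1) are collected at the very end
in `normalExp`. -/
theorem qInt_sq_eq (hq : q ≠ 0) {k : ℤ} (hk : 0 ≤ k) : qInt (q ^ 2) k = q ^ (k - 1) * bal q k := by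
  obtain ⟨n, rfl⟩ := Int.eq_ofNat_of_zero_le hk
  unfold qInt
  simp only [Int.toNat_natCast]
  induction n with
  | zero => simp
  | succ n ih =>
    rw [Finset.sum_range_succ, ih (by positivity)]
    unfold bal; split_ifs with h
    · push_cast
      rw [← zpow_natCast, ← zpow_natCast, ← zpow_mul,
        zpow_even_of_sq_eq_one h (a := ((2 : ℕ) : ℤ) * (n : ℤ)) (b := 0) ⟨n, by push_cast; ring⟩,
        show (n : ℤ) + 1 - 1 = n by ring, show (n : ℤ) = (n - 1) + 1 by ring, zpow_add₀ hq]
      simp only [zpow_one, zpow_zero]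
      have h3 : q ^ ((n : ℤ) - 1) * q ^ ((n : ℤ) - 1) = 1 := by
        rw [← zpow_add₀ hq]
        simpa using zpow_even_of_sq_eq_one h (a := (n : ℤ) - 1 + (n - 1)) (b := 0) ⟨n - 1, by ring⟩
      simp only [sub_add_cancel]
      linear_combination (n - (n + 1) * q ^ 2 : K) * h3 - (n + 1 : K) * h
    · have hd := sub_inv_ne_zero hq h
      have hd' : q ^ 2 - 1 ≠ 0 := sub_ne_zero.mpr h
      rw [Nat.cast_succ, show (n : ℤ) + 1 - 1 = n by ring, neg_add, zpow_add₀ hq, zpow_add₀ hq, zpow_sub₀ hq]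
      simp only [zpow_neg, zpow_one, ← zpow_natCast, ← zpow_mul]
      rw [show ((2 : ℕ) : ℤ) * (n : ℤ) = n + n by push_cast; ring, zpow_add₀ hq]
      have : q ^ (n : ℤ) ≠ 0 := zpow_ne_zero _ hq
      field_simp
      ring

theorem bal_ne_zero (hq : q ≠ 0) (hq' : ∀ k : ℤ, 0 < k → qInt (q ^ 2) k ≠ 0) {k : ℤ} (hk : k ≠ 0) :
    bal q k ≠ 0 := by
  have pos : ∀ k : ℤ, 0 < k → bal q k ≠ 0 := by
    intro k hk h0
    apply hq' k hk
    rw [qInt_sq_eq hq hk.le, h0, mul_zero]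
  rcases lt_or_gt_of_ne hk with h | h
  · have := pos (-k) (by omega)
    rw [bal_neg] at this
    simpa using this
  · exact pos k h

/-! ### Discrete primitives of the lozenge weights -/

/-- The product of the `t` values `bal (a - t + 1), bal (a - t + 3), …, bal (a + t - 1)`. -/
noncomputable def balProd (q : K) (t : ℕ) (a : ℤ) : K := ∏ r ∈ range t, bal q (a + 2 * r - t + 1)

/-- The shifts by +1 and -1 of the longer product share all factors but the outermost one, so a
central difference acts on a single factor. -/
theorem balProd_succ_add_one (t : ℕ) (b : ℤ) :
    balProd q (t + 1) (b + 1) = balProd q t b * bal q (b + t + 1) := by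
  unfold balProd
  rw [prod_range_succ]
  congr 1
  · refine prod_congr rfl fun r _ => ?_
    congr 1; push_cast; ring
  · congr 1; push_cast; ring

theorem balProd_succ_sub_one (t : ℕ) (b : ℤ) :
    balProd q (t + 1) (b - 1) = balProd q t b * bal q (b - t - 1) := by
  unfold balProd
  rw [prod_range_succ']
  congr 1
  · refine prod_congr rfl fun r _ => ?_
    congr 1; push_cast; ring
  · congr 1; push_cast; ring

/-- The arguments run symmetrically around a in steps of 2, so 0 is among them when |a| < t and a +
t is odd. These zeros provide the boundary conditions at the west side and the triangularity used
later. -/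
theorem balProd_eq_zero {t : ℕ} {a : ℤ} (h : ∃ r : ℕ, r < t ∧ a + 2 * r - t + 1 = 0) :
    balProd q t a = 0 := by
  obtain ⟨r, hr, h0⟩ := h
  exact prod_eq_zero (mem_range.mpr hr) (by rw [h0, bal_zero])

/-- `2^t s(1) s(2) ⋯ s(t)`. -/
noncomputable def balFact (q : K) (t : ℕ) : K := ∏ r ∈ range t, (2 * bal q (r + 1))

/-- The functions spanning the lower state sums. -/
noncomputable def lowFun (q : K) (t : ℕ) (a : ℤ) : K := balProd q t a / balFact q t

/-- The functions spanning the upper state sums. -/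
noncomputable def upFun (q : K) : ℕ → ℤ → K
  | 0, _ => 1
  | t + 1, a => bal q a * balProd q t a / balFact q (t + 1)

/-- The generic weight of a vertical lozenge. -/
noncomputable def fullWt (q : K) (i : ℤ) : K := (q ^ i + q ^ (-i)) / 2

variable [CharZero K]

theorem balFact_ne_zero (hs : ∀ k : ℤ, k ≠ 0 → bal q k ≠ 0) (t : ℕ) : balFact q t ≠ 0 :=
  prod_ne_zero_iff.mpr fun r _ => mul_ne_zero two_ne_zero (hs _ (by positivity))

/-- The common factor `balProd q t b` splits off, and the two extra factors differ by [t+1](q^b +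
q^(-b)); the normalization by 2^t [t]! absorbs [t+1] and leaves the weight. -/
theorem lowFun_diff (hq : q ≠ 0) (hs : ∀ k : ℤ, k ≠ 0 → bal q k ≠ 0) (t : ℕ) (b : ℤ) :
    lowFun q (t + 1) (b + 1) - lowFun q (t + 1) (b - 1) = fullWt q b * lowFun q t b := by
  have h1 : balFact q (t + 1) = balFact q t * (2 * bal q (t + 1)) := prod_range_succ _ _
  have h2 := bal_add_sub_bal_sub hq b (t + 1)
  have h3 := balFact_ne_zero hs t
  have h4 := hs (t + 1) (by positivity)
  unfold lowFun fullWt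
  rw [balProd_succ_add_one, balProd_succ_sub_one, h1, ← sub_div, ← mul_sub,
    show b + t + 1 = b + (t + 1 : ℤ) by ring, show b - t - 1 = b - (t + 1 : ℤ) by ring, h2]
  field_simp

/-- With the additional factor [b] the difference is [b+1][b+t+1] - [b-1][b-t-1] = [2b][t+2] (with t
shifted by one), and [2b] = [b](q^b + q^(-b)) restores the factor [b]. The constant function has no
such factor, so degree 0 is a separate case. -/
theorem upFun_diff (hq : q ≠ 0) (hs : ∀ k : ℤ, k ≠ 0 → bal q k ≠ 0) (t : ℕ) (b : ℤ) :
    upFun q (t + 1) (b + 1) - upFun q (t + 1) (b - 1) = fullWt q b * upFun q t b := by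
  rcases t with _ | t
  · have h2 := bal_add_sub_bal_sub hq b 1
    simp only [upFun, balProd, balFact, fullWt, range_zero, prod_empty, zero_add, prod_range_one,
      mul_one, Nat.cast_zero, bal_one hq] at *
    rw [← sub_div, h2, one_mul]
  · have h1 : balFact q (t + 1 + 1) = balFact q (t + 1) * (2 * bal q (t + 2)) := by
      rw [balFact, prod_range_succ, ← balFact]; push_cast; ring_nf
    have h2 := bal_mul_sub_mul hq (a := b + 1) (b := b + t + 1) (c := b - 1) (d := b - t - 1)
      (e := 2 * b) (f := t + 2) (by ring) (by ring) (by left; ring)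
    have h3 := balFact_ne_zero hs (t + 1)
    have h4 := hs (t + 2) (by positivity)
    have h5 := bal_two_mul hq b
    rw [h5] at h2
    simp only [upFun, fullWt]
    rw [balProd_succ_add_one, balProd_succ_sub_one, h1, ← sub_div,
      show bal q (b + 1) * (balProd q t b * bal q (b + t + 1)) -
        bal q (b - 1) * (balProd q t b * bal q (b - t - 1)) = balProd q t b *
        (bal q (b + 1) * bal q (b + t + 1) - bal q (b - 1) * bal q (b - t - 1)) by ring, h2]
    field_simp

end

/-! ### Cutting tilings -/

/-- The unit triangles covered by a set of lozenges. -/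
def covered (B : Finset (UnitTriangle × UnitTriangle)) : Finset UnitTriangle :=
  B.image Prod.fst ∪ B.image Prod.snd

theorem mem_covered {B : Finset (UnitTriangle × UnitTriangle)} {t : UnitTriangle} :
    t ∈ covered B ↔ ∃ p ∈ B, p.1 = t ∨ p.2 = t := by
  simp only [covered, mem_union, mem_image]
  constructor
  · rintro (⟨p, hp, h⟩ | ⟨p, hp, h⟩)
    exacts [⟨p, hp, Or.inl h⟩, ⟨p, hp, Or.inr h⟩]
  · rintro ⟨p, hp, h | h⟩
    exacts [Or.inl ⟨p, hp, h⟩, Or.inr ⟨p, hp, h⟩]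

/-- No two different lozenges of `B` overlap. -/
def NonOverlapping (B : Finset (UnitTriangle × UnitTriangle)) : Prop :=
  ∀ p ∈ B, ∀ p' ∈ B, ∀ t, (p.1 = t ∨ p.2 = t) → (p'.1 = t ∨ p'.2 = t) → p = p'

/-- A tiling is a set of non-overlapping lozenges that cover the region. -/
theorem isTiling_iff {R : Finset UnitTriangle} {T : Finset (UnitTriangle × UnitTriangle)} :
    IsTiling R T ↔ (∀ p ∈ T, IsLozenge p) ∧ NonOverlapping T ∧ covered T = R := by
  constructor
  · rintro ⟨h1, h2⟩
    have hc : ∀ p ∈ T, ∀ t, (p.1 = t ∨ p.2 = t) → t ∈ R := by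
      rintro p hp t (rfl | rfl)
      exacts [(h1 p hp).2.1, (h1 p hp).2.2]
    refine ⟨fun p hp => (h1 p hp).1, fun p hp p' hp' t ht ht' => ?_, ?_⟩
    · exact (h2 t (hc p hp t ht)).unique ⟨hp, ht⟩ ⟨hp', ht'⟩
    · ext t
      rw [mem_covered]
      constructor
      · rintro ⟨p, hp, h⟩; exact hc p hp t h
      · intro ht; obtain ⟨p, ⟨hp, h⟩, -⟩ := h2 t ht; exact ⟨p, hp, h⟩
  · rintro ⟨h1, h2, rfl⟩
    refine ⟨fun p hp => ⟨h1 p hp, mem_covered.mpr ⟨p, hp, Or.inl rfl⟩,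
      mem_covered.mpr ⟨p, hp, Or.inr rfl⟩⟩, fun t ht => ?_⟩
    obtain ⟨p, hp, h⟩ := mem_covered.mp ht
    exact ⟨p, ⟨hp, h⟩, fun p' hp' => h2 _ hp'.1 _ hp t hp'.2 h⟩

theorem covered_union (A B : Finset (UnitTriangle × UnitTriangle)) :
    covered (A ∪ B) = covered A ∪ covered B := by
  ext t
  simp only [mem_union, mem_covered]
  constructor
  · rintro ⟨p, hp | hp, h⟩
    exacts [Or.inl ⟨p, hp, h⟩, Or.inr ⟨p, hp, h⟩]
  · rintro (⟨p, hp, h⟩ | ⟨p, hp, h⟩)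
    exacts [⟨p, Or.inl hp, h⟩, ⟨p, Or.inr hp, h⟩]

theorem NonOverlapping.mono {A B : Finset (UnitTriangle × UnitTriangle)} (hB : NonOverlapping B)
    (h : A ⊆ B) : NonOverlapping A :=
  fun p hp p' hp' => hB p (h hp) p' (h hp')

theorem NonOverlapping.union {A B : Finset (UnitTriangle × UnitTriangle)} (hA : NonOverlapping A)
    (hB : NonOverlapping B) (h : Disjoint (covered A) (covered B)) : NonOverlapping (A ∪ B) := by
  intro p hp p' hp' t ht ht'
  rw [mem_union] at hp hp'
  rcases hp with hp | hp <;> rcases hp' with hp' | hp'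
  · exact hA p hp p' hp' t ht ht'
  · exact absurd rfl (disjoint_iff_ne.mp h t (mem_covered.mpr ⟨p, hp, ht⟩) t
      (mem_covered.mpr ⟨p', hp', ht'⟩))
  · exact absurd rfl (disjoint_iff_ne.mp h t (mem_covered.mpr ⟨p', hp', ht'⟩) t
      (mem_covered.mpr ⟨p, hp, ht⟩))
  · exact hB p hp p' hp' t ht ht'

theorem NonOverlapping.disjoint_covered {A B C : Finset (UnitTriangle × UnitTriangle)}
    (hC : NonOverlapping C) (hA : A ⊆ C) (hB : B ⊆ C) (h : Disjoint A B) :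
    Disjoint (covered A) (covered B) := by
  rw [disjoint_left]
  intro t hA' hB'
  obtain ⟨p, hp, ht⟩ := mem_covered.mp hA'
  obtain ⟨p', hp', ht'⟩ := mem_covered.mp hB'
  have := hC p (hA hp) p' (hB hp') t ht ht'
  subst this
  exact disjoint_left.mp h hp hp'

open Classical in
/-- The tilings of a region. -/
noncomputable def tilings (R : Finset UnitTriangle) : Finset (Finset (UnitTriangle × UnitTriangle)) :=
  (R ×ˢ R).powerset.filter (IsTiling R)

theorem mem_tilings {R : Finset UnitTriangle} {T : Finset (UnitTriangle × UnitTriangle)} :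
    T ∈ tilings R ↔ IsTiling R T := by
  classical
  rw [tilings, mem_filter, mem_powerset]
  refine ⟨fun h => h.2, fun h => ⟨fun p hp => ?_, h⟩⟩
  rw [mem_product]
  exact (h.1 p hp).2

theorem tilingGF_eq (R : Finset UnitTriangle) (wt : UnitTriangle × UnitTriangle → K) :
    tilingGF R wt = ∑ T ∈ tilings R, ∏ p ∈ T, wt p := rfl

/-- The lozenges contained in neither of two regions. -/
def Crossing (R₁ R₂ : Finset UnitTriangle) (p : UnitTriangle × UnitTriangle) : Prop :=
  ¬ (p.1 ∈ R₁ ∧ p.2 ∈ R₁) ∧ ¬ (p.1 ∈ R₂ ∧ p.2 ∈ R₂)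

-- Group the tilings by the set B of lozenges that lie in neither part. The remaining lozenges tile,
-- independently, what B leaves uncovered in each part.
open Classical in
theorem tilingGF_union {R₁ R₂ : Finset UnitTriangle} (hd : Disjoint R₁ R₂)
    (wt : UnitTriangle × UnitTriangle → K) :
    tilingGF (R₁ ∪ R₂) wt =
      ∑ B ∈ ((R₁ ∪ R₂) ×ˢ (R₁ ∪ R₂)).powerset with
          (NonOverlapping B ∧ ∀ p ∈ B, IsLozenge p ∧ Crossing R₁ R₂ p),
        (∏ p ∈ B, wt p) * (tilingGF (R₁ \ covered B) wt * tilingGF (R₂ \ covered B) wt) := by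
  rw [tilingGF_eq]
  rw [← sum_fiberwise_of_maps_to (s := tilings (R₁ ∪ R₂))
    (t := ((R₁ ∪ R₂) ×ˢ (R₁ ∪ R₂)).powerset.filter
      (fun B => NonOverlapping B ∧ ∀ p ∈ B, IsLozenge p ∧ Crossing R₁ R₂ p))
    (g := fun T => T.filter (Crossing R₁ R₂))]
  · refine sum_congr rfl fun B hB => ?_
    rw [mem_filter, mem_powerset] at hB
    obtain ⟨hBR, hBn, hBl⟩ := hB
    rw [tilingGF_eq, tilingGF_eq, sum_mul_sum]
    simp only [mul_sum]
    rw [← sum_product']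
    have hBcov : covered B ⊆ R₁ ∪ R₂ := by
      intro t ht
      obtain ⟨p, hp, h⟩ := mem_covered.mp ht
      have := mem_product.mp (hBR hp)
      rcases h with rfl | rfl
      exacts [this.1, this.2]
    have hnc : ∀ (R : Finset UnitTriangle) (T : Finset (UnitTriangle × UnitTriangle)),
        covered T = R \ covered B → ∀ p ∈ T, p.1 ∈ R ∧ p.2 ∈ R := by
      intro R T hT p hp
      have h1 : p.1 ∈ covered T := mem_covered.mpr ⟨p, hp, Or.inl rfl⟩
      have h2 : p.2 ∈ covered T := mem_covered.mpr ⟨p, hp, Or.inr rfl⟩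
      rw [hT, mem_sdiff] at h1 h2
      exact ⟨h1.1, h2.1⟩
    -- A tiling is recovered as a union of three disjoint sets of lozenges; conversely its lozenges
    -- are sorted according to the part that contains them.
    symm
    refine sum_bij' (fun T _ => B ∪ (T.1 ∪ T.2))
      (fun T _ => (T.filter (fun p => p.1 ∈ R₁ ∧ p.2 ∈ R₁), T.filter (fun p => p.1 ∈ R₂ ∧ p.2 ∈ R₂)))
      ?_ ?_ ?_ ?_ ?_
    · rintro ⟨T1, T2⟩ hT
      rw [mem_product, mem_tilings, mem_tilings, isTiling_iff, isTiling_iff] at hT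
      obtain ⟨⟨a1, a2, a3⟩, b1, b2, b3⟩ := hT
      dsimp only at a1 a2 a3 b1 b2 b3 ⊢
      rw [mem_filter, mem_tilings, isTiling_iff]
      refine ⟨⟨?_, ?_, ?_⟩, ?_⟩
      · intro p hp
        simp only [mem_union] at hp
        rcases hp with hp | hp | hp
        exacts [(hBl p hp).1, a1 p hp, b1 p hp]
      · refine hBn.union (a2.union b2 ?_) ?_
        · rw [a3, b3]
          exact disjoint_of_subset_left sdiff_subset (disjoint_of_subset_right sdiff_subset hd)
        · rw [covered_union, a3, b3, ← union_sdiff_distrib]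
          exact disjoint_sdiff
      · rw [covered_union, covered_union, a3, b3, ← union_sdiff_distrib, union_sdiff_of_subset hBcov]
      · ext p
        rw [mem_filter, mem_union, mem_union]
        constructor
        · rintro ⟨hp | hp | hp, hc⟩
          · exact hp
          · exact absurd (hnc R₁ T1 a3 p hp) hc.1
          · exact absurd (hnc R₂ T2 b3 p hp) hc.2
        · intro hp
          exact ⟨Or.inl hp, (hBl p hp).2⟩
    · intro T hT
      rw [mem_filter, mem_tilings, isTiling_iff] at hT
      obtain ⟨⟨c1, c2, c3⟩, rfl⟩ := hT
      rw [mem_product, mem_tilings, mem_tilings, isTiling_iff, isTiling_iff]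
      dsimp only
      have aux : ∀ R S : Finset UnitTriangle, R ∪ S = R₁ ∪ R₂ → Disjoint R S →
          (∀ p, Crossing R₁ R₂ p ↔ Crossing R S p) →
          covered (T.filter (fun p => p.1 ∈ R ∧ p.2 ∈ R)) = R \ covered (T.filter (Crossing R₁ R₂)) := by
        intro R S hRS hdis hcr
        have hdisj := c2.disjoint_covered (filter_subset (fun p => p.1 ∈ R ∧ p.2 ∈ R) T)
          (filter_subset (Crossing R₁ R₂) T) (by
            rw [disjoint_left]
            intro p hp hp'
            exact ((hcr p).mp (mem_filter.mp hp').2).1 (mem_filter.mp hp).2)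
        ext t
        rw [mem_sdiff]
        constructor
        · intro ht
          refine ⟨?_, disjoint_left.mp hdisj ht⟩
          obtain ⟨p, hp, h⟩ := mem_covered.mp ht
          have := (mem_filter.mp hp).2
          rcases h with rfl | rfl
          exacts [this.1, this.2]
        · rintro ⟨ht, hnt⟩
          have : t ∈ covered T := by rw [c3, ← hRS]; exact mem_union_left _ ht
          obtain ⟨p, hp, h⟩ := mem_covered.mp this
          refine mem_covered.mpr ⟨p, mem_filter.mpr ⟨hp, ?_⟩, h⟩
          have hnc : ¬ Crossing R S p := fun hc =>
            hnt (mem_covered.mpr ⟨p, mem_filter.mpr ⟨hp, (hcr p).mpr hc⟩, h⟩)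
          by_contra hcon
          apply hnc
          refine ⟨hcon, fun h2 => ?_⟩
          rcases h with rfl | rfl
          exacts [disjoint_left.mp hdis ht h2.1, disjoint_left.mp hdis ht h2.2]
      exact ⟨⟨fun p hp => c1 p (mem_filter.mp hp).1, c2.mono (filter_subset _ _),
          aux R₁ R₂ rfl hd fun _ => Iff.rfl⟩,
        fun p hp => c1 p (mem_filter.mp hp).1, c2.mono (filter_subset _ _),
          aux R₂ R₁ (union_comm _ _) hd.symm fun _ => and_comm⟩
    · rintro ⟨T1, T2⟩ hT
      rw [mem_product, mem_tilings, mem_tilings, isTiling_iff, isTiling_iff] at hT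
      obtain ⟨⟨a1, a2, a3⟩, b1, b2, b3⟩ := hT
      dsimp only at a3 b3 ⊢
      have h1 := hnc R₁ T1 a3
      have h2 := hnc R₂ T2 b3
      ext p
      · simp only [mem_filter, mem_union]
        constructor
        · rintro ⟨hp | hp | hp, hc⟩
          · exact absurd hc (hBl p hp).2.1
          · exact hp
          · exact absurd (h2 p hp).1 (disjoint_left.mp hd hc.1)
        · intro hp; exact ⟨Or.inr (Or.inl hp), h1 p hp⟩
      · simp only [mem_filter, mem_union]
        constructor
        · rintro ⟨hp | hp | hp, hc⟩
          · exact absurd hc (hBl p hp).2.2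
          · exact absurd hc.1 (disjoint_left.mp hd (h1 p hp).1)
          · exact hp
        · intro hp; exact ⟨Or.inr (Or.inr hp), h2 p hp⟩
    · intro T hT
      rw [mem_filter] at hT
      obtain ⟨-, rfl⟩ := hT
      ext p
      simp only [mem_filter, mem_union, Crossing]
      tauto
    · rintro ⟨T1, T2⟩ hT
      rw [mem_product, mem_tilings, mem_tilings, isTiling_iff, isTiling_iff] at hT
      obtain ⟨⟨a1, a2, a3⟩, b1, b2, b3⟩ := hT
      dsimp only at a3 b3 ⊢
      have h1 := hnc R₁ T1 a3
      have h2 := hnc R₂ T2 b3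
      rw [prod_union, prod_union]
      · rw [disjoint_left]
        intro p hp hp'
        exact disjoint_left.mp hd (h1 p hp).1 (h2 p hp').1
      · rw [disjoint_left]
        intro p hp hp'
        rcases mem_union.mp hp' with hp' | hp'
        · exact (hBl p hp).2.1 (h1 p hp')
        · exact (hBl p hp).2.2 (h2 p hp')
  · intro T hT
    rw [mem_tilings] at hT
    have hT' := isTiling_iff.mp hT
    rw [mem_filter, mem_powerset]
    refine ⟨fun p hp => ?_, hT'.2.1.mono (filter_subset _ _), fun p hp => ?_⟩
    · rw [mem_product]; exact (hT.1 p (mem_filter.mp hp).1).2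
    · exact ⟨hT'.1 p (mem_filter.mp hp).1, (mem_filter.mp hp).2⟩

/-! ### Strips -/

/-- The unit triangle of the lattice in the strip above height `j` with axis at `i`. -/
def cell (i j : ℤ) : UnitTriangle := ⟨decide (Even (i + j)), i, j⟩

theorem cell_injective (j : ℤ) : Function.Injective (cell · j) :=
  fun _ _ h => congrArg UnitTriangle.i h

/-- The weight of a vertical lozenge whose center has first coordinate `i`. -/
noncomputable def vertWt (q : K) (i : ℤ) : K := if i = 0 then 1 / 2 else fullWt q i

/-- The vertical lozenge with center `(i, j)`. -/
def vert (j i : ℤ) : UnitTriangle × UnitTriangle := (cell i j, cell i (j - 1))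

theorem isVertical_vert {i j : ℤ} (h : Even (i + j)) : IsVertical (vert j i) := by
  refine ⟨by simp [vert, cell, h], ?_, rfl, by simp [vert, cell]⟩
  simp only [vert, cell, decide_eq_false_iff_not, Int.not_even_iff_odd]
  rw [← add_sub_assoc]
  exact h.sub_odd odd_one

theorem wt2_vert (q : K) {i j : ℤ} (h : Even (i + j)) : wt2 q (vert j i) = vertWt q i := by
  rw [wt2, if_pos (isVertical_vert h)]
  rfl

theorem wt2_of_same_strip (q : K) {p : UnitTriangle × UnitTriangle} (h : p.1.j = p.2.j) :
    wt2 q p = 1 := by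
  rw [wt2, if_neg]
  rintro ⟨-, -, -, h'⟩
  omega

/-- A set of unit triangles belonging to the lattice. -/
def OnLattice (R : Finset UnitTriangle) : Prop := ∀ t ∈ R, t = cell t.i t.j

theorem covered_image_vert (j : ℤ) (B : Finset ℤ) :
    covered (B.image (vert j)) = B.image (cell · j) ∪ B.image (cell · (j - 1)) := by
  simp only [covered, image_image]; rfl

open Classical in
/-- Cutting a region along the lattice line at height `j`. -/
theorem tilingGF_cut (q : K) {R : Finset UnitTriangle} (hR : OnLattice R) (j : ℤ) (P : Finset ℤ)
    (hP : ∀ i, i ∈ P ↔ Even (i + j) ∧ cell i j ∈ R ∧ cell i (j - 1) ∈ R) :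
    tilingGF R (wt2 q) = ∑ B ∈ P.powerset, (∏ i ∈ B, vertWt q i) *
      (tilingGF (R.filter (fun t => t.j < j) \ B.image (cell · (j - 1))) (wt2 q) *
        tilingGF (R.filter (fun t => j ≤ t.j) \ B.image (cell · j)) (wt2 q)) := by
  have hd : Disjoint (R.filter (fun t => t.j < j)) (R.filter (fun t => j ≤ t.j)) := by
    rw [disjoint_filter]; intro t _ h; omega
  have hu : R.filter (fun t => t.j < j) ∪ R.filter (fun t => j ≤ t.j) = R := by
    ext t; simp only [mem_union, mem_filter, ← and_or_left]
    exact ⟨fun h => h.1, fun h => ⟨h, lt_or_ge _ _⟩⟩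
  have hinj : Function.Injective (vert j) := fun a b h => congrArg (fun p => p.1.i) h
  conv_lhs => rw [← hu]
  rw [tilingGF_union hd, hu]
  symm
  refine sum_nbij (fun B => B.image (vert j)) ?_ (fun A _ B _ h => image_injective hinj h) ?_ ?_
  · intro B hB
    rw [mem_powerset] at hB
    rw [mem_filter, mem_powerset]
    refine ⟨?_, ?_, ?_⟩
    · intro p hp
      obtain ⟨i, hi, rfl⟩ := mem_image.mp hp
      exact mem_product.mpr ((hP i).mp (hB hi)).2
    · intro p hp p' hp' t ht ht'
      obtain ⟨i, hi, rfl⟩ := mem_image.mp hp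
      obtain ⟨i', hi', rfl⟩ := mem_image.mp hp'
      have h1 : t.i = i := by rcases ht with rfl | rfl <;> rfl
      have h2 : t.i = i' := by rcases ht' with rfl | rfl <;> rfl
      rw [← h1, ← h2]
    · intro p hp
      obtain ⟨i, hi, rfl⟩ := mem_image.mp hp
      refine ⟨Or.inl (isVertical_vert ((hP i).mp (hB hi)).1), ?_, ?_⟩ <;>
        simp [vert, cell]
  · intro B hB
    simp only [coe_filter, mem_powerset, Set.mem_ofPred_eq] at hB
    obtain ⟨hB1, -, hB2⟩ := hB
    -- Only a vertical lozenge occupies two strips, and one with a triangle on either side of the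
    -- line must be centered on the line.
    have key : ∀ p ∈ B, p.1.i ∈ P ∧ vert j p.1.i = p := by
      intro p hp
      obtain ⟨hp1, hp2⟩ := mem_product.mp (hB1 hp)
      obtain ⟨hl, hc1, hc2⟩ := hB2 p hp
      simp only [mem_filter, hp1, hp2, true_and, not_and, not_lt, not_le] at hc1 hc2
      have e1 := hR _ hp1
      have e2 := hR _ hp2
      rcases hl with ⟨v1, v2, v3, v4⟩ | ⟨-, -, h3, -⟩
      · have hj : p.1.j = j := by
          by_contra hne
          rcases lt_or_gt_of_ne hne with h | h
          · have := hc1 h; omega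
          · have := hc2 (by omega); omega
        have hj2 : p.2.j = j - 1 := by omega
        have f1 : p.1 = cell p.1.i j := by rw [← hj]; exact e1
        have f2 : p.2 = cell p.1.i (j - 1) := by rw [← hj2, ← v3]; exact e2
        have he : Even (p.1.i + j) := by
          rw [e1, hj] at v1
          simpa [cell] using v1
        refine ⟨(hP _).mpr ⟨he, f1 ▸ hp1, f2 ▸ hp2⟩, ?_⟩
        exact Prod.ext f1.symm f2.symm
      · rcases lt_or_ge p.1.j j with h | h
        · have := hc1 h; omega
        · have := hc2 h; omega
    refine ⟨B.image (fun p => p.1.i), ?_, ?_⟩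
    · simp only [coe_powerset, Set.mem_preimage, Set.mem_powerset_iff, coe_subset]
      intro i hi
      obtain ⟨p, hp, rfl⟩ := mem_image.mp hi
      exact (key p hp).1
    · dsimp only
      rw [image_image]
      conv_rhs => rw [← image_id (s := B)]
      exact image_congr fun p hp => (key p hp).2
  · intro B hB
    rw [mem_powerset] at hB
    rw [prod_image (fun a _ b _ h => hinj h), covered_image_vert]
    congr 1
    · exact prod_congr rfl fun i hi => (wt2_vert q ((hP i).mp (hB hi)).1).symm
    · congr 2
      · ext t
        simp only [mem_sdiff, mem_filter, mem_union, mem_image, not_or]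
        refine and_congr_right fun h => ⟨fun h' => ⟨?_, h'⟩, fun h' => h'.2⟩
        rintro ⟨i, -, rfl⟩
        exact lt_irrefl _ h.2
      · ext t
        simp only [mem_sdiff, mem_filter, mem_union, mem_image, not_or]
        refine and_congr_right fun h => ⟨fun h' => ⟨h', ?_⟩, fun h' => h'.1⟩
        rintro ⟨i, -, rfl⟩
        have := h.2
        simp only [cell] at this
        omega

theorem tilingGF_empty (wt : UnitTriangle × UnitTriangle → K) : tilingGF ∅ wt = 1 := by
  have : tilings ∅ = {∅} := by
    ext T
    rw [mem_tilings, mem_singleton]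
    constructor
    · intro h
      rw [eq_empty_iff_forall_notMem]
      intro p hp
      exact absurd (h.1 p hp).2.1 (notMem_empty _)
    · rintro rfl
      exact ⟨fun p hp => absurd hp (notMem_empty _), fun t ht => absurd ht (notMem_empty _)⟩
  rw [tilingGF_eq, this, sum_singleton, prod_empty]

theorem tilingGF_eq_zero {R : Finset UnitTriangle} (wt : UnitTriangle × UnitTriangle → K)
    {t : UnitTriangle} (ht : t ∈ R)
    (h : ∀ p, IsLozenge p → p.1 ∈ R → p.2 ∈ R → ¬ (p.1 = t ∨ p.2 = t)) : tilingGF R wt = 0 := by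
  rw [tilingGF_eq]
  refine sum_eq_zero fun T hT => ?_
  rw [mem_tilings] at hT
  obtain ⟨p, ⟨hp, hpt⟩, -⟩ := hT.2 t ht
  obtain ⟨h1, h2, h3⟩ := hT.1 p hp
  exact absurd hpt (h p h1 h2 h3)

theorem lozenge_ne {p : UnitTriangle × UnitTriangle} (h : IsLozenge p) : p.1 ≠ p.2 := by
  intro h'
  rcases h with h | h <;> · have := h.1; rw [h', h.2.1] at this; cases this

/-- A forced lozenge splits off. -/
theorem tilingGF_forced {R : Finset UnitTriangle} (wt : UnitTriangle × UnitTriangle → K)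
    {t : UnitTriangle} {p₀ : UnitTriangle × UnitTriangle} (hl : IsLozenge p₀) (h1 : p₀.1 ∈ R)
    (h2 : p₀.2 ∈ R) (ht : p₀.1 = t ∨ p₀.2 = t)
    (h : ∀ p, IsLozenge p → p.1 ∈ R → p.2 ∈ R → (p.1 = t ∨ p.2 = t) → p = p₀) :
    tilingGF R wt = wt p₀ * tilingGF (R \ {p₀.1, p₀.2}) wt := by
  classical
  have htR : t ∈ R := by rcases ht with rfl | rfl <;> assumption
  have hu : {t} ∪ R \ {t} = R := by
    ext s
    simp only [mem_union, mem_singleton, mem_sdiff]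
    by_cases hs : s = t
    · simp [hs, htR]
    · simp [hs]
  conv_lhs => rw [← hu]
  -- The region is split into the single triangle t and the rest. No crossing lozenge other than p₀
  -- exists, and the empty crossing set contributes 0 because a single triangle has no tiling.
  rw [tilingGF_union disjoint_sdiff, hu, sum_eq_single {p₀}]
  · have hc : covered {p₀} = {p₀.1, p₀.2} := by
      ext s; simp [covered]
    have e1 : {t} \ covered {p₀} = ∅ := by
      rw [hc, sdiff_eq_empty_iff_subset, singleton_subset_iff]
      rcases ht with rfl | rfl <;> simp
    have e2 : (R \ {t}) \ covered {p₀} = R \ {p₀.1, p₀.2} := by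
      rw [hc]
      ext s
      simp only [mem_sdiff, mem_singleton, mem_insert]
      rcases ht with rfl | rfl <;> tauto
    rw [e1, e2, tilingGF_empty, prod_singleton, one_mul]
  · intro B hB hne
    rw [mem_filter, mem_powerset] at hB
    obtain ⟨hB1, -, hB2⟩ := hB
    have hsub : B ⊆ {p₀} := by
      intro p hp
      rw [mem_singleton]
      obtain ⟨hp1, hp2⟩ := mem_product.mp (hB1 hp)
      obtain ⟨hpl, -, hpc⟩ := hB2 p hp
      refine h p hpl hp1 hp2 ?_
      simp only [mem_sdiff, mem_singleton, hp1, hp2, true_and] at hpc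
      tauto
    have hB0 : B = ∅ := by
      rcases subset_singleton_iff.mp hsub with h | h
      exacts [h, absurd h hne]
    have : tilingGF ({t} \ covered B) wt = 0 := by
      have e : {t} \ covered B = {t} := by rw [hB0]; simp [covered]
      rw [e]
      refine tilingGF_eq_zero wt (mem_singleton_self t) fun p hp hp1 hp2 => ?_
      rw [mem_singleton] at hp1 hp2
      exact absurd (hp1.trans hp2.symm) (lozenge_ne hp)
    rw [this]; ring
  · intro hn
    refine absurd ?_ hn
    rw [mem_filter, mem_powerset, singleton_subset_iff, mem_product]
    refine ⟨⟨h1, h2⟩, ?_, ?_⟩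
    · intro p hp p' hp' _ _ _
      rw [mem_singleton] at hp hp'
      rw [hp, hp']
    · intro p hp
      rw [mem_singleton] at hp
      subst hp
      refine ⟨hl, ?_, ?_⟩
      · simp only [mem_singleton]
        rintro ⟨ha, hb⟩
        exact lozenge_ne hl (ha.trans hb.symm)
      · simp only [mem_sdiff, mem_singleton]
        tauto

/-- The positions of a strip can be paired off from the left. -/
def Pairable (S : Finset ℤ) : Prop := ∀ v ∈ S, Even (#{s ∈ S | s < v}) → v + 1 ∈ S

theorem lozenge_in_strip {S : Finset ℤ} {j : ℤ} {p : UnitTriangle × UnitTriangle} (h : IsLozenge p)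
    (h1 : p.1 ∈ S.image (cell · j)) (h2 : p.2 ∈ S.image (cell · j)) :
    p.1.i ∈ S ∧ p.2.i ∈ S ∧ p.1 = cell p.1.i j ∧ p.2 = cell p.2.i j ∧ Even (p.1.i + j) ∧
      (p.2.i = p.1.i - 1 ∨ p.2.i = p.1.i + 1) := by
  obtain ⟨a, ha, h1⟩ := mem_image.mp h1
  obtain ⟨b, hb, h2⟩ := mem_image.mp h2
  rcases h with h | ⟨g1, -, -, g4⟩
  · have := h.2.2.2
    rw [← h1, ← h2] at this
    simp [cell] at this
  · rw [← h1] at g1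
    rw [← h1, ← h2] at g4 ⊢
    simp only [cell, decide_eq_true_eq] at g1
    exact ⟨ha, hb, rfl, rfl, g1, g4⟩

theorem isTilted_cell {i j : ℤ} (h : Even (i + j)) (i' : ℤ) (hi : i' = i - 1 ∨ i' = i + 1) :
    IsTilted (cell i j, cell i' j) := by
  refine ⟨by simp [cell, h], ?_, rfl, hi⟩
  simp only [cell, decide_eq_false_iff_not, Int.not_even_iff_odd]
  obtain ⟨c, hc⟩ := h
  rcases hi with rfl | rfl
  · exact ⟨c - 1, by omega⟩
  · exact ⟨c, by omega⟩

-- The leftmost cell of a strip can only be joined to its right neighbor, so a tiling is forced pair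
-- by pair from the left. Its lozenges are tilted and have weight 1.
open Classical in
theorem tilingGF_strip (q : K) (j : ℤ) (S : Finset ℤ) :
    tilingGF (S.image (cell · j)) (wt2 q) = if Pairable S then 1 else 0 := by
  induction hn : #S using Nat.strong_induction_on generalizing S with
  | _ n ih =>
  rcases S.eq_empty_or_nonempty with rfl | hne
  · rw [image_empty, tilingGF_empty, if_pos]
    intro v hv; exact absurd hv (notMem_empty _)
  have hv := S.min'_mem hne
  set v := S.min' hne with hvdef
  have hmin : ∀ s ∈ S, v ≤ s := fun s hs => S.min'_le s hs
  have hr0 : #{s ∈ S | s < v} = 0 := by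
    rw [card_eq_zero, filter_eq_empty_iff]
    intro s hs; exact not_lt.mpr (hmin s hs)
  by_cases hv1 : v + 1 ∈ S
  · set S' := S \ {v, v + 1} with hS'
    have hcard : #S' < n := by
      rw [← hn]
      apply card_lt_card
      rw [ssubset_iff_of_subset sdiff_subset]
      exact ⟨v, hv, by simp⟩
    have hP : Pairable S ↔ Pairable S' := by
      -- Removing the first pair lowers all later ranks by 2 and so preserves their parity.
      have hrank : ∀ w ∈ S', #{s ∈ S | s < w} = #{s ∈ S' | s < w} + 2 := by
        intro w hw
        rw [hS', mem_sdiff, mem_insert, mem_singleton, not_or] at hw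
        have hw1 := hmin w hw.1
        have : {s ∈ S | s < w} = {s ∈ S' | s < w} ∪ {v, v + 1} := by
          ext s
          simp only [mem_filter, mem_union, hS', mem_sdiff, mem_insert, mem_singleton]
          constructor
          · rintro ⟨a, b⟩
            by_cases h : s = v ∨ s = v + 1
            · exact Or.inr h
            · exact Or.inl ⟨⟨a, h⟩, b⟩
          · rintro (⟨⟨a, -⟩, b⟩ | rfl | rfl)
            · exact ⟨a, b⟩
            · exact ⟨hv, by omega⟩
            · exact ⟨hv1, by omega⟩
        rw [this, card_union_of_disjoint, card_pair (by omega)]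
        rw [disjoint_left]
        intro s hs
        simp only [hS', mem_filter, mem_sdiff] at hs
        exact hs.1.2
      constructor
      · intro h w hw hev
        have hw' := hw
        rw [hS', mem_sdiff, mem_insert, mem_singleton, not_or] at hw'
        have := h w hw'.1 (by rw [hrank w hw]; exact hev.add even_two)
        have := hmin w hw'.1
        rw [hS', mem_sdiff, mem_insert, mem_singleton, not_or]
        exact ⟨by assumption, by omega, by omega⟩
      · intro h w hw hev
        by_cases hwv : w = v
        · rw [hwv]; exact hv1
        by_cases hwv1 : w = v + 1
        · exfalso
          have : {s ∈ S | s < w} = {v} := by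
            ext s
            rw [mem_filter, mem_singleton]
            constructor
            · rintro ⟨a, b⟩; have := hmin s a; omega
            · rintro rfl; exact ⟨hv, by omega⟩
          rw [this, card_singleton] at hev
          exact absurd hev (by decide)
        · have hw' : w ∈ S' := by
            rw [hS', mem_sdiff, mem_insert, mem_singleton, not_or]; exact ⟨hw, hwv, hwv1⟩
          have := h w hw' (by
            have := hrank w hw'
            rw [this] at hev
            exact (Nat.even_add.mp hev).mpr even_two)
          exact (mem_sdiff.mp this).1
    have hforced : tilingGF (S.image (cell · j)) (wt2 q) = tilingGF (S'.image (cell · j)) (wt2 q) := by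
      have himg : S'.image (cell · j) = S.image (cell · j) \ {cell v j, cell (v + 1) j} := by
        rw [hS', image_sdiff _ _ (cell_injective j)]
        simp
      have mv : cell v j ∈ S.image (cell · j) := mem_image_of_mem (cell · j) hv
      have mv1 : cell (v + 1) j ∈ S.image (cell · j) := mem_image_of_mem (cell · j) hv1
      -- The parity of v + j decides which cell of the forced lozenge points up.
      by_cases hev : Even (v + j)
      · rw [tilingGF_forced (wt2 q) (t := cell v j) (p₀ := (cell v j, cell (v + 1) j))
          (Or.inr (isTilted_cell hev _ (Or.inr rfl))) mv mv1 (Or.inl rfl),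
          wt2_of_same_strip q rfl, one_mul, himg]
        intro p hp hp1 hp2 hpt
        obtain ⟨a1, a2, a3, a4, a5, a6⟩ := lozenge_in_strip hp hp1 hp2
        have b1 := hmin _ a1
        have b2 := hmin _ a2
        rcases hpt with h | h
        · have : p.1.i = v := by rw [h]; rfl
          have h2 : p.2.i = v + 1 := by omega
          exact Prod.ext h (by rw [a4, h2])
        · have : p.2.i = v := by rw [h]; rfl
          have h2 : p.1.i = v + 1 := by omega
          rw [h2] at a5
          rw [Int.even_iff] at a5 hev
          omega
      · have hev1 : Even (v + 1 + j) := by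
          rw [Int.even_iff] at *; omega
        rw [tilingGF_forced (wt2 q) (t := cell v j) (p₀ := (cell (v + 1) j, cell v j))
          (Or.inr (isTilted_cell hev1 _ (Or.inl (by ring)))) mv1 mv (Or.inr rfl),
          wt2_of_same_strip q rfl, one_mul, himg]
        · congr 2
          exact pair_comm _ _
        intro p hp hp1 hp2 hpt
        obtain ⟨a1, a2, a3, a4, a5, a6⟩ := lozenge_in_strip hp hp1 hp2
        have b1 := hmin _ a1
        have b2 := hmin _ a2
        rcases hpt with h | h
        · have : p.1.i = v := by rw [h]; rfl
          rw [this] at a5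
          exact absurd a5 hev
        · have : p.2.i = v := by rw [h]; rfl
          have h2 : p.1.i = v + 1 := by omega
          exact Prod.ext (by rw [a3, h2]) h
    rw [hforced, ih _ hcard S' rfl]
    simp only [hP]
  · rw [if_neg fun h => hv1 (h v hv (by rw [hr0]; exact Even.zero))]
    refine tilingGF_eq_zero (wt2 q) (mem_image_of_mem (cell · j) hv) fun p hp hp1 hp2 hpt => ?_
    obtain ⟨a1, a2, a3, a4, a5, a6⟩ := lozenge_in_strip hp hp1 hp2
    have b1 := hmin _ a1
    have b2 := hmin _ a2
    rcases hpt with h | h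
    · have : p.1.i = v := by rw [h]; rfl
      exact hv1 (by rw [show v + 1 = p.2.i by omega]; exact a2)
    · have : p.2.i = v := by rw [h]; rfl
      exact hv1 (by rw [show v + 1 = p.1.i by omega]; exact a1)

/-! ### Interlacing -/

/-- If an odd number of positions were left of x, the last one, u, would have even rank and hence
the partner u + 1. This is either left of x, against the maximality of u, or equal to x, which is
not in S. -/
theorem Pairable.even_of_notMem {S : Finset ℤ} (h : Pairable S) {x : ℤ} (hx : x ∉ S) :
    Even #{s ∈ S | s < x} := by
  by_contra hodd
  have hne : {s ∈ S | s < x}.Nonempty := by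
    rw [← card_pos]
    rcases Nat.eq_zero_or_pos #{s ∈ S | s < x} with h0 | h0
    · rw [h0] at hodd; exact absurd Even.zero hodd
    · exact h0
  have hu := max'_mem _ hne
  set u := ({s ∈ S | s < x}).max' hne with hudef
  have hmax : ∀ s ∈ S, s < x → s ≤ u := fun s hs hsx => le_max' _ _ (mem_filter.mpr ⟨hs, hsx⟩)
  obtain ⟨huS, hux⟩ := mem_filter.mp hu
  have hset : {s ∈ S | s < x} = insert u {s ∈ S | s < u} := by
    ext s
    simp only [mem_filter, mem_insert]
    constructor
    · rintro ⟨a, b⟩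
      rcases (hmax s a b).lt_or_eq with h | h
      exacts [Or.inr ⟨a, h⟩, Or.inl h]
    · rintro (rfl | ⟨a, b⟩)
      exacts [⟨huS, hux⟩, ⟨a, b.trans hux⟩]
  rw [hset, card_insert_of_notMem (by simp)] at hodd
  have hev : Even #{s ∈ S | s < u} := by
    rw [Nat.even_add_one, not_not] at hodd; exact hodd
  have h1 := h u huS hev
  rcases (show u + 1 ≤ x by omega).lt_or_eq with h2 | h2
  · have := hmax _ h1 h2; omega
  · exact hx (h2 ▸ h1)

theorem card_filter_lt_add_one (A : Finset ℤ) (x : ℤ) :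
    #{a ∈ A | a < x + 1} = #{a ∈ A | a < x} + if x ∈ A then 1 else 0 := by
  split_ifs with h
  · have : {a ∈ A | a < x + 1} = insert x {a ∈ A | a < x} := by
      ext s
      simp only [mem_filter, mem_insert]
      constructor
      · rintro ⟨a, b⟩
        rcases (show s ≤ x by omega).lt_or_eq with h | h
        exacts [Or.inr ⟨a, h⟩, Or.inl h]
      · rintro (rfl | ⟨a, b⟩)
        exacts [⟨h, by omega⟩, ⟨a, by omega⟩]
    rw [this, card_insert_of_notMem (by simp)]
  · rw [add_zero]
    congr 1
    refine filter_congr fun s hs => ?_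
    constructor
    · intro hlt
      rcases (show s ≤ x by omega).lt_or_eq with h' | h'
      exacts [h', absurd (h' ▸ hs) h]
    · intro hlt; omega

theorem card_filter_lt_sdiff {p P x : ℤ} {C : Finset ℤ} (hC : C ⊆ Icc p P) (h1 : p ≤ x)
    (h2 : x ≤ P + 1) :
    (#{s ∈ Icc p P \ C | s < x} : ℤ) + #{c ∈ C | c < x} = x - p := by
  have hset : {s ∈ Icc p P \ C | s < x} = Ico p x \ {c ∈ C | c < x} := by
    ext s
    simp only [mem_filter, mem_sdiff, mem_Icc, mem_Ico]
    constructor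
    · rintro ⟨⟨⟨a, b⟩, c⟩, d⟩; exact ⟨⟨a, d⟩, fun h => c h.1⟩
    · rintro ⟨⟨a, b⟩, c⟩; exact ⟨⟨⟨a, by omega⟩, fun h => c ⟨h, b⟩⟩, b⟩
  have hsub : {c ∈ C | c < x} ⊆ Ico p x := by
    intro s hs
    rw [mem_filter] at hs
    have := mem_Icc.mp (hC hs.1)
    exact mem_Ico.mpr ⟨this.1, hs.2⟩
  rw [hset, card_sdiff_of_subset hsub, Nat.cast_sub (card_le_card hsub), Int.card_Ico,
    Int.toNat_of_nonneg (by omega)]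
  ring

theorem lt_iff_lt_card {n : ℕ} {a : Fin n → ℤ} (ha : StrictMono a) (x : ℤ) (i : Fin n) :
    a i < x ↔ (i : ℕ) < #{y ∈ univ.image a | y < x} := by
  have hcard : #{y ∈ univ.image a | y < x} = #{i : Fin n | a i < x} := by
    rw [filter_image, card_image_of_injective _ ha.injective]
  rw [hcard]
  constructor
  · intro h
    have : Iic i ⊆ ({i : Fin n | a i < x} : Finset (Fin n)) := by
      intro j hj
      rw [mem_filter]
      exact ⟨mem_univ _, (ha.monotone (mem_Iic.mp hj)).trans_lt h⟩
    have := card_le_card this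
    rw [Fin.card_Iic] at this
    omega
  · intro h
    by_contra hn
    have : ({i : Fin n | a i < x} : Finset (Fin n)) ⊆ Iio i := by
      intro j hj
      rw [mem_filter] at hj
      rw [mem_Iio]
      exact ha.lt_iff_lt.mp (hj.2.trans_le (not_lt.mp hn))
    have := card_le_card this
    rw [Fin.card_Iio] at this
    omega

theorem card_filter_image_lt {n : ℕ} {a : Fin n → ℤ} (ha : StrictMono a) {x : ℤ} {c : ℕ}
    (hc : c ≤ n) (h : ∀ i : Fin n, a i < x ↔ (i : ℕ) < c) : #{y ∈ univ.image a | y < x} = c := by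
  rw [filter_image, card_image_of_injective _ ha.injective]
  simp only [h]
  rw [Fin.card_filter_val_lt, min_eq_right hc]

/-! ### Interlacing of the particles on two consecutive lines -/

section
variable {p P : ℤ} {A B : Finset ℤ}

/-- At a particle the number of free positions to its left is even, so the number of particles of
both kinds to its left has the parity of x - p. That is even at a particle of A and odd at one of B;
hence the counts are equal before a particle of A, and A is ahead by one before a particle of B. -/
theorem Pairable.interlace (hA : A ⊆ Icc p P) (hB : B ⊆ Icc p P) (hA2 : ∀ x ∈ A, Even (x - p))
    (hB2 : ∀ x ∈ B, ¬ Even (x - p)) (hS : Pairable (Icc p P \ (A ∪ B))) (x : ℤ) (h1 : p ≤ x)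
    (h2 : x ≤ P + 1) : #{b ∈ B | b < x} ≤ #{a ∈ A | a < x} ∧
      #{a ∈ A | a < x} ≤ #{b ∈ B | b < x} + 1 := by
  have hd : Disjoint A B := disjoint_left.mpr fun x hx hx' => hB2 x hx' (hA2 x hx)
  have hrank := fun x (h1 : p ≤ x) (h2 : x ≤ P + 1) =>
    card_filter_lt_sdiff (union_subset hA hB) h1 h2
  simp only [filter_union] at hrank
  simp only [card_union_of_disjoint (disjoint_filter_filter hd), Nat.cast_add] at hrank
  induction x, h1 using Int.leInduction with
  | base =>
    have e1 : {a ∈ A | a < p} = ∅ := filter_eq_empty_iff.mpr fun a ha => not_lt.mpr (mem_Icc.mp (hA ha)).1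
    have e2 : {a ∈ B | a < p} = ∅ := filter_eq_empty_iff.mpr fun a ha => not_lt.mpr (mem_Icc.mp (hB ha)).1
    rw [e1, e2]; simp
  | succ x hx ih =>
    have ih := ih (by omega)
    have hr := hrank x hx (by omega)
    rw [card_filter_lt_add_one, card_filter_lt_add_one]
    by_cases hxA : x ∈ A
    · have hxB : x ∉ B := disjoint_left.mp hd hxA
      have hev := hS.even_of_notMem (x := x) (by simp [hxA])
      have hp := hA2 x hxA
      rw [if_pos hxA, if_neg hxB]
      rw [Nat.even_iff] at hev; rw [Int.even_iff] at hp
      omega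
    · by_cases hxB : x ∈ B
      · have hev := hS.even_of_notMem (x := x) (by simp [hxB])
        have hp := hB2 x hxB
        rw [if_neg hxA, if_pos hxB]
        rw [Nat.even_iff] at hev; rw [Int.even_iff] at hp
        omega
      · rw [if_neg hxA, if_neg hxB]; omega

/-- If the particles are even and the strip ends with an even position, the lines interlace. -/
theorem Pairable.card_eq (hpP : p ≤ P + 1) (hP : Even (P - p)) (hA : A ⊆ Icc p P) (hB : B ⊆ Icc p P)
    (hA2 : ∀ x ∈ A, Even (x - p)) (hB2 : ∀ x ∈ B, ¬ Even (x - p))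
    (hS : Pairable (Icc p P \ (A ∪ B))) : #A = #B + 1 := by
  have hd : Disjoint A B := disjoint_left.mpr fun x hx hx' => hB2 x hx' (hA2 x hx)
  have h1 := hS.interlace hA hB hA2 hB2 (P + 1) hpP le_rfl
  have hr := card_filter_lt_sdiff (union_subset hA hB) hpP le_rfl
  have hev := hS.even_of_notMem (x := P + 1) (by simp)
  have e1 : {a ∈ A | a < P + 1} = A :=
    filter_eq_self.mpr fun a ha => Int.lt_add_one_iff.mpr (mem_Icc.mp (hA ha)).2
  have e2 : {a ∈ B | a < P + 1} = B :=
    filter_eq_self.mpr fun a ha => Int.lt_add_one_iff.mpr (mem_Icc.mp (hB ha)).2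
  rw [filter_union, card_union_of_disjoint (disjoint_filter_filter hd)] at hr
  rw [e1, e2] at h1 hr
  rw [Int.even_iff] at hP
  rw [Nat.even_iff] at hev
  push_cast at hr
  omega

/-- The positions strictly between two consecutive particles, of the other parity. -/
noncomputable def gap (p : ℤ) {k : ℕ} (a : Fin (k + 1) → ℤ) (c : Fin k) : Finset ℤ :=
  {x ∈ Ioo (a c.castSucc) (a c.succ) | ¬ Even (x - p)}

theorem strictMono_of_mem_gap {k : ℕ} {a : Fin (k + 1) → ℤ} (ha : StrictMono a) {b : Fin k → ℤ}
    (hb : ∀ c, b c ∈ gap p a c) : StrictMono b := by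
  intro c c' h
  have h1 := mem_Ioo.mp (mem_filter.mp (hb c)).1
  have h2 := mem_Ioo.mp (mem_filter.mp (hb c')).1
  have : a c.succ ≤ a c'.castSucc := ha.monotone (by
    rw [Fin.le_def, Fin.val_succ, Fin.val_castSucc]; exact h)
  omega

/-- Tileability of a strip means interlacing. In one direction, parity shows that exactly c + 1
particles of the first line precede the particle number c (from 0) of the second. In the other,
interlacing fixes all counts, and these rule out a position of even rank without a right neighbor.
-/
theorem pairable_iff {k : ℕ} {a : Fin (k + 1) → ℤ} (ha : StrictMono a)
    (hpP : p ≤ P + 1) (hP : Even (P - p)) (hA : ∀ c, a c ∈ Icc p P) (hB : B ⊆ Icc p P)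
    (hA2 : ∀ c, Even (a c - p)) (hB2 : ∀ x ∈ B, ¬ Even (x - p)) :
    Pairable (Icc p P \ (univ.image a ∪ B)) ↔ ∃ b : Fin k → ℤ, (∀ c, b c ∈ gap p a c) ∧
      B = univ.image b := by
  have hA' : univ.image a ⊆ Icc p P := by
    intro x hx; obtain ⟨c, -, rfl⟩ := mem_image.mp hx; exact hA c
  have hA2' : ∀ x ∈ univ.image a, Even (x - p) := by
    intro x hx; obtain ⟨c, -, rfl⟩ := mem_image.mp hx; exact hA2 c
  have hd : Disjoint (univ.image a) B := disjoint_left.mpr fun x hx hx' => hB2 x hx' (hA2' x hx)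
  have hrank := fun x (h1 : p ≤ x) (h2 : x ≤ P + 1) =>
    card_filter_lt_sdiff (union_subset hA' hB) h1 h2
  simp only [filter_union] at hrank
  simp only [card_union_of_disjoint (disjoint_filter_filter hd), Nat.cast_add] at hrank
  constructor
  · intro hS
    have hcard := hS.card_eq hpP hP hA' hB hA2' hB2
    rw [card_image_of_injective _ ha.injective, card_univ, Fintype.card_fin] at hcard
    have hk : #B = k := by omega
    refine ⟨B.orderEmbOfFin hk, fun c => ?_, (image_orderEmbOfFin_univ B hk).symm⟩
    set b := B.orderEmbOfFin hk with hb
    have hbB : b c ∈ B := orderEmbOfFin_mem B hk c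
    have hbI := mem_Icc.mp (hB hbB)
    have hcB : #{y ∈ B | y < b c} = c := by
      conv_lhs => rw [← image_orderEmbOfFin_univ B hk]
      exact card_filter_image_lt b.strictMono c.2.le fun i => by
        rw [b.lt_iff_lt, Fin.lt_def]
    have h1 := hS.interlace hA' hB hA2' hB2 (b c) hbI.1 (by omega)
    have hr := hrank (b c) hbI.1 (by omega)
    have hev := hS.even_of_notMem (x := b c) (by simp [hbB])
    have hodd := hB2 _ hbB
    have hcA : #{y ∈ univ.image a | y < b c} = c + 1 := by
      rw [Nat.even_iff] at hev; rw [Int.even_iff] at hodd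
      omega
    refine mem_filter.mpr ⟨mem_Ioo.mpr ⟨?_, ?_⟩, hodd⟩
    · rw [lt_iff_lt_card ha, hcA, Fin.val_castSucc]; omega
    · have : ¬ a c.succ < b c := by rw [lt_iff_lt_card ha, hcA, Fin.val_succ]; omega
      rcases (not_lt.mp this).lt_or_eq with h | h
      · exact h
      · rw [h] at hodd; exact absurd (hA2 _) hodd
  · rintro ⟨b, hb, rfl⟩ v hv hev
    have hbm := strictMono_of_mem_gap ha hb
    by_contra hv1
    rw [mem_sdiff, mem_union, not_or, mem_Icc] at hv
    obtain ⟨⟨hv2, hv3⟩, hvA, hvB⟩ := hv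
    have hr := hrank v hv2 (by omega)
    have hlt : ∀ c, a c.castSucc < b c ∧ b c < a c.succ := fun c =>
      mem_Ioo.mp (mem_filter.mp (hb c)).1
    have hvb : ∀ c, b c ≠ v := fun c h => hvB (mem_image.mpr ⟨c, mem_univ _, h⟩)
    have hva : ∀ c, a c ≠ v := fun c h => hvA (mem_image.mpr ⟨c, mem_univ _, h⟩)
    rw [Nat.even_iff] at hev
    -- the number of particles on both lines left of `v`
    have hcount : ∀ ca cb : ℕ, ca ≤ k + 1 → cb ≤ k → (∀ i, a i < v ↔ (i : ℕ) < ca) →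
        (∀ i, b i < v ↔ (i : ℕ) < cb) → (v - p - (ca + cb)) % 2 = 0 := by
      intro ca cb h1 h2 h3 h4
      rw [card_filter_image_lt ha h1 h3, card_filter_image_lt hbm h2 h4] at hr
      omega
    -- A position v of even rank that cannot be paired is the end of the strip or is followed by a
    -- particle. The particles left of v then number k+1 and k, or c and c (before `a c`), or c+1
    -- and c (before `b c`), and each case contradicts the parity of v - p.
    by_cases hvP : v = P
    · have := hcount (k + 1) k le_rfl le_rfl (fun i => by
          have := (mem_Icc.mp (hA i)).2
          have := hva i
          have := i.2
          constructor <;> intro <;> omega) (fun i => by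
          have := (mem_Icc.mp (hA i.succ)).2
          have := hlt i
          have := i.2
          constructor <;> intro <;> omega)
      rw [Int.even_iff] at hP
      push_cast at this
      omega
    · have hv1' : v + 1 ∈ univ.image a ∪ univ.image b := by
        by_contra hn
        exact hv1 (mem_sdiff.mpr ⟨mem_Icc.mpr ⟨by omega, by omega⟩, hn⟩)
      rcases mem_union.mp hv1' with h | h <;> obtain ⟨c, -, hc⟩ := mem_image.mp h
      · have := hcount c c c.2.le (by omega) (fun i => by
            rw [← Fin.lt_def, ← ha.lt_iff_lt]
            have := hva i
            constructor <;> intro <;> omega) (fun i => by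
            have h1 := hlt i
            have h2 := hvb i
            constructor
            · intro h
              have : a i.castSucc < a c := by omega
              rw [ha.lt_iff_lt, Fin.lt_def] at this
              exact this
            · intro h
              have : a i.succ ≤ a c := ha.monotone (by rw [Fin.le_def, Fin.val_succ]; exact h)
              omega)
        have h2 := hA2 c
        rw [Int.even_iff] at h2
        omega
      · have := hcount (c + 1) c (by omega) c.2.le (fun i => by
            have h1 := hlt c
            have h2 := hva i
            constructor
            · intro h
              have : a i < a c.succ := by omega
              rw [ha.lt_iff_lt, Fin.lt_def] at this
              exact this
            · intro h
              have : a i ≤ a c.castSucc := ha.monotone (by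
                rw [Fin.le_def, Fin.val_castSucc]; omega)
              omega) (fun i => by
            rw [← Fin.lt_def, ← hbm.lt_iff_lt]
            have := hvb i
            constructor <;> intro <;> omega)
        have h2 := hB2 _ (mem_image_of_mem b (mem_univ c))
        rw [Int.even_iff] at h2
        push_cast at this
        omega

end

/-! ### Determinants at sets of positions, and their transfer through a strip -/

/-- The determinant of the values of the functions `φ` at the elements of `A`. -/
noncomputable def detAt {k : ℕ} (φ : Fin k → ℤ → K) (A : Finset ℤ) : K :=
  if h : #A = k then (Matrix.of fun r c => φ r (A.orderEmbOfFin h c)).det else 0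

theorem detAt_image {k : ℕ} (φ : Fin k → ℤ → K) {a : Fin k → ℤ} (ha : StrictMono a) :
    detAt φ (univ.image a) = (Matrix.of fun r c => φ r (a c)).det := by
  have h : #(univ.image a) = k := by
    rw [card_image_of_injective _ ha.injective, card_univ, Fintype.card_fin]
  have : a = (univ.image a).orderEmbOfFin h :=
    orderEmbOfFin_unique h (fun x => mem_image_of_mem a (mem_univ x)) ha
  rw [detAt, dif_pos h, ← this]

theorem detAt_of_card_ne {k : ℕ} (φ : Fin k → ℤ → K) {A : Finset ℤ} (h : #A ≠ k) :
    detAt φ A = 0 := dif_neg h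

theorem exists_strictMono {k : ℕ} {A : Finset ℤ} (h : #A = k) :
    ∃ a : Fin k → ℤ, StrictMono a ∧ A = univ.image a :=
  ⟨A.orderEmbOfFin h, (A.orderEmbOfFin h).strictMono, (image_orderEmbOfFin_univ A h).symm⟩

/-- Multilinearity in the columns: a determinant of sums over intervals becomes a sum over choices
of one position in each interval. -/
theorem det_sum_columns {k : ℕ} (φ : Fin k → ℤ → K) (g : ℤ → K) (I : Fin k → Finset ℤ) :
    (Matrix.of fun r c => ∑ v ∈ I c, g v * φ r v).det =
      ∑ b ∈ Fintype.piFinset I, (∏ c, g (b c)) * (Matrix.of fun r c => φ r (b c)).det := by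
  rw [← Matrix.det_transpose]
  have h1 : (Matrix.of fun r c => ∑ v ∈ I c, g v * φ r v).transpose =
      fun c => ∑ v ∈ I c, g v • (fun r => φ r v) := by
    ext c r
    simp [Matrix.transpose_apply, Finset.sum_apply]
  rw [h1]
  change Matrix.detRowAlternating.toMultilinearMap _ = _
  rw [MultilinearMap.map_sum_finset]
  refine sum_congr rfl fun b _ => ?_
  rw [MultilinearMap.map_smul_univ, smul_eq_mul, ← Matrix.det_transpose (Matrix.of _)]
  rfl

/-- Differences of consecutive columns. -/
theorem det_cons_one {k : ℕ} (Φ : Fin k → ℤ → K) (a : Fin (k + 1) → ℤ) :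
    (Matrix.of fun (r : Fin (k + 1)) c =>
      (Fin.cons (fun _ => 1) Φ : Fin (k + 1) → ℤ → K) r (a c)).det =
      (Matrix.of fun r c => Φ r (a (Fin.succ c)) - Φ r (a (Fin.castSucc c))).det := by
  set M : Matrix (Fin (k + 1)) (Fin (k + 1)) K :=
    Matrix.of fun r c => (Fin.cons (fun _ => 1) Φ : Fin (k + 1) → ℤ → K) r (a c) with hM
  set N : Matrix (Fin (k + 1)) (Fin (k + 1)) K :=
    Matrix.of fun r => Fin.cons (M r 0) (fun c => M r c.succ - M r c.castSucc) with hN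
  -- Subtracting from each column the preceding one turns the first row into (1, 0, …, 0).
  rw [Matrix.det_eq_of_forall_col_eq_smul_add_pred (A := M) (B := N) (fun _ => 1)
    (fun i => by simp [hN]) (fun i j => by simp [hN]), Matrix.det_succ_row_zero]
  rw [Fin.sum_univ_succ]
  simp [hN, hM, Matrix.submatrix]

/-- The weighted sums of a function over the positions of one parity left of `x`. -/
noncomputable def cumul (g : ℤ → K) (p : ℤ) (φ : ℤ → K) (x : ℤ) : K :=
  ∑ v ∈ (Ico p x).filter (fun v => ¬ Even (v - p)), g v * φ v

open Classical in
/-- Transfer through a strip with a new particle. -/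
theorem transfer_new {k : ℕ} (φ : Fin k → ℤ → K) (g : ℤ → K) {p P : ℤ} (hpP : p ≤ P + 1)
    (hP : Even (P - p)) {A : Finset ℤ} (hA : A ⊆ Icc p P) (hA2 : ∀ x ∈ A, Even (x - p)) :
    ∑ B ∈ ((Icc p P).filter (fun x => ¬ Even (x - p))).powerset,
      (∏ b ∈ B, g b) * (detAt φ B * if Pairable (Icc p P \ (A ∪ B)) then 1 else 0) =
    detAt (Fin.cons (fun _ => 1) (fun r => cumul g p (φ r)) : Fin (k + 1) → ℤ → K) A := by
  have hBs : ∀ B ∈ ((Icc p P).filter (fun x => ¬ Even (x - p))).powerset,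
      B ⊆ Icc p P ∧ ∀ x ∈ B, ¬ Even (x - p) := by
    intro B hB
    rw [mem_powerset] at hB
    exact ⟨hB.trans (filter_subset _ _), fun x hx => (mem_filter.mp (hB hx)).2⟩
  by_cases hk : #A = k + 1
  · obtain ⟨a, ha, rfl⟩ := exists_strictMono hk
    have hac : ∀ c, a c ∈ Icc p P := fun c => hA (mem_image_of_mem a (mem_univ c))
    have hac2 : ∀ c, Even (a c - p) := fun c => hA2 _ (mem_image_of_mem a (mem_univ c))
    rw [detAt_image _ ha, det_cons_one]
    -- The difference of partial sums at consecutive particles is the sum over the gap between them,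
    -- so expanding the determinant lists exactly the interlacing configurations.
    have hdiff : ∀ (r c : Fin k), cumul g p (φ r) (a c.succ) - cumul g p (φ r) (a c.castSucc) =
        ∑ v ∈ gap p a c, g v * φ r v := by
      intro r c
      have h1 := mem_Icc.mp (hac c.castSucc)
      have h2 : a c.castSucc < a c.succ := ha Fin.castSucc_lt_succ
      rw [sub_eq_iff_eq_add, cumul, cumul, ← sum_union]
      · refine sum_congr ?_ fun _ _ => rfl
        ext v
        simp only [gap, mem_union, mem_filter, mem_Ico, mem_Ioo, ← or_and_right]
        refine and_congr_left fun hv => ?_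
        have : v ≠ a c.castSucc := fun h => hv (h ▸ hac2 _)
        omega
      · rw [disjoint_left]
        intro v hv hv'
        simp only [gap, mem_filter, mem_Ico, mem_Ioo] at hv hv'
        omega
    simp only [hdiff]
    rw [det_sum_columns, ← sum_filter_add_sum_filter_not _
      (fun B => Pairable (Icc p P \ (univ.image a ∪ B)))]
    rw [sum_eq_zero (s := filter (fun B => ¬ _) _), add_zero]
    · symm
      refine sum_nbij (fun b => univ.image b) ?_ ?_ ?_ ?_
      · intro b hb
        rw [Fintype.mem_piFinset] at hb
        have hB : univ.image b ⊆ (Icc p P).filter (fun x => ¬ Even (x - p)) := by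
          intro x hx
          obtain ⟨c, -, rfl⟩ := mem_image.mp hx
          have h1 := mem_filter.mp (hb c)
          have h2 := mem_Ioo.mp h1.1
          have h3 := mem_Icc.mp (hac c.castSucc)
          have h4 := mem_Icc.mp (hac c.succ)
          exact mem_filter.mpr ⟨mem_Icc.mpr ⟨by omega, by omega⟩, h1.2⟩
        rw [mem_filter, mem_powerset]
        refine ⟨hB, ?_⟩
        have := hBs _ (mem_powerset.mpr hB)
        exact (pairable_iff ha hpP hP hac this.1 hac2 this.2).mpr ⟨b, hb, rfl⟩
      · intro b hb b' hb' h
        rw [mem_coe, Fintype.mem_piFinset] at hb hb'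
        have m1 := strictMono_of_mem_gap ha hb
        have m2 := strictMono_of_mem_gap ha hb'
        have hr : Set.range b = Set.range b' := by
          have := congrArg (fun s : Finset ℤ => (s : Set ℤ)) h
          simpa using this
        exact (StrictMono.range_inj m1 m2).mp hr
      · intro B hB
        rw [mem_coe, mem_filter] at hB
        have h1 := hBs B hB.1
        obtain ⟨b, hb, rfl⟩ := (pairable_iff ha hpP hP hac h1.1 hac2 h1.2).mp hB.2
        exact ⟨b, by rw [mem_coe, Fintype.mem_piFinset]; exact hb, rfl⟩
      · intro b hb
        rw [Fintype.mem_piFinset] at hb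
        have hbm := strictMono_of_mem_gap ha hb
        have hpr : Pairable (Icc p P \ (univ.image a ∪ univ.image b)) := by
          refine (pairable_iff ha hpP hP hac ?_ hac2 ?_).mpr ⟨b, hb, rfl⟩
          · intro x hx
            obtain ⟨c, -, rfl⟩ := mem_image.mp hx
            have h2 := mem_Ioo.mp (mem_filter.mp (hb c)).1
            have h3 := mem_Icc.mp (hac c.castSucc)
            have h4 := mem_Icc.mp (hac c.succ)
            exact mem_Icc.mpr ⟨by omega, by omega⟩
          · intro x hx
            obtain ⟨c, -, rfl⟩ := mem_image.mp hx
            exact (mem_filter.mp (hb c)).2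
        rw [if_pos hpr, mul_one, detAt_image _ hbm,
          prod_image (fun x _ y _ h => hbm.injective h)]
    · intro B hB
      rw [if_neg (mem_filter.mp hB).2, mul_zero, mul_zero]
  · rw [detAt_of_card_ne _ hk]
    refine sum_eq_zero fun B hB => ?_
    have h1 := hBs B hB
    split_ifs with h
    · have := h.card_eq hpP hP hA h1.1 hA2 h1.2
      rw [detAt_of_card_ne _ (by omega)]; ring
    · ring

/-- At the additional leftmost position only the constant function is nonzero, so expansion along
that column removes both. -/
theorem detAt_cons_insert {k : ℕ} (Φ : Fin k → ℤ → K) {x : ℤ} {A : Finset ℤ} (hx : ∀ a ∈ A, x < a)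
    (h0 : ∀ r, Φ r x = 0) :
    detAt (Fin.cons (fun _ => 1) Φ : Fin (k + 1) → ℤ → K) (insert x A) = detAt Φ A := by
  have hxA : x ∉ A := fun h => lt_irrefl _ (hx x h)
  by_cases hk : #A = k
  · obtain ⟨a, ha, rfl⟩ := exists_strictMono hk
    have hm : StrictMono (Fin.cons x a : Fin (k + 1) → ℤ) := by
      intro i j hij
      refine Fin.cases ?_ (fun j => ?_) j hij
      · intro h; exact absurd h (Fin.not_lt_zero _)
      · intro h
        refine Fin.cases ?_ (fun i => ?_) i h
        · intro _; simpa using hx _ (mem_image_of_mem a (mem_univ j))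
        · intro h; simpa using ha (Fin.succ_lt_succ_iff.mp h)
    have himg : insert x (univ.image a) = univ.image (Fin.cons x a : Fin (k + 1) → ℤ) := by
      ext y
      simp only [mem_insert, mem_image, mem_univ, true_and, Fin.exists_fin_succ, Fin.cons_zero,
        Fin.cons_succ, eq_comm]
    rw [himg, detAt_image _ hm, detAt_image _ ha, Matrix.det_succ_column_zero, Fin.sum_univ_succ]
    simp [h0, Matrix.submatrix]
  · rw [detAt_of_card_ne _ hk, detAt_of_card_ne]
    rw [card_insert_of_notMem hxA]
    omega

open Classical in
/-- Transfer through a strip without a new particle. -/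
theorem transfer_old {k : ℕ} (φ : Fin k → ℤ → K) (g : ℤ → K) {p P : ℤ} (hpP : p ≤ P + 1)
    (hP : ¬ Even (P - p)) {A : Finset ℤ} (hA : A ⊆ Icc p P) (hA2 : ∀ x ∈ A, ¬ Even (x - p)) :
    ∑ B ∈ ((Icc p P).filter (fun x => Even (x - p))).powerset,
      (∏ b ∈ B, g b) * (detAt φ B * if Pairable (Icc p P \ (A ∪ B)) then 1 else 0) =
    detAt (fun r => cumul g (p - 1) (φ r)) A := by
  have hpar : ∀ x, ¬ Even (x - (p - 1)) ↔ Even (x - p) := fun x => by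
    rw [Int.even_iff, Int.even_iff]; omega
  -- A virtual particle at p - 1, just outside the strip, reduces this case to the preceding one;
  -- the partial sums vanish there because they are empty.
  have h1 := transfer_new φ g (p := p - 1) (P := P) (A := insert (p - 1) A) (by omega)
    (by by_contra h; exact hP ((hpar P).mp h))
    (by
      rw [insert_subset_iff, mem_Icc]
      refine ⟨⟨le_rfl, by omega⟩, hA.trans (Icc_subset_Icc_left (by omega))⟩)
    (by
      intro x hx
      rcases mem_insert.mp hx with rfl | hx
      · simp
      · by_contra h; exact hA2 x hx ((hpar x).mp h))
  rw [detAt_cons_insert _ (fun a ha => by have := (mem_Icc.mp (hA ha)).1; omega)] at h1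
  · rw [← h1]
    have hf : (Icc (p - 1) P).filter (fun x => ¬ Even (x - (p - 1))) =
        (Icc p P).filter (fun x => Even (x - p)) := by
      ext x
      simp only [mem_filter, mem_Icc, hpar]
      refine and_congr_left fun h => ?_
      have : x ≠ p - 1 := by rintro rfl; simp at h
      omega
    rw [hf]
    refine sum_congr rfl fun B hB => ?_
    have hset : Icc (p - 1) P \ (insert (p - 1) A ∪ B) = Icc p P \ (A ∪ B) := by
      ext x
      simp only [mem_sdiff, mem_Icc, mem_union, mem_insert, not_or]
      constructor
      · rintro ⟨a, ⟨b, c⟩, d⟩; exact ⟨by omega, c, d⟩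
      · rintro ⟨a, b, c⟩; exact ⟨by omega, ⟨by omega, b⟩, c⟩
    rw [hset]
  · intro r; simp [cumul]

open Classical in
/-- Forced particles beyond the right end of a strip. -/
theorem sum_extend {k : ℕ} (φ : Fin k → ℤ → K) (g : ℤ → K) (Q : ℤ → Prop)
    [DecidablePred Q] (hQ : ∀ x, Q (x + 1) ↔ ¬ Q x) {p p' P : ℤ} (hp : p ≤ p' + 1) (hp' : p' ≤ P)
    (hP : ¬ Q P) (h1 : p' < P → ¬ Q (p' + 1)) {A : Finset ℤ}
    (hA : A ⊆ Icc p p') :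
    (∑ B ∈ ((Icc p p').filter Q).powerset, (∏ b ∈ B, g b) *
        (detAt φ (B ∪ (Icc (p' + 1) P).filter Q) *
          if Pairable (Icc p p' \ (A ∪ B)) then 1 else 0)) *
        ∏ b ∈ (Icc (p' + 1) P).filter Q, g b =
    ∑ B ∈ ((Icc p P).filter Q).powerset, (∏ b ∈ B, g b) * (detAt φ B *
      if Pairable (Icc p P \ ((A ∪ (Icc (p' + 1) P).filter (fun x => ¬ Q x)) ∪ B)) then 1 else 0) := by
  set X := (Icc (p' + 1) P).filter Q with hX
  set X' := (Icc (p' + 1) P).filter (fun x => ¬ Q x) with hX'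
  -- Beyond p', the positions without property Q are all occupied from the other line. A free
  -- position with property Q would have occupied neighbors on both sides and could not be paired,
  -- so all such positions carry particles.
  have hforce : ∀ B, Pairable (Icc p P \ ((A ∪ X') ∪ B)) → X ⊆ B := by
    intro B hB x hx
    by_contra hxB
    rw [hX, mem_filter, mem_Icc] at hx
    obtain ⟨⟨hx1, hx2⟩, hx3⟩ := hx
    have hxP : x ≠ P := by rintro rfl; exact hP hx3
    have hx4 : x ≠ p' + 1 := by rintro rfl; exact h1 (by omega) hx3
    have mem1 : x + 1 ∈ X' := by
      rw [hX', mem_filter, mem_Icc, hQ, not_not]; exact ⟨by omega, hx3⟩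
    have mem2 : x - 1 ∈ X' := by
      rw [hX', mem_filter, mem_Icc]
      refine ⟨by omega, ?_⟩
      rw [← hQ, sub_add_cancel]; exact hx3
    have hxS : x ∈ Icc p P \ ((A ∪ X') ∪ B) := by
      rw [mem_sdiff, mem_union, mem_union, not_or, not_or, mem_Icc]
      refine ⟨by omega, ⟨fun h => ?_, fun h => (mem_filter.mp h).2 hx3⟩, hxB⟩
      have := (mem_Icc.mp (hA h)).2
      omega
    have hnot : ∀ y ∈ X', y ∉ Icc p P \ ((A ∪ X') ∪ B) := by
      intro y hy h
      rw [mem_sdiff, mem_union, mem_union] at h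
      exact h.2 (Or.inl (Or.inr hy))
    have hr := hB.even_of_notMem (hnot _ mem2)
    have h3 := card_filter_lt_add_one (Icc p P \ ((A ∪ X') ∪ B)) (x - 1)
    rw [if_neg (hnot _ mem2), sub_add_cancel, add_zero] at h3
    rw [← h3] at hr
    exact hnot _ mem1 (hB x hxS hr)
  have hdisj : ∀ B ∈ ((Icc p p').filter Q).powerset, Disjoint B X := by
    intro B hB
    rw [disjoint_left]
    intro x hx hx'
    have a1 := (mem_Icc.mp (mem_filter.mp (mem_powerset.mp hB hx)).1).2
    have a2 := (mem_Icc.mp (mem_filter.mp hx').1).1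
    omega
  rw [← sum_filter_add_sum_filter_not (((Icc p P).filter Q).powerset) (fun B => X ⊆ B)]
  rw [sum_eq_zero (s := filter (fun B => ¬ _) _), add_zero, sum_mul]
  · refine sum_bij' (fun B _ => B ∪ X) (fun B _ => B \ X) ?_ ?_ ?_ ?_ ?_
    · intro B hB
      rw [mem_powerset] at hB
      rw [mem_filter, mem_powerset]
      refine ⟨union_subset (hB.trans ?_) ?_, subset_union_right⟩
      · exact filter_subset_filter _ (Icc_subset_Icc_right hp')
      · exact filter_subset_filter _ (Icc_subset_Icc_left (by omega))
    · intro B hB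
      rw [mem_filter, mem_powerset] at hB
      rw [mem_powerset]
      intro x hx
      rw [mem_sdiff] at hx
      have h2 := mem_filter.mp (hB.1 hx.1)
      have h3 := mem_Icc.mp h2.1
      refine mem_filter.mpr ⟨mem_Icc.mpr ⟨h3.1, ?_⟩, h2.2⟩
      by_contra hlt
      exact hx.2 (mem_filter.mpr ⟨mem_Icc.mpr ⟨by omega, h3.2⟩, h2.2⟩)
    · intro B hB
      rw [union_sdiff_right, (hdisj B hB).sdiff_eq_left]
    · intro B hB
      exact sdiff_union_of_subset (mem_filter.mp hB).2
    · intro B hB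
      have hset : Icc p P \ ((A ∪ X') ∪ (B ∪ X)) = Icc p p' \ (A ∪ B) := by
        ext x
        simp only [mem_sdiff, mem_union, not_or, hX, hX', mem_filter, mem_Icc]
        constructor
        · rintro ⟨a, ⟨b, c⟩, d, e⟩
          refine ⟨⟨a.1, ?_⟩, b, d⟩
          by_contra hlt
          have hm : p' + 1 ≤ x ∧ x ≤ P := ⟨by omega, a.2⟩
          by_cases hq : Q x
          · exact e ⟨hm, hq⟩
          · exact c ⟨hm, hq⟩
        · rintro ⟨a, b, c⟩
          refine ⟨⟨a.1, by omega⟩, ⟨b, fun h => ?_⟩, c, fun h => ?_⟩ <;> omega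
      rw [hset, prod_union (hdisj B hB)]
      ring
  · intro B hB
    rw [mem_filter] at hB
    rw [if_neg fun h => hB.2 (hforce B h), mul_zero, mul_zero]

/-! ### Regions consisting of strips -/

theorem detAt_congr {k : ℕ} {φ ψ : Fin k → ℤ → K} {A : Finset ℤ}
    (h : ∀ r, ∀ x ∈ A, φ r x = ψ r x) : detAt φ A = detAt ψ A := by
  unfold detAt
  split_ifs with hk
  · congr 1
    ext r c
    exact h r _ (orderEmbOfFin_mem A hk c)
  · rfl

/-- The weighted sums of a function over the positions with property `Q` left of `x`. -/
noncomputable def cumulAt (g : ℤ → K) (Q : ℤ → Prop) [DecidablePred Q] (p : ℤ) (φ : ℤ → K)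
    (x : ℤ) : K :=
  ∑ v ∈ (Ico p x).filter Q, g v * φ v

theorem even_sub_iff_of_alternating {Q : ℤ → Prop} (hQ : ∀ x, Q (x + 1) ↔ ¬ Q x) (p x : ℤ) :
    (Q x ↔ Q p) ↔ Even (x - p) := by
  induction x using Int.induction_on with
  | zero =>
    induction p using Int.induction_on with
    | zero => simp
    | succ n ih =>
      rw [hQ, show (0 : ℤ) - (n + 1) = 0 - n - 1 by ring, Int.even_sub_one, ← ih]; tauto
    | pred n ih =>
      have := hQ (-n - 1)
      rw [sub_add_cancel] at this
      rw [show (0 : ℤ) - (-n - 1) = 0 - -n + 1 by ring, Int.even_add_one, ← ih]; tauto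
  | succ n ih =>
    rw [hQ, show (n + 1 : ℤ) - p = n - p + 1 by ring, Int.even_add_one, ← ih]; tauto
  | pred n ih =>
    have := hQ (-n - 1)
    rw [sub_add_cancel] at this
    rw [show (-n - 1 : ℤ) - p = -n - p - 1 by ring, Int.even_sub_one, ← ih]; tauto

section
variable {Q : ℤ → Prop} [DecidablePred Q] {p p' P : ℤ} {O A : Finset ℤ} {k : ℕ}
  {φ : Fin k → ℤ → K} {F : Finset ℤ → K} {c : K} {w : ℤ → K}

open Classical in
/-- The positions of the old line that are available. -/
theorem sum_available (hO : O ⊆ (Icc p p').filter Q)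
    (hF : ∀ B ⊆ O, F B * c = detAt φ (B ∪ (Icc (p' + 1) P).filter Q)) :
    (∑ B ∈ O.powerset, (∏ b ∈ B, w b) * (F B * if Pairable (Icc p p' \ (A ∪ B)) then 1 else 0)) * c =
    ∑ B ∈ ((Icc p p').filter Q).powerset,
      (∏ b ∈ B, (if b ∈ O ∨ p' < b then w b else 0)) *
        (detAt φ (B ∪ (Icc (p' + 1) P).filter Q) *
          if Pairable (Icc p p' \ (A ∪ B)) then 1 else 0) := by
  rw [← sum_subset (powerset_mono.mpr hO), sum_mul]
  · refine sum_congr rfl fun B hB => ?_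
    rw [mem_powerset] at hB
    rw [← hF B hB, prod_congr rfl fun b hb => if_pos (Or.inl (hB hb))]
    ring
  · intro B hB hB'
    rw [mem_powerset] at hB hB'
    -- Unavailable positions are admitted with weight 0, so that the sum runs over a full interval
    -- of one parity.
    obtain ⟨b, hb, hbO⟩ := not_subset.mp hB'
    have := (mem_Icc.mp (mem_filter.mp (hB hb)).1).2
    rw [prod_eq_zero hb (by rw [if_neg]; push Not; exact ⟨hbO, this⟩), zero_mul]

-- One step of the line-by-line summation. F is the state sum of the old line, c the accumulated
-- weight of the forced particles, p' the end of the actual strip and P the end of the wedge to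
-- which it is extended. A strip that begins at the parity of the new line has one more particle
-- there than on the old line, hence the additional constant function.
open Classical in
theorem step_new (hQ : ∀ x, Q (x + 1) ↔ ¬ Q x) (hp : p ≤ p' + 1) (hp' : p' ≤ P)
    (hP : ¬ Q P) (h1 : p' < P → ¬ Q (p' + 1)) (hQp : ¬ Q p)
    (hO : O ⊆ (Icc p p').filter Q)
    (hF : ∀ B ⊆ O, F B * c = detAt φ (B ∪ (Icc (p' + 1) P).filter Q))
    (hA : ∀ x ∈ A, x ∈ Icc p p' ∧ ¬ Q x) {φ' : Fin (k + 1) → ℤ → K} (h0 : ∀ x, φ' 0 x = 1)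
    (hφ : ∀ r : Fin k, ∀ x ∈ Icc p P, ¬ Q x →
      cumulAt (fun b => if b ∈ O ∨ p' < b then w b else 0) Q p (φ r) x = φ' r.succ x) :
    (∑ B ∈ O.powerset, (∏ b ∈ B, w b) *
        (F B * if Pairable (Icc p p' \ (A ∪ B)) then 1 else 0)) *
        (c * ∏ b ∈ (Icc (p' + 1) P).filter Q, w b) =
      detAt φ' (A ∪ (Icc (p' + 1) P).filter (fun x => ¬ Q x)) := by
  have hpar : ∀ x, ¬ Even (x - p) ↔ Q x := fun x => by
    rw [← even_sub_iff_of_alternating hQ]; tauto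
  have hw : ∏ b ∈ (Icc (p' + 1) P).filter Q, w b =
      ∏ b ∈ (Icc (p' + 1) P).filter Q, (if b ∈ O ∨ p' < b then w b else 0) := by
    refine prod_congr rfl fun b hb => ?_
    have := (mem_Icc.mp (mem_filter.mp hb).1).1
    rw [if_pos (Or.inr (by omega))]
  have hAX : A ∪ (Icc (p' + 1) P).filter (fun x => ¬ Q x) ⊆ Icc p P := by
    refine union_subset (fun x hx => ?_) ((filter_subset _ _).trans (Icc_subset_Icc_left (by omega)))
    have := mem_Icc.mp (hA x hx).1
    exact mem_Icc.mpr ⟨this.1, this.2.trans hp'⟩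
  have hAQ : ∀ x ∈ A ∪ (Icc (p' + 1) P).filter (fun x => ¬ Q x), ¬ Q x := by
    intro x hx
    rcases mem_union.mp hx with hx | hx
    exacts [(hA x hx).2, (mem_filter.mp hx).2]
  rw [← mul_assoc, sum_available hO hF, hw, sum_extend φ _ Q hQ hp hp' hP h1 fun x hx => (hA x hx).1]
  have := transfer_new φ (fun b => if b ∈ O ∨ p' < b then w b else 0) (p := p) (P := P)
    (by omega) (by rw [← not_not (a := Even _), hpar]; exact hP) hAX
    (by intro x hx; rw [← not_not (a := Even _), hpar]; exact hAQ x hx)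
  simp only [hpar] at this
  rw [this]
  refine detAt_congr fun r x hx => ?_
  refine Fin.cases ?_ (fun r => ?_) r
  · rw [Fin.cons_zero, h0]
  · rw [Fin.cons_succ, ← hφ r x (hAX hx) (hAQ x hx)]
    simp only [cumul, cumulAt, hpar]

-- The same step for a strip that begins at the parity of the old line; here both lines have equally
-- many particles.
open Classical in
theorem step_old (hQ : ∀ x, Q (x + 1) ↔ ¬ Q x) (hp : p ≤ p' + 1) (hp' : p' ≤ P)
    (hP : ¬ Q P) (h1 : p' < P → ¬ Q (p' + 1)) (hQp : Q p)
    (hO : O ⊆ (Icc p p').filter Q)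
    (hF : ∀ B ⊆ O, F B * c = detAt φ (B ∪ (Icc (p' + 1) P).filter Q))
    (hA : ∀ x ∈ A, x ∈ Icc p p' ∧ ¬ Q x) {φ' : Fin k → ℤ → K}
    (hφ : ∀ r : Fin k, ∀ x ∈ Icc p P, ¬ Q x →
      cumulAt (fun b => if b ∈ O ∨ p' < b then w b else 0) Q p (φ r) x = φ' r x) :
    (∑ B ∈ O.powerset, (∏ b ∈ B, w b) *
        (F B * if Pairable (Icc p p' \ (A ∪ B)) then 1 else 0)) *
        (c * ∏ b ∈ (Icc (p' + 1) P).filter Q, w b) =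
      detAt φ' (A ∪ (Icc (p' + 1) P).filter (fun x => ¬ Q x)) := by
  have hpar : ∀ x, Even (x - p) ↔ Q x := fun x => by
    rw [← even_sub_iff_of_alternating hQ]; tauto
  have hpar' : ∀ x, ¬ Even (x - (p - 1)) ↔ Q x := fun x => by
    rw [← hpar, Int.even_iff, Int.even_iff]; omega
  have hw : ∏ b ∈ (Icc (p' + 1) P).filter Q, w b =
      ∏ b ∈ (Icc (p' + 1) P).filter Q, (if b ∈ O ∨ p' < b then w b else 0) := by
    refine prod_congr rfl fun b hb => ?_
    have := (mem_Icc.mp (mem_filter.mp hb).1).1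
    rw [if_pos (Or.inr (by omega))]
  have hAX : A ∪ (Icc (p' + 1) P).filter (fun x => ¬ Q x) ⊆ Icc p P := by
    refine union_subset (fun x hx => ?_) ((filter_subset _ _).trans (Icc_subset_Icc_left (by omega)))
    have := mem_Icc.mp (hA x hx).1
    exact mem_Icc.mpr ⟨this.1, this.2.trans hp'⟩
  have hAQ : ∀ x ∈ A ∪ (Icc (p' + 1) P).filter (fun x => ¬ Q x), ¬ Q x := by
    intro x hx
    rcases mem_union.mp hx with hx | hx
    exacts [(hA x hx).2, (mem_filter.mp hx).2]
  rw [← mul_assoc, sum_available hO hF, hw, sum_extend φ _ Q hQ hp hp' hP h1 fun x hx => (hA x hx).1]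
  have := transfer_old φ (fun b => if b ∈ O ∨ p' < b then w b else 0) (p := p) (P := P)
    (by omega) (by rw [hpar]; exact hP) hAX
    (by intro x hx; rw [hpar]; exact hAQ x hx)
  simp only [hpar] at this
  rw [this]
  refine detAt_congr fun r x hx => ?_
  rw [← hφ r x (hAX hx) (hAQ x hx), cumul, cumulAt]
  refine sum_congr ?_ fun _ _ => rfl
  ext v
  simp only [mem_filter, mem_Ico, hpar']
  refine and_congr_left fun hv => ?_
  have : v ≠ p - 1 := by
    rintro rfl
    rw [← hpar, Int.even_iff] at hv
    omega
  omega

end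

/-- Telescoping over the positions of one parity. -/
theorem sum_telescope (f u : ℤ → K) {Q : ℤ → Prop} [DecidablePred Q] (hQ : ∀ x, Q (x + 1) ↔ ¬ Q x)
    {p y x : ℤ} (hp : p ≤ y) (hy : y ≤ p + 1) (hQy : Q y) (hx : y - 1 ≤ x) (hQx : ¬ Q x)
    (h : ∀ v, y ≤ v → v < x → Q v → f (v + 1) - f (v - 1) = u v) :
    ∑ v ∈ (Ico p x).filter Q, u v = f x - f (y - 1) := by
  have hset : (Ico p x).filter Q = (Ico y x).filter Q := by
    ext v
    simp only [mem_filter, mem_Ico]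
    refine and_congr_left fun hv => ?_
    constructor
    · rintro ⟨a, b⟩
      refine ⟨?_, b⟩
      by_contra hlt
      have : y = v + 1 := by omega
      rw [this, hQ] at hQy
      exact hQy hv
    · rintro ⟨a, b⟩; exact ⟨hp.trans a, b⟩
  -- Here y is the first position with property Q in the range, so the surviving boundary term is
  -- taken at y - 1, possibly left of p.
  rw [hset]
  have hpar := (even_sub_iff_of_alternating hQ y x).not
  have hev : Even (x - (y - 1)) := by
    have : ¬ Even (x - y) := hpar.mp (by tauto)
    rw [Int.even_iff] at *; omega
  obtain ⟨N, hN⟩ : ∃ N : ℕ, x = y - 1 + 2 * N := by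
    obtain ⟨e, he⟩ := hev
    exact ⟨e.toNat, by omega⟩
  subst hN
  clear hev hx hpar hset
  induction N with
  | zero => simp
  | succ N ih =>
    have hQ2 : ¬ Q (y - 1 + 2 * N) := by
      have e1 : y - 1 + 2 * ((N + 1 : ℕ) : ℤ) = y - 1 + 2 * N + 1 + 1 := by push_cast; ring
      rw [e1, hQ, hQ, not_not] at hQx
      exact hQx
    have hset : (Ico y (y - 1 + 2 * ((N + 1 : ℕ) : ℤ))).filter Q =
        insert (y - 1 + 2 * N + 1) ((Ico y (y - 1 + 2 * N)).filter Q) := by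
      ext v
      simp only [mem_filter, mem_insert, mem_Ico]
      constructor
      · rintro ⟨a, b⟩
        have : v ≠ y - 1 + 2 * N := by rintro rfl; exact hQ2 b
        push_cast at a
        by_cases hv : v = y - 1 + 2 * N + 1
        · exact Or.inl hv
        · exact Or.inr ⟨by omega, b⟩
      · rintro (rfl | ⟨a, b⟩)
        · exact ⟨by push_cast; omega, (hQ _).mpr hQ2⟩
        · exact ⟨by push_cast; omega, b⟩
    rw [hset, sum_insert (by simp), ih hQ2 (fun v h1 h2 h3 => h v h1 (by push_cast; omega) h3),
      ← h (y - 1 + 2 * N + 1) (by omega) (by push_cast; omega) ((hQ _).mpr hQ2)]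
    have e1 : y - 1 + 2 * ((N + 1 : ℕ) : ℤ) = y - 1 + 2 * N + 1 + 1 := by push_cast; ring
    rw [e1, add_sub_cancel_right]
    ring

/-- A region whose strip above height `j` consists of the positions from `lo j` to `hi j`. -/
structure IsStrips (R : Finset UnitTriangle) (W : ℤ) (lo hi : ℤ → ℤ) : Prop where
  onLattice : OnLattice R
  mem : ∀ i j, cell i j ∈ R ↔ (0 ≤ j ∧ j < W) ∧ i ∈ Icc (lo j) (hi j)

/-- The tilings of the part of a region below height `j`, with particles `A` at height `j`. -/
noncomputable def lowSum (q : K) (R : Finset UnitTriangle) (j : ℤ) (A : Finset ℤ) : K :=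
  tilingGF (R.filter (fun t => t.j < j) \ A.image (cell · (j - 1))) (wt2 q)

/-- The tilings of the part of a region above height `j`, with particles `A` at height `j`. -/
noncomputable def upSum (q : K) (R : Finset UnitTriangle) (j : ℤ) (A : Finset ℤ) : K :=
  tilingGF (R.filter (fun t => j ≤ t.j) \ A.image (cell · j)) (wt2 q)

open Classical in
/-- The possible particles at height `j`. -/
noncomputable def sites (R : Finset UnitTriangle) (lo hi : ℤ → ℤ) (j : ℤ) : Finset ℤ :=
  (Icc (lo j) (hi j)).filter (fun i => Even (i + j) ∧ cell i j ∈ R ∧ cell i (j - 1) ∈ R)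

section
variable {R : Finset UnitTriangle} {W : ℤ} {lo hi : ℤ → ℤ}

theorem IsStrips.mem_sites (h : IsStrips R W lo hi) (i j : ℤ) :
    i ∈ sites R lo hi j ↔ Even (i + j) ∧ cell i j ∈ R ∧ cell i (j - 1) ∈ R := by
  rw [sites, mem_filter, and_iff_right_iff_imp]
  exact fun h' => ((h.mem i j).mp h'.2.1).2

theorem IsStrips.tilingGF_eq_sum (h : IsStrips R W lo hi) (q : K) (j : ℤ) :
    tilingGF R (wt2 q) = ∑ B ∈ (sites R lo hi j).powerset, (∏ i ∈ B, vertWt q i) *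
      (lowSum q R j B * upSum q R j B) :=
  tilingGF_cut q h.onLattice j _ fun i => h.mem_sites i j

theorem IsStrips.strip_eq (h : IsStrips R W lo hi) {j : ℤ} (hj : 0 ≤ j ∧ j < W) :
    R.filter (fun t => t.j = j) = (Icc (lo j) (hi j)).image (cell · j) := by
  ext t
  rw [mem_filter, mem_image]
  constructor
  · rintro ⟨h1, h2⟩
    have h3 := h.onLattice t h1
    rw [h2] at h3
    rw [h3] at h1
    exact ⟨t.i, ((h.mem _ _).mp h1).2, h3.symm⟩
  · rintro ⟨i, hi, rfl⟩
    exact ⟨(h.mem _ _).mpr ⟨hj, hi⟩, rfl⟩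

theorem IsStrips.strip_sdiff (h : IsStrips R W lo hi) {j : ℤ} (hj : 0 ≤ j ∧ j < W)
    (A B : Finset ℤ) :
    (R.filter (fun t => t.j = j) \ A.image (cell · j)) \ B.image (cell · j) =
      (Icc (lo j) (hi j) \ (A ∪ B)).image (cell · j) := by
  rw [h.strip_eq hj, ← image_sdiff _ _ (cell_injective j), ← image_sdiff _ _ (cell_injective j),
    sdiff_sdiff_left, sup_eq_union]

-- Cutting at height j isolates the top strip, whose generating function is 1 or 0. The parity
-- condition keeps the particles of the upper line away from the sites of the lower one.
open Classical in
theorem IsStrips.lowSum_succ (h : IsStrips R W lo hi) (q : K) {j : ℤ} (hj : 0 ≤ j ∧ j < W)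
    {A : Finset ℤ} (hA : ∀ i ∈ A, ¬ Even (i + j)) :
    lowSum q R (j + 1) A = ∑ B ∈ (sites R lo hi j).powerset, (∏ i ∈ B, vertWt q i) *
      (lowSum q R j B * if Pairable (Icc (lo j) (hi j) \ (A ∪ B)) then 1 else 0) := by
  rw [lowSum, tilingGF_cut q (P := sites R lo hi j) (j := j)]
  · refine sum_congr rfl fun B hB => ?_
    rw [← tilingGF_strip q j]
    congr 2
    · unfold lowSum
      congr 2
      ext t
      simp only [mem_filter, mem_sdiff, mem_image, add_sub_cancel_right]
      constructor
      · rintro ⟨⟨⟨a, b⟩, c⟩, d⟩; exact ⟨a, d⟩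
      · rintro ⟨a, b⟩
        refine ⟨⟨⟨a, by omega⟩, ?_⟩, b⟩
        rintro ⟨i, -, rfl⟩
        exact lt_irrefl _ b
    · rw [← h.strip_sdiff hj]
      congr 1
      ext t
      simp only [mem_filter, mem_sdiff, mem_image, add_sub_cancel_right]
      constructor
      · rintro ⟨⟨⟨⟨a, b⟩, c⟩, d⟩, e⟩; exact ⟨⟨⟨a, by omega⟩, c⟩, e⟩
      · rintro ⟨⟨⟨a, b⟩, c⟩, e⟩; exact ⟨⟨⟨⟨a, by omega⟩, c⟩, by omega⟩, e⟩
  · intro t ht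
    exact h.onLattice t (mem_filter.mp (mem_sdiff.mp ht).1).1
  · intro i
    rw [h.mem_sites]
    simp only [mem_sdiff, mem_filter, add_sub_cancel_right]
    refine and_congr_right fun hi => ⟨fun ⟨a, b⟩ => ⟨⟨⟨a, by simp [cell]⟩, ?_⟩,
      ⟨b, by simp [cell]⟩, ?_⟩, fun ⟨a, b⟩ => ⟨a.1.1, b.1.1⟩⟩
    · intro hm
      obtain ⟨i', hi', he⟩ := mem_image.mp hm
      rw [cell_injective j he] at hi'
      exact hA i hi' hi
    · intro hm
      obtain ⟨i', hi', he⟩ := mem_image.mp hm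
      have := congrArg UnitTriangle.j he
      simp only [cell] at this
      omega

-- The reflection of the preceding recursion: the lowest strip is split off from above.
open Classical in
theorem IsStrips.upSum_pred (h : IsStrips R W lo hi) (q : K) {j : ℤ} (hj : 0 ≤ j ∧ j < W)
    {A : Finset ℤ} (hA : ∀ i ∈ A, Even (i + j)) :
    upSum q R j A = ∑ B ∈ (sites R lo hi (j + 1)).powerset, (∏ i ∈ B, vertWt q i) *
      (upSum q R (j + 1) B * if Pairable (Icc (lo j) (hi j) \ (A ∪ B)) then 1 else 0) := by
  rw [upSum, tilingGF_cut q (P := sites R lo hi (j + 1)) (j := j + 1)]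
  · refine sum_congr rfl fun B hB => ?_
    rw [← tilingGF_strip q j, mul_comm (tilingGF _ _)]
    congr 2
    · unfold upSum
      congr 2
      ext t
      simp only [mem_filter, mem_sdiff, mem_image]
      constructor
      · rintro ⟨⟨⟨a, b⟩, c⟩, d⟩; exact ⟨a, d⟩
      · rintro ⟨a, b⟩
        refine ⟨⟨⟨a, by omega⟩, ?_⟩, b⟩
        rintro ⟨i, -, rfl⟩
        simp [cell] at b
    · rw [← h.strip_sdiff hj]
      congr 1
      ext t
      simp only [mem_filter, mem_sdiff, mem_image, add_sub_cancel_right]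
      constructor
      · rintro ⟨⟨⟨⟨a, b⟩, c⟩, d⟩, e⟩; exact ⟨⟨⟨a, by omega⟩, c⟩, e⟩
      · rintro ⟨⟨⟨a, b⟩, c⟩, e⟩; exact ⟨⟨⟨⟨a, by omega⟩, c⟩, by omega⟩, e⟩
  · intro t ht
    exact h.onLattice t (mem_filter.mp (mem_sdiff.mp ht).1).1
  · intro i
    rw [h.mem_sites]
    simp only [mem_sdiff, mem_filter, add_sub_cancel_right]
    refine and_congr_right fun hi => ⟨fun ⟨a, b⟩ => ⟨⟨⟨a, by simp [cell]⟩, ?_⟩,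
      ⟨b, by simp [cell]⟩, ?_⟩, fun ⟨a, b⟩ => ⟨a.1.1, b.1.1⟩⟩
    · intro hm
      obtain ⟨i', hi', he⟩ := mem_image.mp hm
      have := congrArg UnitTriangle.j he
      simp [cell] at this
    · intro hm
      obtain ⟨i', hi', he⟩ := mem_image.mp hm
      rw [cell_injective j he] at hi'
      have := hA i hi'
      rw [Int.even_iff] at hi this
      omega

end

/-! ### The region of type `T` as a union of strips -/

/-- The last position of the strip above height `j`. -/
noncomputable def lastPos (x u d m n : ℕ) (j : ℤ) : ℤ :=
  min (1 + 2 * southSide x u d m n + j) (2 * southSide x u d m n + 2 * southeastSide d m n - j)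

theorem mem_baseHexagon {x u d m n : ℕ} (hm : m ≤ d) (hn : n ≤ u) (t : UnitTriangle) :
    t ∈ baseHexagon x u d m n ↔ t = cell t.i t.j ∧ (0 ≤ t.j ∧ t.j < westSide u d) ∧
      t.i ∈ Icc (if t.j ≤ 2 * d then 1 else 0) (lastPos x u d m n t.j) := by
  obtain ⟨up, i, j⟩ := t
  have hS : 0 ≤ southSide x u d m n := by simp only [southSide, e']; omega
  have hE : southeastSide d m n = 2 * d - m + n + 1 := rfl
  have hW : westSide u d = 2 * u + 2 * d + 1 := rfl
  -- This says that the north side has non-negative length.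
  have hN : 2 * southSide x u d m n + 2 * southeastSide d m n - westSide u d ≥ -1 := by
    simp only [southSide, southeastSide, westSide, e']; omega
  rw [baseHexagon, mem_filter, mem_image]
  simp only [lastPos, mem_product, mem_univ, true_and, mem_Icc,
    Prod.exists, UnitTriangle.mk.injEq, cell, UnitTriangle.vertices, and_true, west, east]
  constructor
  · rintro ⟨⟨up, i, j, ⟨h1, h2⟩, rfl, rfl, rfl⟩, h⟩
    cases up
    · simp only [Bool.false_eq_true, if_false, mem_insert, mem_singleton, forall_eq_or_imp,
        forall_eq] at h
      simp only [Int.odd_iff, Int.even_iff, Bool.false_eq, decide_eq_false_iff_not] at h ⊢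
      obtain ⟨⟨a1, a2, a3, a4, a5⟩, ⟨b1, b2, b3, b4, b5⟩, c1, c2, c3, c4, c5⟩ := h
      refine ⟨by omega, by omega, ?_, ?_⟩
      · split_ifs at * <;> omega
      · split_ifs at * <;> omega
    · simp only [if_true, mem_insert, mem_singleton, forall_eq_or_imp,
        forall_eq] at h
      simp only [Int.odd_iff, Int.even_iff, Bool.true_eq, decide_eq_true_eq] at h ⊢
      obtain ⟨⟨a1, a2, a3, a4, a5⟩, ⟨b1, b2, b3, b4, b5⟩, c1, c2, c3, c4, c5⟩ := h
      refine ⟨by omega, by omega, ?_, ?_⟩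
      · split_ifs at * <;> omega
      · split_ifs at * <;> omega
  · rintro ⟨h1, h2, h3⟩
    refine ⟨⟨up, i, j, ⟨?_, by omega⟩, rfl, rfl, rfl⟩, ?_⟩
    · split_ifs at h3 <;> omega
    · cases up
      · simp only [Bool.false_eq_true, if_false, mem_insert, mem_singleton, forall_eq_or_imp,
          forall_eq]
        simp only [Int.odd_iff, Int.even_iff, Bool.false_eq, decide_eq_false_iff_not] at h1 ⊢
        refine ⟨⟨by omega, by omega, by omega, ?_, ?_⟩, ⟨by omega, by omega, by omega, ?_, ?_⟩,
          by omega, by omega, by omega, ?_, ?_⟩ <;> (split_ifs at * <;> omega)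
      · simp only [if_true, mem_insert, mem_singleton, forall_eq_or_imp, forall_eq]
        simp only [Int.odd_iff, Int.even_iff, Bool.true_eq, decide_eq_true_eq] at h1 ⊢
        refine ⟨⟨by omega, by omega, by omega, ?_, ?_⟩, ⟨by omega, by omega, by omega, ?_, ?_⟩,
          by omega, by omega, by omega, ?_, ?_⟩ <;> (split_ifs at * <;> omega)

/-- The triangles removed along the west side. -/
noncomputable def dents (u d m n : ℕ) (l h : ℕ → ℕ) : Finset UnitTriangle :=
  ((Icc 1 u \ (Icc 1 n).image h).image (upperDent d) ∪
    (Icc 1 d \ (Icc 1 m).image l).image (lowerDent d)) ∪ {middleDent d}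

open Classical in
/-- The first position of the strip above height `j`. -/
noncomputable def firstPos (u d m n : ℕ) (l h : ℕ → ℕ) (j : ℤ) : ℤ :=
  if j ≤ 2 * d then (if cell 1 j ∈ dents u d m n l h then 2 else 1)
  else (if cell 0 j ∈ dents u d m n l h then 1 else 0)

theorem mem_dents {u d m n : ℕ} {l h : ℕ → ℕ} (i j : ℤ) :
    cell i j ∈ dents u d m n l h ↔
      (i = 0 ∧ ∃ b : ℕ, (1 ≤ b ∧ b ≤ u) ∧ b ∉ (Icc 1 n).image h ∧ j = 2 * d + 2 * b) ∨
      (i = 1 ∧ ∃ b : ℕ, (1 ≤ b ∧ b ≤ d) ∧ b ∉ (Icc 1 m).image l ∧ j = 2 * d - 2 * b) ∨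
      (i = 1 ∧ j = 2 * d) := by
  simp only [dents, mem_union, mem_singleton]
  rw [mem_image, mem_image, or_assoc]
  refine or_congr ?_ (or_congr ?_ ?_)
  · simp only [mem_sdiff, mem_Icc, upperDent, cell, UnitTriangle.mk.injEq, Bool.true_eq,
      decide_eq_true_eq]
    constructor
    · rintro ⟨b, ⟨h1, h2⟩, h3, rfl, rfl⟩; exact ⟨rfl, b, h1, h2, rfl⟩
    · rintro ⟨rfl, b, h1, h2, rfl⟩
      exact ⟨b, ⟨h1, h2⟩, by rw [Int.even_iff]; omega, rfl, rfl⟩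
  · simp only [mem_sdiff, mem_Icc, lowerDent, cell, UnitTriangle.mk.injEq, Bool.false_eq,
      decide_eq_false_iff_not]
    constructor
    · rintro ⟨b, ⟨h1, h2⟩, h3, rfl, rfl⟩; exact ⟨rfl, b, h1, h2, rfl⟩
    · rintro ⟨rfl, b, h1, h2, rfl⟩
      exact ⟨b, ⟨h1, h2⟩, by rw [Int.even_iff]; omega, rfl, rfl⟩
  · simp only [middleDent, cell, UnitTriangle.mk.injEq, decide_eq_false_iff_not]
    constructor
    · rintro ⟨h3, rfl, rfl⟩; exact ⟨rfl, rfl⟩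
    · rintro ⟨rfl, rfl⟩; exact ⟨by rw [Int.even_iff]; omega, rfl, rfl⟩

/-- Every removed triangle is the first cell of its strip, so its removal only moves the left end of
an interval by one. -/
theorem isStrips_regionT {x u d m n : ℕ} (hm : m ≤ d) (hn : n ≤ u) (l h : ℕ → ℕ) :
    IsStrips (regionT x u d m n l h) (westSide u d) (firstPos u d m n l h) (lastPos x u d m n) where
  onLattice t ht := ((mem_baseHexagon hm hn t).mp (mem_sdiff.mp ht).1).1
  mem i j := by
    have hR : regionT x u d m n l h = baseHexagon x u d m n \ dents u d m n l h := rfl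
    rw [hR, mem_sdiff, mem_baseHexagon hm hn]
    rw [and_iff_right (show cell i j = cell (cell i j).i (cell i j).j from rfl)]
    simp only [mem_Icc]
    change ((0 ≤ j ∧ j < westSide u d) ∧ (if j ≤ 2 * d then 1 else 0) ≤ i ∧ i ≤ lastPos x u d m n j) ∧
      cell i j ∉ dents u d m n l h ↔ _
    rw [and_assoc]
    refine and_congr_right fun hj => ?_
    rw [firstPos]
    have hdent : cell i j ∈ dents u d m n l h ↔ (j ≤ 2 * d ∧ i = 1 ∧ cell 1 j ∈ dents u d m n l h) ∨
        (¬ j ≤ 2 * d ∧ i = 0 ∧ cell 0 j ∈ dents u d m n l h) := by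
      constructor
      · intro hc
        have hc' := hc
        rw [mem_dents] at hc'
        rcases hc' with ⟨rfl, b, h1, h2, h3⟩ | ⟨rfl, b, h1, h2, h3⟩ | ⟨rfl, h3⟩
        · exact Or.inr ⟨by omega, rfl, hc⟩
        · exact Or.inl ⟨by omega, rfl, hc⟩
        · exact Or.inl ⟨by omega, rfl, hc⟩
      · rintro (⟨-, rfl, h⟩ | ⟨-, rfl, h⟩) <;> exact h
    rw [hdent]
    split_ifs with h1 h2 h2 <;>
      simp only [h1, h2, true_and, and_true, false_and, and_false, or_false, false_or,
        not_true_eq_false, not_false_eq_true] <;> omega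

/-! ### The state sums below and above the additional step -/

theorem lowFun_zero (q : K) (a : ℤ) : lowFun q 0 a = 1 := by
  simp [lowFun, balProd, balFact]

theorem lowFun_eq_zero {q : K} {t : ℕ} {a : ℤ} (h : ∃ r : ℕ, r < t ∧ a + 2 * r - t + 1 = 0) :
    lowFun q t a = 0 := by
  rw [lowFun, balProd_eq_zero h, zero_div]

theorem alternating_even (j : ℤ) (x : ℤ) : Even (x + 1 + j) ↔ ¬ Even (x + j) := by
  rw [Int.even_iff, Int.even_iff]; omega

/-- Telescoping with `lowFun_diff`. The boundary term sits at 1 for even j and at 0 for odd j, and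
both are zeros of `lowFun q (t + 1)` for the relevant parity of t. Positions in the lower half are
at least 1, so the exceptional weight does not occur; a wrong weight is harmless where `lowFun q t`
vanishes. -/
theorem lowFun_cumul [CharZero K] {q : K} (hq : q ≠ 0) (hs : ∀ k : ℤ, k ≠ 0 → bal q k ≠ 0) {t : ℕ} {j p x : ℤ}
    (htj : Even (t + j + 1)) (hp : p = 1 ∨ p = 2 ∧ Even j) (g : ℤ → K) (hpx : p ≤ x)
    (hx : ¬ Even (x + j))
    (hg : ∀ v, p ≤ v → v < x → Even (v + j) → g v = vertWt q v ∨ lowFun q t v = 0) :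
    cumulAt g (fun v => Even (v + j)) p (lowFun q t) x = lowFun q (t + 1) x := by
  have hu : ∀ y, p ≤ y → ∀ v, y ≤ v → v < x → Even (v + j) →
      lowFun q (t + 1) (v + 1) - lowFun q (t + 1) (v - 1) = g v * lowFun q t v := by
    intro y hpy v hyv hvx hev
    rw [lowFun_diff hq hs]
    rcases hg v (by omega) hvx hev with h | h
    · rw [h, vertWt, if_neg (by omega)]
    · rw [h]; ring
  rw [Int.even_iff] at htj hx
  simp only [Int.even_iff] at hp
  rw [cumulAt]
  rcases Int.even_or_odd j with hj | hj
  · rw [Int.even_iff] at hj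
    rw [sum_telescope (lowFun q (t + 1)) _ (alternating_even j) (y := 2) (by omega) (by omega)
      (by rw [Int.even_iff]; omega) (by omega) (by rw [Int.even_iff]; omega) (hu 2 (by omega)),
      lowFun_eq_zero (a := 2 - 1), sub_zero]
    exact ⟨(t - 1) / 2, by omega, by push_cast; omega⟩
  · rw [Int.odd_iff] at hj
    rw [sum_telescope (lowFun q (t + 1)) _ (alternating_even j) (y := 1) (by omega) (by omega)
      (by rw [Int.even_iff]; omega) (by omega) (by rw [Int.even_iff]; omega) (hu 1 (by omega)),
      lowFun_eq_zero (a := 1 - 1), sub_zero]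
    exact ⟨t / 2, by omega, by push_cast; omega⟩

theorem upFun_zero_right (q : K) {t : ℕ} (ht : t ≠ 0) : upFun q t 0 = 0 := by
  obtain ⟨t, rfl⟩ := Nat.exists_eq_succ_of_ne_zero ht
  simp [upFun]

/-- Telescoping with `upFun_diff`. The exceptional weight at 0 is immaterial for t > 0, because
`upFun q t` vanishes there; for t = 0 it is exactly what makes the partial sums equal to `upFun q 1`
without an additive constant. -/
theorem upFun_cumul [CharZero K] {q : K} (hq : q ≠ 0) (hs : ∀ k : ℤ, k ≠ 0 → bal q k ≠ 0) {t : ℕ} {j p x : ℤ}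
    (htj : Even (t + j)) (hp : p = 0 ∨ p = 1 ∧ ¬ Even j) (g : ℤ → K) (hpx : p ≤ x)
    (hx : ¬ Even (x + j))
    (hg : ∀ v, p ≤ v → v < x → Even (v + j) → g v = vertWt q v ∨ upFun q t v = 0) :
    cumulAt g (fun v => Even (v + j)) p (upFun q t) x = upFun q (t + 1) x := by
  have hu : ∀ v, p ≤ v → v < x → Even (v + j) → (v = 0 → t ≠ 0) →
      upFun q (t + 1) (v + 1) - upFun q (t + 1) (v - 1) = g v * upFun q t v := by
    intro v hyv hvx hev hv0
    rw [upFun_diff hq hs]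
    by_cases hv : v = 0
    · subst hv; rw [upFun_zero_right q (hv0 rfl)]; ring
    · rcases hg v (by omega) hvx hev with h | h
      · rw [h, vertWt, if_neg hv]
      · rw [h]; ring
  rw [Int.even_iff] at htj hx
  simp only [Int.even_iff] at hp
  rw [cumulAt]
  rcases Int.even_or_odd j with hj | hj
  · rw [Int.even_iff] at hj
    by_cases ht : t = 0
    · subst ht
      have h0 : upFun q 1 (-1) = - (1 / 2) := by
        simp [upFun, balProd, balFact, bal_neg, bal_one hq, neg_div]
      have h1 : upFun q 1 1 = 1 / 2 := by
        simp [upFun, balProd, balFact, bal_one hq]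
      -- The generic difference at 0 would be 1, but the weight there is 1/2. Adding 1/2 to the
      -- primitive at -1 accounts for this and also cancels the boundary term `upFun q 1 (-1)` =
      -- -1/2.
      rw [sum_telescope (fun v => upFun q 1 v + if v ≤ -1 then 1 / 2 else 0) _ (alternating_even j)
        (y := 0) (by omega) (by omega) (by rw [Int.even_iff]; omega) (by omega)
        (by rw [Int.even_iff]; omega)]
      · rw [if_neg (by omega), if_pos (by omega), zero_sub, h0]; ring
      · intro v hv hvx hev
        by_cases hv0 : v = 0
        · subst hv0
          have hg0 : g 0 = vertWt q 0 := by
            rcases hg 0 (by omega) hvx hev with h | h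
            · exact h
            · simp [upFun] at h
          rw [hg0, zero_add, zero_sub, h0, h1]
          simp [vertWt, upFun]
        · rw [if_neg (by omega), if_neg (by rw [Int.even_iff] at hev; omega), add_zero, add_zero]
          exact hu v (by omega) hvx hev (fun h => absurd h hv0)
    · rw [sum_telescope (upFun q (t + 1)) _ (alternating_even j) (y := 0) (by omega) (by omega)
        (by rw [Int.even_iff]; omega) (by omega) (by rw [Int.even_iff]; omega)
        (fun v h1 h2 h3 => hu v (by omega) h2 h3 (fun _ => ht))]
      have : upFun q (t + 1) (0 - 1) = 0 := by
        rw [upFun, balProd_eq_zero, mul_zero, zero_div]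
        exact ⟨t / 2, by omega, by push_cast; omega⟩
      rw [this, sub_zero]
  · rw [Int.odd_iff] at hj
    rw [sum_telescope (upFun q (t + 1)) _ (alternating_even j) (y := 1) (by omega) (by omega)
      (by rw [Int.even_iff]; omega) (by omega) (by rw [Int.even_iff]; omega)
      (fun v h1 h2 h3 => hu v (by omega) h2 h3 (fun _ => by omega)), sub_self,
      upFun_zero_right q (by omega), sub_zero]

theorem detAt_fin_zero (φ : Fin 0 → ℤ → K) : detAt φ ∅ = 1 := by
  rw [detAt, dif_pos card_empty, Matrix.det_isEmpty]

/-- The positions at height `j` right of the region, but inside the wedge continuing the southeast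
side. -/
noncomputable def lowExtra (x u d m n : ℕ) (j : ℤ) : Finset ℤ :=
  (Icc (lastPos x u d m n j + 1) (1 + 2 * southSide x u d m n + j)).filter (fun i => Even (i + j))

/-- The positions at height `j` right of the region, but inside the wedge continuing the northeast
side. -/
noncomputable def upExtra (x u d m n : ℕ) (j : ℤ) : Finset ℤ :=
  (Icc (lastPos x u d m n j + 1)
    (2 * southSide x u d m n + 2 * southeastSide d m n - j)).filter (fun i => Even (i + j))

theorem lowExtra_succ (x u d m n : ℕ) (j : ℤ) :
    (Icc (lastPos x u d m n j + 1) (1 + 2 * southSide x u d m n + j)).filter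
      (fun i => ¬ Even (i + j)) = lowExtra x u d m n (j + 1) := by
  ext i
  simp only [lowExtra, lastPos, mem_filter, mem_Icc, Int.even_iff]
  omega

theorem upExtra_pred (x u d m n : ℕ) (j : ℤ) :
    (Icc (lastPos x u d m n (j - 1) + 1)
      (2 * southSide x u d m n + 2 * southeastSide d m n - (j - 1))).filter
      (fun i => Even (i + j)) = upExtra x u d m n j := by
  ext i
  simp only [upExtra, lastPos, mem_filter, mem_Icc, Int.even_iff]
  omega

/-! ### The lower state sums as determinants -/

section
variable {x u d m n : ℕ} {l h : ℕ → ℕ}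

theorem notMem_dents_of_odd {i j : ℤ} (hj : ¬ Even j) : cell i j ∉ dents u d m n l h := by
  rw [mem_dents, Int.even_iff] at *
  rintro (⟨_, b, _, _, h3⟩ | ⟨_, b, _, _, h3⟩ | ⟨_, h3⟩) <;> omega

/-- Induction over the strips from the bottom. The intact bump `l i` lies in the strip above height
2d - 2l_i and creates a particle on the next line, with the constant function; every further line
raises the degree by one, which gives 2l_i + j - (2d+1) at height j. As the bumps are numbered from
top to bottom, the k bumps already passed are those with the k largest indices. The product on the
left is the weight of the forced particles in the wedge. -/
theorem lowSum_eq_detAt [CharZero K] {q : K} (hq : q ≠ 0) (hs : ∀ k : ℤ, k ≠ 0 → bal q k ≠ 0)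
    (hm : m ≤ d) (hn : n ≤ u)
    (hl : ∀ i ∈ Set.Icc 1 m, l i ∈ Set.Icc 1 d) (hl_mono : StrictMonoOn l (Set.Icc 1 m))
    (j : ℕ) (hj : j ≤ 2 * d + 1) :
    ∀ k ≤ m, (∀ i ∈ Set.Icc 1 m, (m - k < i ↔ 2 * d + 1 ≤ 2 * l i + j)) →
    ∀ A : Finset ℤ, (∀ i ∈ A, Even (i + j) ∧ cell i (j - 1) ∈ regionT x u d m n l h) →
    lowSum q (regionT x u d m n l h) j A *
      ∏ s ∈ range j, ∏ v ∈ lowExtra x u d m n s, vertWt q v =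
    detAt (fun r : Fin k => lowFun q (2 * l (m - k + 1 + r) + j - (2 * d + 1)))
      (A ∪ lowExtra x u d m n j) := by
  have hR := isStrips_regionT (x := x) hm hn l h
  have hS : 0 ≤ southSide x u d m n := by simp only [southSide, e']; omega
  have hE : southeastSide d m n = 2 * d - m + n + 1 := rfl
  have hW : westSide u d = 2 * u + 2 * d + 1 := rfl
  induction j with
  | zero =>
    intro k hk hact A hA
    have hA0 : A = ∅ := by
      rw [eq_empty_iff_forall_notMem]
      intro i hi
      have := ((hR.mem _ _).mp (hA i hi).2).1.1
      omega
    have hk0 : k = 0 := by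
      by_contra hne
      have h1 := (hact m ⟨by omega, le_rfl⟩).mp (by omega)
      have h2 := (hl m ⟨by omega, le_rfl⟩).2
      omega
    subst hk0
    have hX : lowExtra x u d m n ((0 : ℕ) : ℤ) = ∅ := by
      rw [eq_empty_iff_forall_notMem]
      intro i hi
      simp only [lowExtra, lastPos, mem_filter, mem_Icc] at hi
      push_cast at hi
      omega
    have hF : (regionT x u d m n l h).filter (fun t => t.j < ((0 : ℕ) : ℤ)) = ∅ := by
      rw [filter_eq_empty_iff]
      intro t ht
      have h1 := hR.onLattice t ht
      rw [h1] at ht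
      have := ((hR.mem _ _).mp ht).1.1
      push_cast; omega
    rw [hX, hA0, range_zero, prod_empty, mul_one, lowSum, hF, empty_sdiff, tilingGF_empty,
      empty_union, detAt_fin_zero]
  | succ j ih =>
    intro k' hk' hact A hA
    have hjW : (0 : ℤ) ≤ j ∧ (j : ℤ) < westSide u d := by rw [hW]; omega
    have hQ := alternating_even (j : ℤ)
    -- generic facts on the strip
    have hAmem : ∀ i ∈ A, i ∈ Icc (firstPos u d m n l h j) (lastPos x u d m n j) ∧
        ¬ Even (i + (j : ℤ)) := by
      intro i hi
      obtain ⟨h1, h2⟩ := hA i hi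
      push_cast at h1 h2
      rw [add_sub_cancel_right] at h2
      refine ⟨((hR.mem _ _).mp h2).2, ?_⟩
      rw [Int.even_iff] at *; omega
    have hA' : ∀ i ∈ A, ¬ Even (i + (j : ℤ)) := fun i hi => (hAmem i hi).2
    have hfirst : firstPos u d m n l h j = if cell 1 j ∈ dents u d m n l h then 2 else 1 := by
      rw [firstPos, if_pos (by omega)]
    have hp12 : firstPos u d m n l h j = 1 ∨ firstPos u d m n l h j = 2 ∧ Even (j : ℤ) := by
      rw [hfirst]
      split_ifs with hc
      · refine Or.inr ⟨rfl, ?_⟩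
        by_contra hodd
        exact notMem_dents_of_odd hodd hc
      · exact Or.inl rfl
    have hpp' : firstPos u d m n l h j ≤ lastPos x u d m n j + 1 := by
      simp only [lastPos]; omega
    have hp'P : lastPos x u d m n j ≤ 1 + 2 * southSide x u d m n + j := min_le_left _ _
    have hPQ : ¬ Even (1 + 2 * southSide x u d m n + (j : ℤ) + j) := by
      rw [Int.even_iff]; omega
    have h1Q : lastPos x u d m n j < 1 + 2 * southSide x u d m n + j →
        ¬ Even (lastPos x u d m n j + 1 + (j : ℤ)) := by
      rw [Int.even_iff]; simp only [lastPos]; omega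
    have hO : sites (regionT x u d m n l h) (firstPos u d m n l h) (lastPos x u d m n) j ⊆
        (Icc (firstPos u d m n l h j) (lastPos x u d m n j)).filter (fun v => Even (v + (j : ℤ))) := by
      intro v hv
      have h1 := (hR.mem_sites v j).mp hv
      exact mem_filter.mpr ⟨((hR.mem _ _).mp h1.2.1).2, h1.1⟩
    have hFO : ∀ k ≤ m, (∀ i ∈ Set.Icc 1 m, (m - k < i ↔ 2 * d + 1 ≤ 2 * l i + j)) →
        ∀ B ⊆ sites (regionT x u d m n l h) (firstPos u d m n l h) (lastPos x u d m n) j,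
        lowSum q (regionT x u d m n l h) j B *
          ∏ s ∈ range j, ∏ v ∈ lowExtra x u d m n s, vertWt q v =
        detAt (fun r : Fin k => lowFun q (2 * l (m - k + 1 + r) + j - (2 * d + 1)))
          (B ∪ lowExtra x u d m n j) := by
      intro k hk hactk B hB
      refine ih (by omega) k hk hactk B fun i hi => ?_
      have := (hR.mem_sites i j).mp (hB hi)
      exact ⟨this.1, this.2.2⟩
    -- One line raises the degree by one, even if position 1 is not an available site.
    have hcum : ∀ i ∈ Set.Icc 1 m, 2 * d + 1 ≤ 2 * l i + j →
        ∀ y ∈ Icc (firstPos u d m n l h j) (1 + 2 * southSide x u d m n + j), ¬ Even (y + (j : ℤ)) →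
        cumulAt (fun b => if b ∈ sites (regionT x u d m n l h) (firstPos u d m n l h)
            (lastPos x u d m n) j ∨ lastPos x u d m n j < b then vertWt q b else 0)
          (fun v => Even (v + (j : ℤ))) (firstPos u d m n l h j)
          (lowFun q (2 * l i + j - (2 * d + 1))) y =
        lowFun q (2 * l i + (j + 1) - (2 * d + 1)) y := by
      intro i hi hact' y hy hyQ
      rw [show 2 * l i + (j + 1) - (2 * d + 1) = 2 * l i + j - (2 * d + 1) + 1 by omega]
      have hli := hl i hi
      rw [Set.mem_Icc] at hli
      refine lowFun_cumul hq hs (by rw [Int.even_iff]; omega) hp12 _ (mem_Icc.mp hy).1 hyQ ?_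
      intro v hv hvy hev
      by_cases hvO : v ∈ sites (regionT x u d m n l h) (firstPos u d m n l h)
            (lastPos x u d m n) j ∨ lastPos x u d m n j < v
      · left; rw [if_pos hvO]
      · right
        rw [not_or, not_lt, hR.mem_sites, hR.mem, hR.mem] at hvO
        obtain ⟨hv1, hv2⟩ := hvO
        have hy2 := (mem_Icc.mp hy).2
        have hlast : v ≤ lastPos x u d m n ((j : ℤ) - 1) := by
          rw [Int.even_iff] at hev
          simp only [lastPos] at hv2 ⊢; omega
        -- The position belongs to the strip above the line, so it can only be unavailable because
        -- it lies left of the first cell of the strip below.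
        have hj1 : ¬ (firstPos u d m n l h ((j : ℤ) - 1) ≤ v) := by
          intro hle
          exact hv1 ⟨hev, ⟨hjW, mem_Icc.mpr ⟨hv, hv2⟩⟩, by omega, mem_Icc.mpr ⟨hle, hlast⟩⟩
        rw [firstPos, if_pos (by omega)] at hj1
        split_ifs at hj1 with hd
        · have hv : v = 1 := by omega
          subst hv
          rw [mem_dents] at hd
          rw [Int.even_iff] at hev
          -- The degree t is even here. It is not 0, for otherwise bump `l i` would lie in the strip
          -- below, whose first cell has been removed. An even positive degree makes position 1 a
          -- zero.
          refine lowFun_eq_zero ⟨(2 * l i + j - (2 * d + 1) - 2) / 2, ?_, ?_⟩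
          all_goals
            have ht : 2 * l i + j - (2 * d + 1) ≠ 0 := by
              intro ht
              rcases hd with ⟨h0, _⟩ | ⟨-, b, hb1, hb2, hb3⟩ | ⟨-, hb3⟩
              · omega
              · apply hb2
                rw [mem_image]
                exact ⟨i, mem_Icc.mpr hi, by omega⟩
              · omega
            omega
        · omega
    have hmono : ∀ i ∈ Set.Icc 1 m, ∀ i' ∈ Set.Icc 1 m, i < i' → l i < l i' :=
      fun i hi i' hi' hlt => hl_mono hi hi' hlt
    have hgoal : (A ∪ (Icc (lastPos x u d m n j + 1)
        (1 + 2 * southSide x u d m n + j)).filter (fun i => ¬ Even (i + (j : ℤ)))) =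
        A ∪ lowExtra x u d m n ((j : ℤ) + 1) := by rw [lowExtra_succ]
    rw [Nat.cast_succ, hR.lowSum_succ q hjW hA', prod_range_succ, ← hgoal]
    by_cases hnew : Even (firstPos u d m n l h j + (j : ℤ))
    · -- no new particle
      have hne : ∀ i ∈ Set.Icc 1 m, 2 * l i + j ≠ 2 * d := by
        intro i hi h0
        have hli := (hl i hi).1
        rw [hfirst] at hnew
        split_ifs at hnew with hd
        · rw [mem_dents] at hd
          rcases hd with ⟨h0, _⟩ | ⟨-, b, hb1, hb2, hb3⟩ | ⟨-, hb3⟩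
          · omega
          · apply hb2
            rw [mem_image]
            exact ⟨i, mem_Icc.mpr hi, by omega⟩
          · omega
        · rw [Int.even_iff] at hnew; omega
      have hact' : ∀ i ∈ Set.Icc 1 m, (m - k' < i ↔ 2 * d + 1 ≤ 2 * l i + j) := by
        intro i hi
        rw [hact i hi]
        have := hne i hi
        omega
      refine step_old hQ hpp' hp'P hPQ h1Q hnew hO (hFO k' hk' hact') hAmem ?_
      intro r y hy hyQ
      have hi : m - k' + 1 + (r : ℕ) ∈ Set.Icc 1 m := ⟨by omega, by have := r.2; omega⟩
      exact hcum _ hi ((hact' _ hi).mp (by omega)) y hy hyQ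
    · -- a new particle
      have hd : cell 1 j ∉ dents u d m n l h := by
        intro hd
        rw [hfirst, if_pos hd] at hnew
        have : ¬ ¬ Even (j : ℤ) := fun hodd => notMem_dents_of_odd hodd hd
        rw [Int.even_iff] at *; omega
      rw [hfirst, if_neg hd] at hnew
      have hje : (j : ℤ) % 2 = 0 := by rw [Int.even_iff] at hnew; omega
      have hj2d : j ≠ 2 * d := by
        intro h0
        exact hd ((mem_dents _ _).mpr (Or.inr (Or.inr ⟨rfl, by omega⟩)))
      -- An even strip below height 2d whose first cell is present belongs to a bump that is kept.
      -- Since l increases, this highest bump so far has the smallest active index.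
      obtain ⟨i0, hi0, hl0⟩ : ∃ i0 ∈ Set.Icc 1 m, l i0 = d - j / 2 := by
        by_contra hcon
        push Not at hcon
        apply hd
        rw [mem_dents]
        refine Or.inr (Or.inl ⟨rfl, d - j / 2, ⟨by omega, by omega⟩, ?_, by omega⟩)
        rw [mem_image]
        rintro ⟨i, hi, hli⟩
        exact hcon i (mem_Icc.mp hi) hli
      have hk1 : m - k' < i0 := (hact i0 hi0).mpr (by omega)
      have hi0' := hi0
      rw [Set.mem_Icc] at hi0
      obtain ⟨k, rfl⟩ : ∃ k, k' = k + 1 := ⟨k' - 1, by omega⟩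
      have hfm : m - (k + 1) + 1 ∈ Set.Icc 1 m := ⟨by omega, by omega⟩
      have hf1 := (hact _ hfm).mp (by omega)
      have hf0 : l (m - (k + 1) + 1) = d - j / 2 := by
        rcases (show m - (k + 1) + 1 ≤ i0 by omega).lt_or_eq with hlt | heq
        · have := hmono _ hfm i0 hi0' hlt
          omega
        · rw [heq]; exact hl0
      have hact' : ∀ i ∈ Set.Icc 1 m, (m - k < i ↔ 2 * d + 1 ≤ 2 * l i + j) := by
        intro i hi
        constructor
        · intro hlt
          have := hmono _ hfm i hi (by omega)
          omega
        · intro hle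
          have h1 := (hact i hi).mpr (by omega)
          have h2 : i ≠ m - (k + 1) + 1 := by
            rintro rfl; omega
          omega
      refine step_new hQ hpp' hp'P hPQ h1Q (by rw [hfirst, if_neg hd]; exact hnew) hO
        (hFO k (by omega) hact') hAmem ?_ ?_
      · intro y
        rw [Fin.val_zero, add_zero, hf0, show 2 * (d - j / 2) + (j + 1) - (2 * d + 1) = 0 by omega,
          lowFun_zero]
      · intro r y hy hyQ
        have hr := r.2
        have hi : m - k + 1 + (r : ℕ) ∈ Set.Icc 1 m := ⟨by omega, by omega⟩
        rw [Fin.val_succ, show m - (k + 1) + 1 + ((r : ℕ) + 1) = m - k + 1 + r by omega]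
        exact hcum _ hi ((hact' _ hi).mp (by omega)) y hy hyQ

end

/-! ### The upper state sums as determinants -/

section
variable {x u d m n : ℕ} {l h : ℕ → ℕ}

/-- The same induction from the top, where s is the distance from the north side. The strip of bump
`h i` starts at height 2d + 2h_i, that is at s = 2u + 1 - 2h_i, and its particle on that line has
degree 0; hence the degree 2h_i + s - (2u+1) in general. -/
theorem upSum_eq_detAt [CharZero K] {q : K} (hq : q ≠ 0) (hs : ∀ k : ℤ, k ≠ 0 → bal q k ≠ 0)
    (hm : m ≤ d) (hn : n ≤ u)
    (hh : ∀ i ∈ Set.Icc 1 n, h i ∈ Set.Icc 1 u) (hh_mono : StrictMonoOn h (Set.Icc 1 n))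
    (s : ℕ) (hsu : s ≤ 2 * u) (j : ℤ) (hj : j + s = westSide u d) :
    ∀ k ≤ n, (∀ i ∈ Set.Icc 1 n, (n - k < i ↔ 2 * u + 1 ≤ 2 * h i + s)) →
    ∀ A : Finset ℤ, (∀ i ∈ A, Even (i + j) ∧ cell i j ∈ regionT x u d m n l h) →
    upSum q (regionT x u d m n l h) j A *
      ∏ r ∈ range s, ∏ v ∈ upExtra x u d m n (westSide u d - r), vertWt q v =
    detAt (fun r : Fin k => upFun q (2 * h (n - k + 1 + r) + s - (2 * u + 1)))
      (A ∪ upExtra x u d m n j) := by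
  have hR := isStrips_regionT (x := x) hm hn l h
  have hS : 0 ≤ southSide x u d m n := by simp only [southSide, e']; omega
  have hE : southeastSide d m n = 2 * d - m + n + 1 := rfl
  have hW : westSide u d = 2 * u + 2 * d + 1 := rfl
  have hN : 2 * southSide x u d m n + 2 * southeastSide d m n - westSide u d ≥ -1 := by
    simp only [southSide, southeastSide, westSide, e']; omega
  induction s generalizing j with
  | zero =>
    intro k hk hact A hA
    have hA0 : A = ∅ := by
      rw [eq_empty_iff_forall_notMem]
      intro i hi
      have := ((hR.mem _ _).mp (hA i hi).2).1.2
      omega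
    have hk0 : k = 0 := by
      by_contra hne
      have h1 := (hact n ⟨by omega, le_rfl⟩).mp (by omega)
      have h2 := (hh n ⟨by omega, le_rfl⟩).2
      omega
    subst hk0
    have hX : upExtra x u d m n j = ∅ := by
      rw [eq_empty_iff_forall_notMem]
      intro i hi
      simp only [upExtra, lastPos, mem_filter, mem_Icc] at hi
      omega
    have hF : (regionT x u d m n l h).filter (fun t => j ≤ t.j) = ∅ := by
      rw [filter_eq_empty_iff]
      intro t ht
      have h1 := hR.onLattice t ht
      rw [h1] at ht
      have := ((hR.mem _ _).mp ht).1.2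
      omega
    rw [hX, hA0, range_zero, prod_empty, mul_one, upSum, hF, empty_sdiff, tilingGF_empty,
      empty_union, detAt_fin_zero]
  | succ s ih =>
    intro k' hk' hact A hA
    have hjW : (0 : ℤ) ≤ j ∧ (j : ℤ) < westSide u d := by push_cast at hj; omega
    have hjd : 2 * (d : ℤ) < j := by push_cast at hj; omega
    have hj1 : j + 1 + s = westSide u d := by push_cast at hj; omega
    have hQ := alternating_even (j + 1)
    have hAmem : ∀ i ∈ A, i ∈ Icc (firstPos u d m n l h j) (lastPos x u d m n j) ∧
        ¬ Even (i + (j + 1)) := by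
      intro i hi
      obtain ⟨h1, h2⟩ := hA i hi
      refine ⟨((hR.mem _ _).mp h2).2, ?_⟩
      rw [Int.even_iff] at *; omega
    have hA' : ∀ i ∈ A, Even (i + j) := fun i hi => (hA i hi).1
    have hfirst : firstPos u d m n l h j = if cell 0 j ∈ dents u d m n l h then 1 else 0 := by
      rw [firstPos, if_neg (by omega)]
    have hp12 : firstPos u d m n l h j = 0 ∨ firstPos u d m n l h j = 1 ∧ ¬ Even (j + 1) := by
      rw [hfirst]
      split_ifs with hc
      · refine Or.inr ⟨rfl, ?_⟩
        have : ¬ ¬ Even j := fun hodd => notMem_dents_of_odd hodd hc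
        rw [Int.even_iff] at *; omega
      · exact Or.inl rfl
    have hpp' : firstPos u d m n l h j ≤ lastPos x u d m n j + 1 := by
      simp only [lastPos]; omega
    have hp'P : lastPos x u d m n j ≤ 2 * southSide x u d m n + 2 * southeastSide d m n - j :=
      min_le_right _ _
    have hPQ : ¬ Even (2 * southSide x u d m n + 2 * southeastSide d m n - j + (j + 1)) := by
      rw [Int.even_iff]; omega
    have h1Q : lastPos x u d m n j < 2 * southSide x u d m n + 2 * southeastSide d m n - j →
        ¬ Even (lastPos x u d m n j + 1 + (j + 1)) := by
      rw [Int.even_iff]; simp only [lastPos]; omega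
    have hX : (Icc (lastPos x u d m n j + 1)
        (2 * southSide x u d m n + 2 * southeastSide d m n - j)).filter
        (fun v => Even (v + (j + 1))) = upExtra x u d m n (j + 1) := by
      have := upExtra_pred x u d m n (j + 1)
      rw [add_sub_cancel_right] at this
      exact this
    have hO : sites (regionT x u d m n l h) (firstPos u d m n l h) (lastPos x u d m n) (j + 1) ⊆
        (Icc (firstPos u d m n l h j) (lastPos x u d m n j)).filter (fun v => Even (v + (j + 1))) := by
      intro v hv
      have h1 := (hR.mem_sites v (j + 1)).mp hv
      rw [add_sub_cancel_right] at h1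
      exact mem_filter.mpr ⟨((hR.mem _ _).mp h1.2.2).2, h1.1⟩
    have hFO : ∀ k ≤ n, (∀ i ∈ Set.Icc 1 n, (n - k < i ↔ 2 * u + 1 ≤ 2 * h i + s)) →
        ∀ B ⊆ sites (regionT x u d m n l h) (firstPos u d m n l h) (lastPos x u d m n) (j + 1),
        upSum q (regionT x u d m n l h) (j + 1) B *
          ∏ r ∈ range s, ∏ v ∈ upExtra x u d m n (westSide u d - r), vertWt q v =
        detAt (fun r : Fin k => upFun q (2 * h (n - k + 1 + r) + s - (2 * u + 1)))
          (B ∪ (Icc (lastPos x u d m n j + 1)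
            (2 * southSide x u d m n + 2 * southeastSide d m n - j)).filter
            (fun v => Even (v + (j + 1)))) := by
      intro k hk hactk B hB
      rw [hX]
      refine ih (by omega) (j + 1) hj1 k hk hactk B fun i hi => ?_
      have := (hR.mem_sites i (j + 1)).mp (hB hi)
      exact ⟨this.1, this.2.1⟩
    have hcum : ∀ i ∈ Set.Icc 1 n, 2 * u + 1 ≤ 2 * h i + s →
        ∀ y ∈ Icc (firstPos u d m n l h j) (2 * southSide x u d m n + 2 * southeastSide d m n - j),
        ¬ Even (y + (j + 1)) →
        cumulAt (fun b => if b ∈ sites (regionT x u d m n l h) (firstPos u d m n l h)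
            (lastPos x u d m n) (j + 1) ∨ lastPos x u d m n j < b then vertWt q b else 0)
          (fun v => Even (v + (j + 1))) (firstPos u d m n l h j)
          (upFun q (2 * h i + s - (2 * u + 1))) y =
        upFun q (2 * h i + (s + 1) - (2 * u + 1)) y := by
      intro i hi hact' y hy hyQ
      rw [show 2 * h i + (s + 1) - (2 * u + 1) = 2 * h i + s - (2 * u + 1) + 1 by omega]
      have hli := hh i hi
      rw [Set.mem_Icc] at hli
      refine upFun_cumul hq hs (by rw [Int.even_iff]; omega) hp12 _ (mem_Icc.mp hy).1 hyQ ?_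
      intro v hv hvy hev
      by_cases hvO : v ∈ sites (regionT x u d m n l h) (firstPos u d m n l h)
            (lastPos x u d m n) (j + 1) ∨ lastPos x u d m n j < v
      · left; rw [if_pos hvO]
      · right
        rw [not_or, not_lt, hR.mem_sites, hR.mem, hR.mem, add_sub_cancel_right] at hvO
        obtain ⟨hv1, hv2⟩ := hvO
        have hy2 := (mem_Icc.mp hy).2
        have hlast : v ≤ lastPos x u d m n (j + 1) := by
          rw [Int.even_iff] at hev
          simp only [lastPos] at hv2 ⊢; omega
        -- Now an unavailable position lies left of the first cell of the strip above the upper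
        -- line, so it is 0. It is a zero of `upFun` unless the degree is 0, which would mean that
        -- the removed cell belongs to the kept bump `h i`.
        have hjj : ¬ (firstPos u d m n l h (j + 1) ≤ v) := by
          intro hle
          exact hv1 ⟨hev, ⟨by omega, mem_Icc.mpr ⟨hle, hlast⟩⟩, hjW, mem_Icc.mpr ⟨hv, hv2⟩⟩
        rw [firstPos, if_neg (by omega)] at hjj
        split_ifs at hjj with hd
        · have hv : v = 0 := by omega
          subst hv
          rw [mem_dents] at hd
          refine upFun_zero_right q ?_
          intro ht
          rcases hd with ⟨-, b, hb1, hb2, hb3⟩ | ⟨h0, _⟩ | ⟨h0, _⟩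
          · apply hb2
            rw [mem_image]
            exact ⟨i, mem_Icc.mpr hi, by omega⟩
          · omega
          · omega
        · omega
    have hmono : ∀ i ∈ Set.Icc 1 n, ∀ i' ∈ Set.Icc 1 n, i < i' → h i < h i' :=
      fun i hi i' hi' hlt => hh_mono hi hi' hlt
    have hgoal : (A ∪ (Icc (lastPos x u d m n j + 1)
        (2 * southSide x u d m n + 2 * southeastSide d m n - j)).filter
        (fun i => ¬ Even (i + (j + 1)))) = A ∪ upExtra x u d m n j := by
      congr 1
      refine filter_congr fun i _ => ?_
      rw [Int.even_iff, Int.even_iff]; omega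
    have hj1' : westSide u d - (s : ℤ) = j + 1 := by omega
    rw [hR.upSum_pred q hjW hA', prod_range_succ, hj1', ← hX, ← hgoal]
    by_cases hnew : Even (firstPos u d m n l h j + (j + 1))
    · -- no new particle
      have hne : ∀ i ∈ Set.Icc 1 n, 2 * h i + s ≠ 2 * u := by
        intro i hi h0
        rw [hfirst] at hnew
        split_ifs at hnew with hd
        · rw [mem_dents] at hd
          rcases hd with ⟨-, b, hb1, hb2, hb3⟩ | ⟨h0, _⟩ | ⟨h0, _⟩
          · apply hb2
            rw [mem_image]
            exact ⟨i, mem_Icc.mpr hi, by omega⟩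
          · omega
          · omega
        · rw [Int.even_iff] at hnew; omega
      have hact' : ∀ i ∈ Set.Icc 1 n, (n - k' < i ↔ 2 * u + 1 ≤ 2 * h i + s) := by
        intro i hi
        rw [hact i hi]
        have := hne i hi
        omega
      refine step_old hQ hpp' hp'P hPQ h1Q hnew hO (hFO k' hk' hact') hAmem ?_
      intro r y hy hyQ
      have hi : n - k' + 1 + (r : ℕ) ∈ Set.Icc 1 n := ⟨by omega, by have := r.2; omega⟩
      exact hcum _ hi ((hact' _ hi).mp (by omega)) y hy hyQ
    · -- a new particle
      have hd : cell 0 j ∉ dents u d m n l h := by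
        intro hd
        rw [hfirst, if_pos hd] at hnew
        have : ¬ ¬ Even j := fun hodd => notMem_dents_of_odd hodd hd
        rw [Int.even_iff] at *; omega
      rw [hfirst, if_neg hd] at hnew
      have hje : j % 2 = 0 := by rw [Int.even_iff] at hnew; omega
      obtain ⟨i0, hi0, hl0⟩ : ∃ i0 ∈ Set.Icc 1 n, 2 * h i0 + s = 2 * u := by
        by_contra hcon
        push Not at hcon
        apply hd
        rw [mem_dents]
        refine Or.inl ⟨rfl, u - s / 2, ⟨by omega, by omega⟩, ?_, by omega⟩
        rw [mem_image]
        rintro ⟨i, hi, hli⟩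
        exact hcon i (mem_Icc.mp hi) (by omega)
      have hk1 : n - k' < i0 := (hact i0 hi0).mpr (by omega)
      have hi0' := hi0
      rw [Set.mem_Icc] at hi0
      obtain ⟨k, rfl⟩ : ∃ k, k' = k + 1 := ⟨k' - 1, by omega⟩
      have hfm : n - (k + 1) + 1 ∈ Set.Icc 1 n := ⟨by omega, by omega⟩
      have hf1 := (hact _ hfm).mp (by omega)
      have hf0 : 2 * h (n - (k + 1) + 1) + s = 2 * u := by
        rcases (show n - (k + 1) + 1 ≤ i0 by omega).lt_or_eq with hlt | heq
        · have := hmono _ hfm i0 hi0' hlt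
          omega
        · rw [heq]; exact hl0
      have hact' : ∀ i ∈ Set.Icc 1 n, (n - k < i ↔ 2 * u + 1 ≤ 2 * h i + s) := by
        intro i hi
        constructor
        · intro hlt
          have := hmono _ hfm i hi (by omega)
          omega
        · intro hle
          have h1 := (hact i hi).mpr (by omega)
          have h2 : i ≠ n - (k + 1) + 1 := by
            rintro rfl; omega
          omega
      refine step_new hQ hpp' hp'P hPQ h1Q (by rw [hfirst, if_neg hd]; exact hnew) hO
        (hFO k (by omega) hact') hAmem ?_ ?_
      · intro y
        rw [Fin.val_zero, add_zero,
          show 2 * h (n - (k + 1) + 1) + (s + 1) - (2 * u + 1) = 0 by omega]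
        rfl
      · intro r y hy hyQ
        have hr := r.2
        have hi : n - k + 1 + (r : ℕ) ∈ Set.Icc 1 n := ⟨by omega, by omega⟩
        rw [Fin.val_succ, show n - (k + 1) + 1 + ((r : ℕ) + 1) = n - k + 1 + r by omega]
        exact hcum _ hi ((hact' _ hi).mp (by omega)) y hy hyQ

end

/-! ### Summation over common particle configurations -/

section
variable {m k : ℕ}

/-- The determinant of the functions `ψ` at the positions `f` and the fixed positions `e`. -/
noncomputable def detWith (ψ : Fin m ⊕ Fin k → ℤ → K) (e : Fin k → ℤ) (f : Fin m → ℤ) : K :=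
  (Matrix.of fun r c => ψ r (Sum.elim f e c)).det

theorem detWith_perm (ψ : Fin m ⊕ Fin k → ℤ → K) (e : Fin k → ℤ) (a : Fin m → ℤ)
    (σ : Equiv.Perm (Fin m)) :
    detWith ψ e (a ∘ σ) = Equiv.Perm.sign σ * detWith ψ e a := by
  have := Matrix.det_permute' (Equiv.sumCongr σ (1 : Equiv.Perm (Fin k)))
    (Matrix.of fun r c => ψ r (Sum.elim a e c))
  rw [show Equiv.Perm.sign (Equiv.sumCongr σ (1 : Equiv.Perm (Fin k))) = Equiv.Perm.sign σ by
    rw [show Equiv.sumCongr σ (1 : Equiv.Perm (Fin k)) = Equiv.Perm.sumCongr σ 1 from rfl,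
      Equiv.Perm.sign_sumCongr, Equiv.Perm.sign_one, mul_one]] at this
  unfold detWith
  rw [← this]
  congr 1
  ext r c
  rcases c with c | c <;> simp

theorem detWith_of_not_injective (ψ : Fin m ⊕ Fin k → ℤ → K) (e : Fin k → ℤ) {f : Fin m → ℤ}
    (hf : ¬ Function.Injective f) : detWith ψ e f = 0 := by
  rw [Function.Injective] at hf
  push Not at hf
  obtain ⟨i, j, hij, hne⟩ := hf
  refine Matrix.det_zero_of_column_eq (i := Sum.inl i) (j := Sum.inl j) (by simpa using hne) ?_
  intro r
  simp [hij]

/-- The tuples with the same image as the increasing tuple a are the rearrangements of a. The signs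
of the alternating function assemble the remaining products into a determinant by the Leibniz
formula. -/
theorem sum_fiber (φ : Fin m → ℤ → K) (w : ℤ → K) (alt : (Fin m → ℤ) → K)
    (h1 : ∀ (a : Fin m → ℤ) (σ : Equiv.Perm (Fin m)), alt (a ∘ σ) = Equiv.Perm.sign σ * alt a)
    {a : Fin m → ℤ} (ha : StrictMono a) {P : Finset ℤ} (hP : ∀ i, a i ∈ P) :
    ∑ f ∈ Fintype.piFinset (fun _ : Fin m => P) with univ.image f = univ.image a,
      (∏ i, w (f i) * φ i (f i)) * alt f =
    (∏ v ∈ univ.image a, w v) * (Matrix.of fun r c => φ r (a c)).det * alt a := by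
  rw [← Matrix.det_transpose, Matrix.det_apply', mul_sum, sum_mul]
  symm
  refine sum_nbij (fun σ => a ∘ σ) ?_ ?_ ?_ ?_
  · intro σ _
    rw [mem_filter, Fintype.mem_piFinset]
    refine ⟨fun i => hP _, ?_⟩
    rw [← image_image, image_univ_of_surjective σ.surjective]
  · intro σ _ τ _ h
    ext i
    have := congrFun h i
    exact congrArg Fin.val (ha.injective this)
  · intro f hf
    rw [mem_coe, mem_filter] at hf
    have hinj : Function.Injective f := by
      rw [← Set.injOn_univ, ← coe_univ, ← card_image_iff, hf.2,
        card_image_of_injective _ ha.injective]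
    have hex : ∀ i, ∃ j, a j = f i := by
      intro i
      have : f i ∈ univ.image a := by rw [← hf.2]; exact mem_image_of_mem f (mem_univ i)
      obtain ⟨j, -, hj⟩ := mem_image.mp this
      exact ⟨j, hj⟩
    choose τ hτ using hex
    have hτi : Function.Injective τ := by
      intro i j hij
      apply hinj
      rw [← hτ i, ← hτ j, hij]
    refine ⟨Equiv.ofBijective τ (Finite.injective_iff_bijective.mp hτi), mem_coe.mpr (mem_univ _), ?_⟩
    ext i
    exact hτ i
  · intro σ _
    rw [h1, prod_image (fun x _ y _ h => ha.injective h), prod_mul_distrib]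
    simp only [Function.comp_apply, Matrix.transpose_apply, Matrix.of_apply]
    rw [Equiv.prod_comp σ (fun i => w (a i))]
    have hsq : ((Equiv.Perm.sign σ : ℤ) : K) * ((Equiv.Perm.sign σ : ℤ) : K) = 1 := by
      rcases Int.units_eq_one_or (Equiv.Perm.sign σ) with h | h <;> simp [h]
    ring

/-- The combinatorial half of Cauchy–Binet: a sum over subsets becomes a sum over all tuples, as
tuples with repetitions contribute 0. -/
theorem sum_subsets (φ : Fin m → ℤ → K) (w : ℤ → K) (alt : (Fin m → ℤ) → K)
    (h1 : ∀ (a : Fin m → ℤ) (σ : Equiv.Perm (Fin m)), alt (a ∘ σ) = Equiv.Perm.sign σ * alt a)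
    (h2 : ∀ f, ¬ Function.Injective f → alt f = 0) (P : Finset ℤ) (F : Finset ℤ → K)
    (hF : ∀ a : Fin m → ℤ, StrictMono a → (∀ i, a i ∈ P) → F (univ.image a) = alt a) :
    ∑ A ∈ P.powerset, (∏ v ∈ A, w v) * (detAt φ A * F A) =
      ∑ f ∈ Fintype.piFinset (fun _ : Fin m => P), (∏ i, w (f i) * φ i (f i)) * alt f := by
  rw [← sum_fiberwise_of_maps_to (s := Fintype.piFinset (fun _ : Fin m => P)) (t := P.powerset)
    (g := fun f => univ.image f)]
  · refine sum_congr rfl fun A hA => ?_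
    rw [mem_powerset] at hA
    by_cases hk : #A = m
    · obtain ⟨a, ha, rfl⟩ := exists_strictMono hk
      have hP : ∀ i, a i ∈ P := fun i => hA (mem_image_of_mem a (mem_univ i))
      rw [sum_fiber φ w alt h1 ha hP, detAt_image _ ha, hF a ha hP]
      ring
    · rw [detAt_of_card_ne _ hk, zero_mul, mul_zero]
      symm
      refine sum_eq_zero fun f hf => ?_
      rw [h2, mul_zero]
      intro hinj
      apply hk
      rw [← (mem_filter.mp hf).2, card_image_of_injective _ hinj, card_univ, Fintype.card_fin]
  · intro f hf
    rw [Fintype.mem_piFinset] at hf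
    rw [mem_powerset]
    intro x hx
    obtain ⟨i, -, rfl⟩ := mem_image.mp hx
    exact hf i

/-- Multilinearity in the free positions only; the other k positions stay fixed. -/
theorem sum_detWith (g : Fin m → ℤ → K) (ψ : Fin m ⊕ Fin k → ℤ → K) (e : Fin k → ℤ) (P : Finset ℤ) :
    ∑ f ∈ Fintype.piFinset (fun _ : Fin m => P), (∏ i, g i (f i)) * detWith ψ e f =
      (Matrix.of fun r c => Sum.elim (fun i => ∑ v ∈ P, g i v * ψ c v) (fun j => ψ c (e j)) r).det := by
  set D : MultilinearMap K (fun _ : Fin m ⊕ Fin k => Fin m ⊕ Fin k → K) K :=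
    Matrix.detRowAlternating.toMultilinearMap with hD
  have hw : ∀ f, detWith ψ e f = D.currySum (fun i c => ψ c (f i)) (fun j c => ψ c (e j)) := by
    intro f
    rw [detWith, ← Matrix.det_transpose, MultilinearMap.currySum_apply]
    change _ = Matrix.det _
    congr 1
    ext r c
    rcases r with r | r <;> rfl
  simp only [hw]
  have h2 : (Matrix.of fun r c =>
      Sum.elim (fun i => ∑ v ∈ P, g i v * ψ c v) (fun j => ψ c (e j)) r).det =
      D.currySum (fun i => ∑ v ∈ P, g i v • (fun c => ψ c v)) (fun j c => ψ c (e j)) := by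
    rw [MultilinearMap.currySum_apply]
    change _ = Matrix.det _
    congr 1
    ext r c
    rcases r with r | r
    · simp [Finset.sum_apply]
    · rfl
  rw [h2, MultilinearMap.map_sum_finset, _root_.sum_apply]
  refine sum_congr rfl fun f _ => ?_
  rw [MultilinearMap.map_smul_univ, _root_.smul_apply, smul_eq_mul]

/-- Adding functions that are triangular on the fixed positions. -/
theorem det_extend (Φ ψ : Fin m ⊕ Fin k → ℤ → K) (w : ℤ → K) {e : Fin k → ℤ} (he : StrictMono e)
    {P : Finset ℤ} (hP : ∀ j, e j ∉ P) (h1 : ∀ j, ∀ v ∈ P, Φ (Sum.inr j) v = 0)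
    (h2 : ∀ i j, j < i → Φ (Sum.inr i) (e j) = 0) :
    (Matrix.of fun r c => Sum.elim (fun i => ∑ v ∈ P, w v * Φ (Sum.inl i) v * ψ c v)
        (fun j => ψ c (e j)) r).det * ∏ j, w (e j) * Φ (Sum.inr j) (e j) =
      (Matrix.of fun r c => ∑ v ∈ P ∪ univ.image e, w v * Φ r v * ψ c v).det := by
  set M : Matrix (Fin m ⊕ Fin k) (Fin m ⊕ Fin k) K :=
    Matrix.of fun r c => Sum.elim (fun i => ∑ v ∈ P, w v * Φ (Sum.inl i) v * ψ c v)
        (fun j => ψ c (e j)) r with hM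
  -- The claim is T * M = (full sums). The block of zeros reflects that the added functions vanish
  -- on P, and the lower right block is triangular, so det T is the diagonal product.
  set T : Matrix (Fin m ⊕ Fin k) (Fin m ⊕ Fin k) K :=
    Matrix.fromBlocks 1 (Matrix.of fun i j => w (e j) * Φ (Sum.inl i) (e j)) 0
      (Matrix.of fun i j => w (e j) * Φ (Sum.inr i) (e j)) with hT
  have hdet : T.det = ∏ j, w (e j) * Φ (Sum.inr j) (e j) := by
    rw [hT, Matrix.det_fromBlocks_zero₂₁, Matrix.det_one, one_mul, Matrix.det_of_isUpperTriangular]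
    · rfl
    · intro i j hij
      simp only [Matrix.of_apply]
      rw [h2 i j hij, mul_zero]
  rw [← hdet, mul_comm, ← Matrix.det_mul]
  congr 1
  have hd : Disjoint P (univ.image e) := by
    rw [disjoint_right]
    intro x hx
    obtain ⟨j, -, rfl⟩ := mem_image.mp hx
    exact hP j
  ext r c
  rw [Matrix.of_apply, sum_union hd, sum_image (fun x _ y _ h => he.injective h), Matrix.mul_apply,
    Fintype.sum_sum_type]
  rcases r with r | r
  · simp [hT, hM, Matrix.fromBlocks, Matrix.one_apply]
  · rw [sum_eq_zero (s := P) fun v hv => by rw [h1 r v hv]; ring]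
    simp [hT, hM, Matrix.fromBlocks]

/-- The sum over particle configurations as a single determinant. -/
theorem sum_detAt_mul_detAt (Φ ψ : Fin m ⊕ Fin k → ℤ → K) (w : ℤ → K) {e : Fin k → ℤ}
    (he : StrictMono e) {P : Finset ℤ} (hPe : ∀ v ∈ P, ∀ j, v < e j)
    (h1 : ∀ j, ∀ v ∈ P, Φ (Sum.inr j) v = 0) (h2 : ∀ i j, j < i → Φ (Sum.inr i) (e j) = 0) :
    (∑ A ∈ P.powerset, (∏ v ∈ A, w v) * (detAt (fun i => Φ (Sum.inl i)) A *
        detAt (fun i => ψ (finSumFinEquiv.symm i)) (A ∪ univ.image e))) *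
        ∏ j, w (e j) * Φ (Sum.inr j) (e j) =
      (Matrix.of fun r c => ∑ v ∈ P ∪ univ.image e, w v * Φ r v * ψ c v).det := by
  rw [← det_extend Φ ψ w he (fun j hj => lt_irrefl _ (hPe _ hj j)) h1 h2]
  congr 1
  rw [sum_subsets _ w (detWith ψ e) (detWith_perm ψ e)
    (fun f hf => detWith_of_not_injective ψ e hf) P
    (fun A => detAt (fun i => ψ (finSumFinEquiv.symm i)) (A ∪ univ.image e))]
  · rw [← sum_detWith]
  · intro a ha haP
    have hm : StrictMono (fun c => Sum.elim a e (finSumFinEquiv.symm c) : Fin (m + k) → ℤ) := by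
      intro i j hij
      induction i using Fin.addCases with
      | left i =>
        induction j using Fin.addCases with
        | left j =>
          simp only [finSumFinEquiv_symm_apply_castAdd, Sum.elim_inl]
          exact ha (show (i : ℕ) < j from hij)
        | right j =>
          simp only [finSumFinEquiv_symm_apply_castAdd, finSumFinEquiv_symm_apply_natAdd,
            Sum.elim_inl, Sum.elim_inr]
          exact hPe _ (haP i) j
      | right i =>
        induction j using Fin.addCases with
        | left j =>
          rw [Fin.lt_def] at hij
          simp at hij
          omega
        | right j =>
          simp only [finSumFinEquiv_symm_apply_natAdd, Sum.elim_inr]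
          exact he (Nat.lt_of_add_lt_add_left (show m + (i : ℕ) < m + j from hij))
    have himg : univ.image a ∪ univ.image e =
        univ.image (fun c => Sum.elim a e (finSumFinEquiv.symm c) : Fin (m + k) → ℤ) := by
      ext y
      simp only [mem_union, mem_image, mem_univ, true_and]
      constructor
      · rintro (⟨i, rfl⟩ | ⟨i, rfl⟩)
        exacts [⟨finSumFinEquiv (Sum.inl i), by simp⟩, ⟨finSumFinEquiv (Sum.inr i), by simp⟩]
      · rintro ⟨c, rfl⟩
        rcases finSumFinEquiv.symm c with i | i
        exacts [Or.inl ⟨i, rfl⟩, Or.inr ⟨i, rfl⟩]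
    rw [himg, detAt_image _ hm, detWith, ← Matrix.det_submatrix_equiv_self finSumFinEquiv.symm]
    rfl

end

/-! ### Evaluation of the determinant -/

theorem prod_fin_eq_prod_Icc {M : Type*} [CommMonoid M] (g : ℕ → M) (n : ℕ) :
    ∏ i : Fin n, g (i + 1) = ∏ i ∈ Icc 1 n, g i := by
  induction n with
  | zero => simp
  | succ n ih =>
    rw [Fin.prod_univ_castSucc, prod_Icc_succ_top (by omega), ← ih]
    rfl

/-- The Cauchy determinant for balanced `q`-integers. -/
theorem det_inv_bal {q : K} (hq : q ≠ 0) (a b : ℕ → ℤ) (n : ℕ)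
    (h0 : ∀ i ∈ Icc 1 n, ∀ j ∈ Icc 1 n, bal q (a i + b j) ≠ 0) :
    (Matrix.of fun i j : Fin n => (bal q (a (i + 1) + b (j + 1)))⁻¹).det *
      ∏ i ∈ Icc 1 n, ∏ j ∈ Icc 1 n, bal q (a i + b j) =
    (∏ j ∈ Icc 1 n, ∏ i ∈ Ico 1 j, bal q (a j - a i)) *
      ∏ j ∈ Icc 1 n, ∏ i ∈ Ico 1 j, bal q (b j - b i) := by
  induction n with
  | zero => simp
  | succ n ih =>
    have h0' := fun i (hi : i ≤ n) j (hj : j ≤ n) =>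
      h0 (i + 1) (mem_Icc.mpr ⟨by omega, by omega⟩) (j + 1) (mem_Icc.mpr ⟨by omega, by omega⟩)
    have ih := ih fun i hi j hj => h0 i (mem_Icc.mpr (by have := mem_Icc.mp hi; omega)) j
      (mem_Icc.mpr (by have := mem_Icc.mp hj; omega))
    set M : Matrix (Fin (n + 1)) (Fin (n + 1)) K :=
      Matrix.of fun i j => (bal q (a (i + 1) + b (j + 1)))⁻¹ with hM
    -- Multiples of the last row clear the last column above the corner.
    set c : Fin (n + 1) → K := fun i => if i = Fin.last n then 0 else
      bal q (a (n + 1) + b (n + 1)) / bal q (a (i + 1) + b (n + 1)) with hc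
    set N : Matrix (Fin (n + 1)) (Fin (n + 1)) K :=
      Matrix.of fun i j => M i j - c i * M (Fin.last n) j with hN
    have hMN : M.det = N.det := by
      refine Matrix.det_eq_of_forall_row_eq_smul_add_const c (Fin.last n) (by simp [hc]) ?_
      intro i j
      simp [hN, hc]
    have hcol : ∀ i : Fin n, N i.castSucc (Fin.last n) = 0 := by
      intro i
      have hne : i.castSucc ≠ Fin.last n := (Fin.castSucc_lt_last i).ne
      simp only [hN, hc, hM, Matrix.of_apply, if_neg hne, Fin.val_castSucc, Fin.val_last]
      have h1 := h0' i i.2.le n le_rfl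
      have h2 := h0' n le_rfl n le_rfl
      field_simp
      ring
    have hent : ∀ i j : Fin n, N i.castSucc j.castSucc =
        (bal q (a (i + 1) - a (n + 1)) / bal q (a (i + 1) + b (n + 1))) *
        ((bal q (b (j + 1) - b (n + 1)) / bal q (a (n + 1) + b (j + 1))) *
          (bal q (a (i + 1) + b (j + 1)))⁻¹) := by
      intro i j
      have hne : i.castSucc ≠ Fin.last n := (Fin.castSucc_lt_last i).ne
      simp only [hN, hc, hM, Matrix.of_apply, if_neg hne, Fin.val_castSucc, Fin.val_last]
      have h1 := h0' i i.2.le n le_rfl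
      have h2 := h0' n le_rfl j j.2.le
      have h3 := h0' i i.2.le j j.2.le
      -- By the three term relation the reduced entries are again of Cauchy form, up to a row factor
      -- and a column factor.
      have key := bal_mul_sub_mul hq (a := a (i + 1) + b (n + 1)) (b := -(a (n + 1) + b (j + 1)))
        (c := a (n + 1) + b (n + 1)) (d := -(a (i + 1) + b (j + 1)))
        (e := -(b (j + 1) - b (n + 1))) (f := a (i + 1) - a (n + 1))
        (by ring) (by ring) (by right; ring)
      rw [bal_neg, bal_neg, bal_neg] at key
      field_simp
      linear_combination -key
    have hdet : N.det = (bal q (a (n + 1) + b (n + 1)))⁻¹ *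
        ((∏ i ∈ Icc 1 n, bal q (a i - a (n + 1)) / bal q (a i + b (n + 1))) *
        ((∏ j ∈ Icc 1 n, bal q (b j - b (n + 1)) / bal q (a (n + 1) + b j)) *
        (Matrix.of fun i j : Fin n => (bal q (a (i + 1) + b (j + 1)))⁻¹).det)) := by
      rw [Matrix.det_succ_column N (Fin.last n), Fin.sum_univ_castSucc,
        sum_eq_zero fun i _ => by rw [hcol]; ring, zero_add]
      have hsub : N.submatrix (Fin.succAbove (Fin.last n)) (Fin.succAbove (Fin.last n)) =
          Matrix.of fun i j : Fin n =>
          (bal q (a (i + 1) - a (n + 1)) / bal q (a (i + 1) + b (n + 1))) *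
          (Matrix.of fun i j : Fin n =>
            (bal q (b (j + 1) - b (n + 1)) / bal q (a (n + 1) + b (j + 1))) *
            (Matrix.of fun i j : Fin n => (bal q (a (i + 1) + b (j + 1)))⁻¹) i j) i j := by
        ext i j
        simp only [Matrix.submatrix_apply, Fin.succAbove_last, hent, Matrix.of_apply]
      rw [hsub, Matrix.det_mul_column, Matrix.det_mul_row,
        prod_fin_eq_prod_Icc (fun i => bal q (a i - a (n + 1)) / bal q (a i + b (n + 1))),
        prod_fin_eq_prod_Icc (fun j => bal q (b j - b (n + 1)) / bal q (a (n + 1) + b j))]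
      have hlast : N (Fin.last n) (Fin.last n) = (bal q (a (n + 1) + b (n + 1)))⁻¹ := by
        simp [hN, hc, hM]
      rw [hlast, ← two_mul, pow_mul, neg_one_sq, one_pow, one_mul]
    have hI : ∀ g : ℕ → K, ∏ i ∈ Ico 1 (n + 1), g i = ∏ i ∈ Icc 1 n, g i := by
      intro g; rfl
    have hflip : ∀ c : ℕ → ℤ, ∏ i ∈ Icc 1 n, bal q (c (n + 1) - c i) =
        (-1) ^ n * ∏ i ∈ Icc 1 n, bal q (c i - c (n + 1)) := by
      intro c
      have : ∀ i, bal q (c (n + 1) - c i) = (-1) * bal q (c i - c (n + 1)) := by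
        intro i; rw [← neg_sub, bal_neg]; ring
      simp only [this]
      rw [prod_mul_distrib, prod_const, Nat.card_Icc, Nat.add_sub_cancel]
    rw [hMN, hdet, prod_Icc_succ_top (by omega), prod_Icc_succ_top (by omega),
      prod_Icc_succ_top (by omega), prod_Icc_succ_top (by omega), hI, hI, hflip a, hflip b]
    simp only [prod_Icc_succ_top (show 1 ≤ n + 1 by omega)]
    rw [prod_mul_distrib, prod_div_distrib, prod_div_distrib]
    have z1 : ∏ i ∈ Icc 1 n, bal q (a i + b (n + 1)) ≠ 0 := prod_ne_zero_iff.mpr fun i hi =>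
      h0 i (mem_Icc.mpr (by have := mem_Icc.mp hi; omega)) (n + 1) (mem_Icc.mpr (by omega))
    have z2 : ∏ i ∈ Icc 1 n, bal q (a (n + 1) + b i) ≠ 0 := prod_ne_zero_iff.mpr fun i hi =>
      h0 (n + 1) (mem_Icc.mpr (by omega)) i (mem_Icc.mpr (by have := mem_Icc.mp hi; omega))
    have z3 := h0 (n + 1) (mem_Icc.mpr (by omega)) (n + 1) (mem_Icc.mpr (by omega))
    have hsq : ((-1 : K) ^ n) * (-1) ^ n = 1 := by
      rw [← mul_pow]; simp
    generalize (Matrix.of fun i j : Fin n => (bal q (a (i + 1) + b (j + 1)))⁻¹).det = D at *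
    field_simp
    linear_combination (∏ i ∈ Icc 1 n, bal q (a i - a (n + 1))) *
      (∏ i ∈ Icc 1 n, bal q (b i - b (n + 1))) * (ih - hsq *
        (∏ x ∈ Icc 1 n, ∏ i ∈ Ico 1 x, bal q (a x - a i)) *
        ∏ x ∈ Icc 1 n, ∏ i ∈ Ico 1 x, bal q (b x - b i))

/-- The odd positions from `0` to `B - 1`. -/
noncomputable def oddBelow (B : ℤ) : Finset ℤ := (Icc 0 (B - 1)).filter (fun v => ¬ Even v)

/-- The summand is a central difference: for the product of `balProd q (2 * L + 1)` and `balProd q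
(2 * H - 1)` the three term relation produces [2v][2L+2H], and [2v] = [v](q^v + q^(-v)) supplies
both the weight and the extra factor of `upFun`. The lower boundary term vanishes at 0. -/
theorem sum_lowFun_mul_upFun [CharZero K] {q : K} (hq : q ≠ 0)
    (hs : ∀ k : ℤ, k ≠ 0 → bal q k ≠ 0) {L H : ℕ} (hH : 1 ≤ H) {B : ℤ} (hB : Even B) (hB0 : 0 ≤ B) :
    ∑ v ∈ oddBelow B, vertWt q v * lowFun q (2 * L) v * upFun q (2 * H - 1) v =
      (balProd q (2 * L + 1) B / balFact q (2 * L)) *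
      ((balProd q (2 * H - 1) B / (2 * balFact q (2 * H - 1))) *
        (bal q (2 * L + 2 * H))⁻¹) := by
  obtain ⟨t, rfl⟩ : ∃ t, H = t + 1 := ⟨H - 1, by omega⟩
  rw [show 2 * (t + 1) - 1 = 2 * t + 1 by omega]
  have hLH : bal q (2 * L + 2 * ((t + 1 : ℕ) : ℤ)) ≠ 0 := hs _ (by positivity)
  have h1 := balFact_ne_zero hs (2 * L)
  have h2 := balFact_ne_zero hs (2 * t + 1)
  have hset : oddBelow B = (Ico 0 B).filter (fun v => ¬ Even v) := by
    ext v; simp only [oddBelow, mem_filter, mem_Icc, mem_Ico]; refine and_congr_left fun _ => by omega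
  have htel := sum_telescope (K := K) (fun v => (balProd q (2 * L + 1) v / balFact q (2 * L)) *
      ((balProd q (2 * t + 1) v / (2 * balFact q (2 * t + 1))) *
        (bal q (2 * L + 2 * ((t + 1 : ℕ) : ℤ)))⁻¹))
    (fun v => vertWt q v * lowFun q (2 * L) v * upFun q (2 * t + 1) v)
    (Q := fun v => ¬ Even v) (fun v => by rw [Int.even_add_one]) (p := 0) (y := 1) (x := B)
    (by omega) (by omega) (by simp) (by omega) (by simpa using hB) ?_
  · rw [hset, htel]
    have : balProd q (2 * L + 1) (1 - 1) = 0 := balProd_eq_zero ⟨L, by omega, by push_cast; ring⟩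
    rw [this]; ring
  · intro v hv1 hv2 hv
    rw [balProd_succ_add_one, balProd_succ_sub_one, balProd_succ_add_one, balProd_succ_sub_one,
      vertWt, if_neg (by omega), fullWt, lowFun, upFun]
    have key := bal_mul_sub_mul hq (a := v + ((2 * L : ℕ) : ℤ) + 1) (b := v + ((2 * t : ℕ) : ℤ) + 1)
      (c := v - ((2 * L : ℕ) : ℤ) - 1) (d := v - ((2 * t : ℕ) : ℤ) - 1) (e := 2 * v)
      (f := 2 * L + 2 * ((t + 1 : ℕ) : ℤ)) (by push_cast; ring) (by ring) (by left; push_cast; ring)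
    rw [bal_two_mul hq] at key
    field_simp
    linear_combination (balProd q (2 * L) v * balProd q (2 * t) v) * key

/-- The value of the determinant of the sums. -/
noncomputable def cauchyValue (q : K) (N : ℕ) (L H : ℕ → ℕ) (B : ℤ) : K :=
  (∏ i ∈ Icc 1 N, balProd q (2 * L i + 1) B / balFact q (2 * L i)) *
  (∏ i ∈ Icc 1 N, balProd q (2 * H i - 1) B / (2 * balFact q (2 * H i - 1))) *
  (((∏ j ∈ Icc 1 N, ∏ i ∈ Ico 1 j, bal q (2 * L j - 2 * L i)) *
    ∏ j ∈ Icc 1 N, ∏ i ∈ Ico 1 j, bal q (2 * H j - 2 * H i)) /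
    ∏ i ∈ Icc 1 N, ∏ j ∈ Icc 1 N, bal q (2 * L i + 2 * H j))

/-- Row and column factors come out of the determinant and leave the Cauchy determinant with nodes
2L_i and 2H_j. -/
theorem det_sum_eq_cauchyValue [CharZero K] {q : K} (hq : q ≠ 0)
    (hs : ∀ k : ℤ, k ≠ 0 → bal q k ≠ 0) (N : ℕ) (L H : ℕ → ℕ) (hH : ∀ i ∈ Icc 1 N, 1 ≤ H i) {B : ℤ}
    (hB : Even B) (hB0 : 0 ≤ B) :
    (Matrix.of fun r c : Fin N => ∑ v ∈ oddBelow B,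
      vertWt q v * lowFun q (2 * L (r + 1)) v * upFun q (2 * H (c + 1) - 1) v).det =
      cauchyValue q N L H B := by
  have hH' : ∀ c : Fin N, 1 ≤ H (c + 1) := fun c => hH _ (mem_Icc.mpr ⟨by omega, by omega⟩)
  have hmat : (Matrix.of fun r c : Fin N => ∑ v ∈ oddBelow B,
      vertWt q v * lowFun q (2 * L (r + 1)) v * upFun q (2 * H (c + 1) - 1) v) =
      Matrix.of fun r c : Fin N => (balProd q (2 * L (r + 1) + 1) B / balFact q (2 * L (r + 1))) *
        (Matrix.of fun r c : Fin N =>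
          (balProd q (2 * H (c + 1) - 1) B / (2 * balFact q (2 * H (c + 1) - 1))) *
          (Matrix.of fun r c : Fin N => (bal q (2 * L (r + 1) + 2 * H (c + 1)))⁻¹) r c) r c := by
    ext r c
    simp only [Matrix.of_apply]
    rw [sum_lowFun_mul_upFun hq hs (hH' c) hB hB0]
  have hne : ∀ i ∈ Icc 1 N, ∀ j ∈ Icc 1 N, bal q (2 * L i + 2 * H j) ≠ 0 := by
    intro i _ j hj
    have := hH j hj
    exact hs _ (by omega)
  have hC := det_inv_bal hq (fun i => 2 * (L i : ℤ)) (fun i => 2 * (H i : ℤ)) N hne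
  rw [hmat, Matrix.det_mul_column, Matrix.det_mul_row,
    prod_fin_eq_prod_Icc (fun i => balProd q (2 * L i + 1) B / balFact q (2 * L i)),
    prod_fin_eq_prod_Icc (fun i => balProd q (2 * H i - 1) B / (2 * balFact q (2 * H i - 1))),
    cauchyValue, ← hC, mul_div_assoc, div_self, mul_one]
  · ring
  · exact prod_ne_zero_iff.mpr fun i hi => prod_ne_zero_iff.mpr fun j hj => hne i hi j hj

/-! ### The generating function as a product -/

theorem detAt_eq_zero_of_mem {k : ℕ} {φ : Fin k → ℤ → K} {A : Finset ℤ} {x : ℤ} (hx : x ∈ A)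
    (h : ∀ r, φ r x = 0) : detAt φ A = 0 := by
  unfold detAt
  split_ifs with hk
  · obtain ⟨c, hc⟩ : ∃ c, A.orderEmbOfFin hk c = x := by
      have : x ∈ Set.range (A.orderEmbOfFin hk) := by rw [range_orderEmbOfFin]; exact hx
      exact this
    exact Matrix.det_eq_zero_of_column_eq_zero c fun r => by rw [Matrix.of_apply, hc, h]
  · rfl

/-- The odd positions from `a` to `b - 1`. -/
noncomputable def oddBetween (a b : ℤ) : Finset ℤ := (Icc a (b - 1)).filter (fun v => ¬ Even v)

theorem image_eq_oddBetween (c : ℤ) (k : ℕ) :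
    univ.image (fun j : Fin k => 2 * (c + j) + 1) = oddBetween (2 * c) (2 * (c + k)) := by
  ext v
  simp only [oddBetween, mem_image, mem_univ, true_and, mem_filter, mem_Icc, Int.even_iff]
  constructor
  · rintro ⟨j, rfl⟩
    have := j.2
    omega
  · rintro ⟨h1, h2⟩
    exact ⟨⟨((v - 1) / 2 - c).toNat, by omega⟩, by simp only; omega⟩

/-- The fixed positions are the odd numbers 2(X+i)+1 for m < i ≤ m+k. The added function Φ_i
vanishes at all smaller odd positions, which is the required triangularity. -/
theorem sum_detAt_mul_detAt_oddBelow (Φ ψ : ℕ → ℤ → K) (w : ℤ → K) (m k X : ℕ)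
    (hΦ : ∀ i ∈ Icc (m + 1) (m + k), ∀ v ∈ oddBelow (2 * (X + i)), Φ i v = 0) :
    (∑ A ∈ (oddBelow (2 * (X + m + 1))).powerset, (∏ v ∈ A, w v) *
      (detAt (fun i : Fin m => Φ (i + 1)) A * detAt (fun i : Fin (m + k) => ψ (i + 1))
        (A ∪ oddBetween (2 * (X + m + 1)) (2 * (X + m + 1 + k))))) *
      ∏ i ∈ Icc (m + 1) (m + k), w (2 * (X + i) + 1) * Φ i (2 * (X + i) + 1) =
    (Matrix.of fun r c : Fin (m + k) =>
      ∑ v ∈ oddBelow (2 * (X + m + 1 + k)), w v * Φ (r + 1) v * ψ (c + 1) v).det := by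
  set e : Fin k → ℤ := fun j => 2 * ((X : ℤ) + m + 1 + j) + 1 with he
  have hem : StrictMono e := fun i j hij => by
    have : (i : ℕ) < j := hij
    simp only [he]; omega
  have key := sum_detAt_mul_detAt (fun i : Fin m ⊕ Fin k => Φ ((finSumFinEquiv i : Fin (m + k)) + 1))
    (fun i : Fin m ⊕ Fin k => ψ ((finSumFinEquiv i : Fin (m + k)) + 1)) w hem
    (P := oddBelow (2 * (X + m + 1))) ?_ ?_ ?_
  · have hun : oddBelow (2 * (X + m + 1)) ∪ univ.image e = oddBelow (2 * (X + m + 1 + k)) := by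
      rw [he, image_eq_oddBetween]
      ext v
      simp only [oddBelow, oddBetween, mem_union, mem_filter, mem_Icc, Int.even_iff]
      omega
    rw [hun] at key
    have hp : ∏ j, w (e j) * (fun i : Fin m ⊕ Fin k => Φ ((finSumFinEquiv i : Fin (m + k)) + 1))
        (Sum.inr j) (e j) =
        ∏ i ∈ Icc (m + 1) (m + k), w (2 * (X + i) + 1) * Φ i (2 * (X + i) + 1) := by
      rw [← Ico_add_one_right_eq_Icc, prod_Ico_eq_prod_range, ← Fin.prod_univ_eq_prod_range
        (fun i => w (2 * (X + ((m + 1 + i : ℕ) : ℤ)) + 1) * Φ (m + 1 + i)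
          (2 * (X + ((m + 1 + i : ℕ) : ℤ)) + 1)),
        show m + k + 1 - (m + 1) = k by omega]
      refine prod_congr rfl fun j _ => ?_
      simp only [finSumFinEquiv_apply_right, Fin.val_natAdd, he]
      have e1 : m + j + 1 = m + 1 + (j : ℕ) := by ring
      have e2 : 2 * ((X : ℤ) + m + 1 + j) + 1 = 2 * (X + ((m + 1 + j : ℕ) : ℤ)) + 1 := by
        push_cast; ring
      rw [e1, e2]
    rw [hp] at key
    rw [← Matrix.det_submatrix_equiv_self (finSumFinEquiv (m := m) (n := k))]
    refine Eq.trans ?_ key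
    rw [he, image_eq_oddBetween]
    simp only [finSumFinEquiv_apply_left, Fin.val_castAdd, Equiv.apply_symm_apply]
  · intro v hv j
    simp only [oddBelow, mem_filter, mem_Icc] at hv
    simp only [he]; omega
  · intro j v hv
    refine hΦ _ (mem_Icc.mpr ?_) v ?_
    · simp only [finSumFinEquiv_apply_right, Fin.val_natAdd]; omega
    · simp only [finSumFinEquiv_apply_right, Fin.val_natAdd]
      simp only [oddBelow, mem_filter, mem_Icc, Int.even_iff] at hv ⊢
      push_cast
      omega
  · intro i j hij
    have hij' : (j : ℕ) < i := hij
    refine hΦ _ (mem_Icc.mpr ?_) _ ?_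
    · simp only [finSumFinEquiv_apply_right, Fin.val_natAdd]; omega
    · simp only [finSumFinEquiv_apply_right, Fin.val_natAdd]
      simp only [oddBelow, mem_filter, mem_Icc, he, Int.even_iff]
      push_cast
      omega

theorem balProd_two_mul_eq_zero {q : K} {t : ℕ} {v : ℤ} (hv : v ∈ oddBelow (2 * t)) :
    balProd q (2 * t) v = 0 := by
  simp only [oddBelow, mem_filter, mem_Icc, Int.even_iff] at hv
  exact balProd_eq_zero ⟨((2 * t - 1 - v) / 2).toNat, by omega, by push_cast; omega⟩

section
variable {x u d m n : ℕ} {l h : ℕ → ℕ}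

theorem xTilde_nonneg (hm : m ≤ d) (hn : n ≤ u) : 0 ≤ xTilde x u d m n := by
  rw [xTilde_eq_max]; omega

/-- The region is cut at height 2d+1, the upper end of the extra unit step. At most one of the two
intervals of forced positions is nonempty, according to the sign of m - n. -/
theorem tilingGF_mul_prod_extra [CharZero K] {q : K} (hq : q ≠ 0)
    (hs : ∀ k : ℤ, k ≠ 0 → bal q k ≠ 0) (hm : m ≤ d) (hn : n ≤ u)
    (hl : ∀ i ∈ Set.Icc 1 m, l i ∈ Set.Icc 1 d) (hl_mono : StrictMonoOn l (Set.Icc 1 m))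
    (hh : ∀ i ∈ Set.Icc 1 n, h i ∈ Set.Icc 1 u) (hh_mono : StrictMonoOn h (Set.Icc 1 n)) {X : ℕ}
    (hX : xTilde x u d m n = X) :
    tilingGF (regionT x u d m n l h) (wt2 q) *
      ((∏ s ∈ range (2 * d + 1), ∏ v ∈ lowExtra x u d m n s, vertWt q v) *
        ∏ r ∈ range (2 * u), ∏ v ∈ upExtra x u d m n (westSide u d - r), vertWt q v) =
    ∑ A ∈ (oddBelow (2 * (X + (min m n : ℕ) + 1))).powerset, (∏ v ∈ A, vertWt q v) *
      (detAt (fun r : Fin m => lowFun q (2 * l (r + 1)))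
          (A ∪ oddBetween (2 * (X + n + 1)) (2 * (X + m + 1))) *
        detAt (fun r : Fin n => upFun q (2 * h (r + 1) - 1))
          (A ∪ oddBetween (2 * (X + m + 1)) (2 * (X + n + 1)))) := by
  have hR := isStrips_regionT (x := x) hm hn l h
  have hE : southeastSide d m n = 2 * d - m + n + 1 := rfl
  have hW : westSide u d = 2 * u + 2 * d + 1 := rfl
  -- In terms of x̃ both wedges have simple right ends on the middle line: 2(X+m+1) below and
  -- 2(X+n+1) above.
  have hSX : southSide x u d m n + d = X + m := by
    rw [← hX]; simp only [southSide, xTilde]; ring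
  have hLE : lowExtra x u d m n ((2 * d + 1 : ℕ) : ℤ) = oddBetween (2 * (X + n + 1)) (2 * (X + m + 1)) := by
    ext v
    simp only [lowExtra, oddBetween, lastPos, mem_filter, mem_Icc, Int.even_iff, hE]
    push_cast
    omega
  have hUE : upExtra x u d m n ((2 * d + 1 : ℕ) : ℤ) = oddBetween (2 * (X + m + 1)) (2 * (X + n + 1)) := by
    ext v
    simp only [upExtra, oddBetween, lastPos, mem_filter, mem_Icc, Int.even_iff, hE]
    push_cast
    omega
  rw [hR.tilingGF_eq_sum q ((2 * d + 1 : ℕ) : ℤ), sum_mul]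
  set J : ℤ := ((2 * d + 1 : ℕ) : ℤ) with hJ
  have hJ' : J = 2 * d + 1 := by rw [hJ]; push_cast; ring
  have hterm : ∀ A ∈ (sites (regionT x u d m n l h) (firstPos u d m n l h) (lastPos x u d m n) J).powerset,
      (∏ i ∈ A, vertWt q i) * (lowSum q (regionT x u d m n l h) J A *
        upSum q (regionT x u d m n l h) J A) *
      ((∏ s ∈ range (2 * d + 1), ∏ v ∈ lowExtra x u d m n s, vertWt q v) *
        ∏ r ∈ range (2 * u), ∏ v ∈ upExtra x u d m n (westSide u d - r), vertWt q v) =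
      (∏ v ∈ A, vertWt q v) * (detAt (fun r : Fin m => lowFun q (2 * l (r + 1)))
          (A ∪ oddBetween (2 * (X + n + 1)) (2 * (X + m + 1))) *
        detAt (fun r : Fin n => upFun q (2 * h (r + 1) - 1))
          (A ∪ oddBetween (2 * (X + m + 1)) (2 * (X + n + 1)))) := by
    intro A hA
    have hA' := fun i (hi : i ∈ A) => (hR.mem_sites i J).mp (mem_powerset.mp hA hi)
    have h1 := lowSum_eq_detAt (x := x) (h := h) hq hs hm hn hl hl_mono (2 * d + 1) le_rfl m le_rfl
      (fun i hi => ⟨fun _ => by omega, fun _ => by have := hi.1; omega⟩) A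
      (fun i hi => ⟨(hA' i hi).1, (hA' i hi).2.2⟩)
    have h2 := upSum_eq_detAt (x := x) (l := l) hq hs hm hn hh hh_mono (2 * u) le_rfl J
      (by rw [hJ', hW]; push_cast; ring) n le_rfl
      (fun i hi => ⟨fun _ => by have := (hh i hi).1; omega, fun _ => by have := hi.1; omega⟩) A
      (fun i hi => ⟨(hA' i hi).1, (hA' i hi).2.1⟩)
    rw [hLE] at h1
    rw [hUE] at h2
    rw [detAt_congr (ψ := fun r : Fin m => lowFun q (2 * l (r + 1)))] at h1
    · rw [detAt_congr (ψ := fun r : Fin n => upFun q (2 * h (r + 1) - 1))] at h2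
      · rw [← h1, ← h2]; ring
      · intro r v _
        rw [show n - n + 1 + (r : ℕ) = r + 1 by omega]
        congr 1
        omega
    · intro r v _
      rw [show m - m + 1 + (r : ℕ) = r + 1 by omega, Nat.add_sub_cancel]
  rw [sum_congr rfl hterm]
  -- Position 1 is no site because of the middle dent, and for u = 0 there is no strip above the
  -- line. Both restrictions can be dropped, because the determinants vanish on the additional
  -- configurations.
  have hsite : ∀ i, i ∈ sites (regionT x u d m n l h) (firstPos u d m n l h) (lastPos x u d m n) J ↔
      i ∈ oddBelow (2 * (X + (min m n : ℕ) + 1)) ∧ i ≠ 1 ∧ u ≠ 0 := by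
    intro i
    have hmid : cell 1 (J - 1) ∈ dents u d m n l h := by
      rw [mem_dents]; right; right; exact ⟨rfl, by omega⟩
    have hodd : cell 0 J ∉ dents u d m n l h := notMem_dents_of_odd (by rw [Int.even_iff]; omega)
    rw [hR.mem_sites, hR.mem, hR.mem, firstPos, if_neg (by omega), if_neg hodd, firstPos,
      if_pos (by omega), if_pos hmid]
    simp only [oddBelow, lastPos, mem_filter, mem_Icc, Int.even_iff, hE]
    push_cast
    omega
  refine sum_subset (powerset_mono.mpr fun i hi => ((hsite i).mp hi).1) ?_
  intro A hA hA'
  rw [mem_powerset] at hA hA'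
  rw [not_subset] at hA'
  obtain ⟨i, hi, hi'⟩ := hA'
  rw [hsite] at hi'
  by_cases hu : u = 0
  · rw [detAt_of_card_ne (k := n) _ (fun hc => ?_)]
    · ring
    · rw [show n = 0 by omega, card_eq_zero] at hc
      have : i ∈ (∅ : Finset ℤ) := by rw [← hc]; exact mem_union_left _ hi
      simp at this
  · have hi1 : i = 1 := by
      by_contra hne
      exact hi' ⟨hA hi, hne, hu⟩
    subst hi1
    rw [detAt_eq_zero_of_mem (mem_union_left _ hi) fun r => ?_]
    · ring
    · have hlr := (hl (r + 1) ⟨by omega, by omega⟩).1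
      rw [lowFun, balProd_two_mul_eq_zero, zero_div]
      simp only [oddBelow, mem_filter, mem_Icc, Int.even_iff]
      omega

/-- A sequence continued by `X + i` for `i > m`. -/
def continued (m X : ℕ) (l : ℕ → ℕ) (i : ℕ) : ℕ := if i ≤ m then l i else X + i

/-- The lower half is short of n - m functions; it is completed by `lowFun q (2 * (X + i))`, as if
there were further bumps l_i = X + i for m < i ≤ n. The triangular diagonal appears on the left. -/
theorem tilingGF_mul_of_le [CharZero K] {q : K} (hq : q ≠ 0)
    (hs : ∀ k : ℤ, k ≠ 0 → bal q k ≠ 0) (hm : m ≤ d) (hn : n ≤ u)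
    (hl : ∀ i ∈ Set.Icc 1 m, l i ∈ Set.Icc 1 d) (hl_mono : StrictMonoOn l (Set.Icc 1 m))
    (hh : ∀ i ∈ Set.Icc 1 n, h i ∈ Set.Icc 1 u) (hh_mono : StrictMonoOn h (Set.Icc 1 n)) {X : ℕ}
    (hX : xTilde x u d m n = X) (hmn : m ≤ n) :
    tilingGF (regionT x u d m n l h) (wt2 q) *
      (((∏ s ∈ range (2 * d + 1), ∏ v ∈ lowExtra x u d m n s, vertWt q v) *
        ∏ r ∈ range (2 * u), ∏ v ∈ upExtra x u d m n (westSide u d - r), vertWt q v) *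
        ∏ i ∈ Icc (m + 1) n, vertWt q (2 * (X + i) + 1) *
          lowFun q (2 * (X + i)) (2 * (X + i) + 1)) =
    cauchyValue q n (continued m X l) h (2 * (X + n + 1)) := by
  rw [← mul_assoc, tilingGF_mul_prod_extra hq hs hm hn hl hl_mono hh hh_mono hX,
    ← det_sum_eq_cauchyValue hq hs n _ h (fun i hi => (hh i (by simpa using hi)).1)
      (even_two_mul _) (by positivity)]
  obtain ⟨k, rfl⟩ := Nat.exists_eq_add_of_le hmn
  have key := sum_detAt_mul_detAt_oddBelow (fun i => lowFun q (2 * continued m X l i))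
    (fun i => upFun q (2 * h i - 1)) (vertWt q) m k X (fun i hi v hv => ?_)
  · have he : oddBetween (2 * (X + ((m + k : ℕ) : ℤ) + 1)) (2 * (X + m + 1)) = ∅ := by
      rw [oddBetween, Icc_eq_empty (by omega), filter_empty]
    have hB : (2 * (X + ((m + k : ℕ) : ℤ) + 1)) = 2 * (X + m + 1 + k) := by push_cast; ring
    rw [he, hB, min_eq_left hmn]
    refine Eq.trans ?_ key
    congr 1
    · refine sum_congr rfl fun A _ => ?_
      rw [union_empty]
      congr 2
      refine detAt_congr fun r v _ => ?_
      simp only [continued]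
      rw [if_pos (by omega)]
    · refine prod_congr rfl fun i hi => ?_
      simp only [continued]
      rw [if_neg (by have := mem_Icc.mp hi; omega)]
  · simp only [continued]
    rw [if_neg (by have := mem_Icc.mp hi; omega), lowFun, balProd_two_mul_eq_zero, zero_div]
    exact_mod_cast hv

/-- Here the upper half is completed, by fictitious bumps h_i = X + 1 + i, whose functions have the
odd degrees 2(X+i)+1. The roles of rows and columns are exchanged by transposition. -/
theorem tilingGF_mul_of_ge [CharZero K] {q : K} (hq : q ≠ 0)
    (hs : ∀ k : ℤ, k ≠ 0 → bal q k ≠ 0) (hm : m ≤ d) (hn : n ≤ u)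
    (hl : ∀ i ∈ Set.Icc 1 m, l i ∈ Set.Icc 1 d) (hl_mono : StrictMonoOn l (Set.Icc 1 m))
    (hh : ∀ i ∈ Set.Icc 1 n, h i ∈ Set.Icc 1 u) (hh_mono : StrictMonoOn h (Set.Icc 1 n)) {X : ℕ}
    (hX : xTilde x u d m n = X) (hmn : n ≤ m) :
    tilingGF (regionT x u d m n l h) (wt2 q) *
      (((∏ s ∈ range (2 * d + 1), ∏ v ∈ lowExtra x u d m n s, vertWt q v) *
        ∏ r ∈ range (2 * u), ∏ v ∈ upExtra x u d m n (westSide u d - r), vertWt q v) *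
        ∏ i ∈ Icc (n + 1) m, vertWt q (2 * (X + i) + 1) *
          upFun q (2 * (X + i) + 1) (2 * (X + i) + 1)) =
    cauchyValue q m l (continued n (X + 1) h) (2 * (X + m + 1)) := by
  rw [← mul_assoc, tilingGF_mul_prod_extra hq hs hm hn hl hl_mono hh hh_mono hX,
    ← det_sum_eq_cauchyValue hq hs m l _ (fun i hi => ?_) (even_two_mul _) (by positivity)]
  · obtain ⟨k, rfl⟩ := Nat.exists_eq_add_of_le hmn
    have key := sum_detAt_mul_detAt_oddBelow (fun i => upFun q (2 * continued n (X + 1) h i - 1))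
      (fun i => lowFun q (2 * l i)) (vertWt q) n k X (fun i hi v hv => ?_)
    · have he : oddBetween (2 * (X + ((n + k : ℕ) : ℤ) + 1)) (2 * (X + n + 1)) = ∅ := by
        rw [oddBetween, Icc_eq_empty (by omega), filter_empty]
      have hB : (2 * (X + ((n + k : ℕ) : ℤ) + 1)) = 2 * (X + n + 1 + k) := by push_cast; ring
      rw [he, hB, min_eq_right hmn, ← Matrix.det_transpose]
      have ht : (Matrix.of fun r c : Fin (n + k) => ∑ v ∈ oddBelow (2 * (X + n + 1 + k)),
          vertWt q v * lowFun q (2 * l (r + 1)) v *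
            upFun q (2 * continued n (X + 1) h (c + 1) - 1) v).transpose =
          Matrix.of fun r c : Fin (n + k) => ∑ v ∈ oddBelow (2 * (X + n + 1 + k)),
          vertWt q v * upFun q (2 * continued n (X + 1) h (r + 1) - 1) v *
            lowFun q (2 * l (c + 1)) v := by
        ext r c
        simp only [Matrix.transpose_apply, Matrix.of_apply]
        exact sum_congr rfl fun v _ => by ring
      rw [ht]
      refine Eq.trans ?_ key
      congr 1
      · refine sum_congr rfl fun A _ => ?_
        rw [union_empty, mul_comm (detAt _ _)]
        congr 2
        refine detAt_congr fun r v _ => ?_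
        simp only [continued]
        rw [if_pos (by omega)]
      · refine prod_congr rfl fun i hi => ?_
        simp only [continued]
        rw [if_neg (by have := mem_Icc.mp hi; omega),
          show 2 * (X + 1 + i) - 1 = 2 * (X + i) + 1 by omega]
    · simp only [continued]
      rw [if_neg (by have := mem_Icc.mp hi; omega),
        show 2 * (X + 1 + i) - 1 = 2 * (X + i) + 1 by omega, upFun, balProd_two_mul_eq_zero,
        mul_zero, zero_div]
      exact_mod_cast hv
  · rw [continued]
    split_ifs with hi'
    · exact (hh i ⟨(mem_Icc.mp hi).1, hi'⟩).1
    · omega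

end

/-! ### Products over intervals -/

theorem prod_Icc_eq_prod_range {M : Type*} [CommMonoid M] (f : ℕ → M) (a k : ℕ) :
    ∏ i ∈ Icc (a + 1) (a + k), f i = ∏ r ∈ range k, f (a + 1 + r) := by
  rw [← Ico_add_one_right_eq_Icc, prod_Ico_eq_prod_range, show a + k + 1 - (a + 1) = k by omega]

theorem prod_Icc_split {M : Type*} [CommMonoid M] (f : ℕ → M) (a k : ℕ) :
    ∏ i ∈ Icc 1 (a + k), f i = (∏ i ∈ Icc 1 a, f i) * ∏ i ∈ Icc (a + 1) (a + k), f i := by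
  have h := fun t => prod_Icc_eq_prod_range f 0 t
  simp only [zero_add] at h
  rw [prod_Icc_eq_prod_range, h, h, prod_range_add]
  congr 1
  refine prod_congr rfl fun r _ => ?_
  congr 1
  omega

/-- The product of `g(2), g(4), …, g(2t)`. -/
def evenFact (g : ℤ → K) (t : ℕ) : K := ∏ r ∈ range t, g (2 * (r + 1))

/-- The product of `g(1), g(2), …, g(t)`. -/
def fullFact (g : ℤ → K) (t : ℕ) : K := ∏ r ∈ range t, g (r + 1)

section
variable {g : ℤ → K}

theorem evenFact_ne_zero (hg : ∀ k, 0 < k → g k ≠ 0) (t : ℕ) : evenFact g t ≠ 0 :=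
  prod_ne_zero_iff.mpr fun r _ => hg _ (by positivity)

theorem evenFact_mul_prod_Icc (c : ℤ) {t t' M k : ℕ} (ht : (t : ℤ) = c + M) (ht' : t' = t + k) :
    evenFact g t * ∏ j ∈ Icc (M + 1) (M + k), g (2 * (c + j)) = evenFact g t' := by
  rw [prod_Icc_eq_prod_range, ht', evenFact, evenFact, prod_range_add]
  congr 1
  refine prod_congr rfl fun r _ => ?_
  congr 1
  push_cast
  rw [ht]
  ring

/-- The product of `g(2 (a_j - a_i))` over `1 ≤ i < j ≤ n`. -/
def vandermonde (g : ℤ → K) (n : ℕ) (a : ℕ → ℕ) : K :=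
  ∏ j ∈ Icc 1 n, ∏ i ∈ Ico 1 j, g (2 * ((a j : ℤ) - a i))

/-- The product of `g(2 (a_i + b_j))` over `1 ≤ i ≤ m` and `1 ≤ j ≤ n`. -/
def crossProd (g : ℤ → K) (m n : ℕ) (a b : ℕ → ℕ) : K :=
  ∏ i ∈ Icc 1 m, ∏ j ∈ Icc 1 n, g (2 * ((a i : ℤ) + b j))

theorem vandermonde_continued (M k Y : ℕ) (a : ℕ → ℕ) :
    vandermonde g (M + k) (continued M Y a) = vandermonde g M a *
      ((∏ i ∈ Icc 1 M, ∏ j ∈ Icc (M + 1) (M + k), g (2 * (((Y : ℤ) - a i) + j))) *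
        ∏ j ∈ Icc (M + 1) (M + k), evenFact g (M + k - j)) := by
  rw [vandermonde, prod_Icc_split, vandermonde]
  congr 1
  · refine prod_congr rfl fun j hj => prod_congr rfl fun i hi => ?_
    have := mem_Icc.mp hj
    have := mem_Ico.mp hi
    rw [continued, continued, if_pos (by omega), if_pos (by omega)]
  · have hE : ∏ j ∈ Icc (M + 1) (M + k), evenFact g (M + k - j) =
        ∏ j ∈ Icc (M + 1) (M + k), evenFact g (j - (M + 1)) := by
      rw [prod_Icc_eq_prod_range, prod_Icc_eq_prod_range, ← prod_range_reflect]
      refine prod_congr rfl fun r hr => ?_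
      have := mem_range.mp hr
      congr 1
      omega
    rw [hE, prod_comm, ← prod_mul_distrib]
    refine prod_congr rfl fun j hj => ?_
    have hj' := mem_Icc.mp hj
    have hset : Ico 1 j = Icc 1 M ∪ Ico (M + 1) j := by
      ext i; simp only [mem_union, mem_Icc, mem_Ico]; omega
    rw [hset, prod_union]
    · congr 1
      · refine prod_congr rfl fun i hi => ?_
        have := mem_Icc.mp hi
        rw [continued, continued, if_neg (by omega), if_pos (by omega)]
        congr 1
        push_cast
        ring
      · rw [prod_Ico_eq_prod_range, evenFact, ← prod_range_reflect]
        refine prod_congr rfl fun r hr => ?_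
        have := mem_range.mp hr
        rw [continued, continued, if_neg (by omega), if_neg (by omega)]
        congr 1
        omega
    · rw [disjoint_left]
      intro i hi hi'
      have := mem_Icc.mp hi
      have := mem_Ico.mp hi'
      omega

theorem crossProd_continued (M k N Y : ℕ) (a b : ℕ → ℕ) :
    crossProd g (M + k) N (continued M Y a) b = crossProd g M N a b *
      ∏ j ∈ Icc 1 N, ∏ i ∈ Icc (M + 1) (M + k), g (2 * (((Y : ℤ) + b j) + i)) := by
  rw [crossProd, prod_Icc_split, crossProd]
  congr 1
  · refine prod_congr rfl fun i hi => prod_congr rfl fun j hj => ?_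
    have := mem_Icc.mp hi
    rw [continued, if_pos (by omega)]
  · rw [prod_comm]
    refine prod_congr rfl fun j hj => prod_congr rfl fun i hi => ?_
    have := mem_Icc.mp hi
    rw [continued, if_neg (by omega)]
    congr 1
    push_cast
    ring

/-- The factors pairing an actual value with a continued one are precisely those by which the ratios
of `evenFact` for the enlarged and the original size differ, and the differences among continued
values cancel the remaining denominators. One product over the continued indices survives. -/
theorem prod_continued (hg : ∀ k, 0 < k → g k ≠ 0) (a b : ℕ → ℕ) (M k Y Z : ℕ)
    (ha : ∀ i ∈ Icc 1 M, a i ≤ Y + M) :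
    (∏ i ∈ Icc 1 (M + k), evenFact g (Z + (M + k) + continued M Y a i) /
        evenFact g (Y + (M + k) - continued M Y a i)) *
      (∏ i ∈ Icc 1 (M + k), evenFact g (Y + (M + k) + b i) / evenFact g (Z + (M + k) - b i)) *
      ((vandermonde g (M + k) (continued M Y a) * vandermonde g (M + k) b) /
        crossProd g (M + k) (M + k) (continued M Y a) b) =
    (∏ i ∈ Icc 1 M, evenFact g (Z + (M + k) + a i) / evenFact g (Y + M - a i)) *
      (∏ i ∈ Icc 1 (M + k), evenFact g (Y + M + b i) / evenFact g (Z + (M + k) - b i)) *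
      ((vandermonde g M a * vandermonde g (M + k) b) / crossProd g M (M + k) a b) *
      ∏ i ∈ Icc (M + 1) (M + k), evenFact g (Z + (M + k) + (Y + i)) := by
  have e1 : ∏ i ∈ Icc 1 (M + k), evenFact g (Z + (M + k) + continued M Y a i) /
        evenFact g (Y + (M + k) - continued M Y a i) =
      (∏ i ∈ Icc 1 M, evenFact g (Z + (M + k) + a i) / evenFact g (Y + (M + k) - a i)) *
        ∏ i ∈ Icc (M + 1) (M + k), evenFact g (Z + (M + k) + (Y + i)) / evenFact g (M + k - i) := by
    rw [prod_Icc_split]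
    congr 1
    · refine prod_congr rfl fun i hi => ?_
      rw [continued, if_pos (mem_Icc.mp hi).2]
    · refine prod_congr rfl fun i hi => ?_
      rw [continued, if_neg (by have := mem_Icc.mp hi; omega), Nat.add_sub_add_left]
  have e2 : ∏ i ∈ Icc 1 M, evenFact g (Y + (M + k) - a i) =
      (∏ i ∈ Icc 1 M, evenFact g (Y + M - a i)) *
        ∏ i ∈ Icc 1 M, ∏ j ∈ Icc (M + 1) (M + k), g (2 * (((Y : ℤ) - a i) + j)) := by
    rw [← prod_mul_distrib]
    refine prod_congr rfl fun i hi => ?_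
    have := ha i hi
    rw [evenFact_mul_prod_Icc (t' := Y + (M + k) - a i) _ (by omega) (by omega)]
  have e3 : ∏ i ∈ Icc 1 (M + k), evenFact g (Y + (M + k) + b i) =
      (∏ i ∈ Icc 1 (M + k), evenFact g (Y + M + b i)) *
        ∏ j ∈ Icc 1 (M + k), ∏ i ∈ Icc (M + 1) (M + k), g (2 * (((Y : ℤ) + b j) + i)) := by
    rw [← prod_mul_distrib]
    refine prod_congr rfl fun i hi => ?_
    rw [evenFact_mul_prod_Icc (t' := Y + (M + k) + b i) _ (by push_cast; ring) (by ring)]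
  have z1 : ∏ i ∈ Icc 1 M, ∏ j ∈ Icc (M + 1) (M + k), g (2 * (((Y : ℤ) - a i) + j)) ≠ 0 :=
    prod_ne_zero_iff.mpr fun i hi => prod_ne_zero_iff.mpr fun j hj => hg _ (by
      have := ha i hi; have := mem_Icc.mp hj; omega)
  have z2 : ∏ j ∈ Icc 1 (M + k), ∏ i ∈ Icc (M + 1) (M + k), g (2 * (((Y : ℤ) + b j) + i)) ≠ 0 :=
    prod_ne_zero_iff.mpr fun i hi => prod_ne_zero_iff.mpr fun j hj => hg _ (by
      have := mem_Icc.mp hj; omega)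
  have z3 : ∏ j ∈ Icc (M + 1) (M + k), evenFact g (M + k - j) ≠ 0 :=
    prod_ne_zero_iff.mpr fun i _ => evenFact_ne_zero hg _
  rw [e1, prod_div_distrib, prod_div_distrib, prod_div_distrib, prod_div_distrib,
    prod_div_distrib, e2, e3, vandermonde_continued, crossProd_continued]
  generalize (∏ i ∈ Icc 1 M, ∏ j ∈ Icc (M + 1) (M + k), g (2 * (((Y : ℤ) - a i) + j))) = G1 at *
  generalize (∏ j ∈ Icc 1 (M + k), ∏ i ∈ Icc (M + 1) (M + k), g (2 * (((Y : ℤ) + b j) + i))) = G2 at *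
  generalize (∏ j ∈ Icc (M + 1) (M + k), evenFact g (M + k - j)) = G3 at *
  simp only [div_eq_mul_inv, mul_inv]
  have h1 := mul_inv_cancel₀ z1
  have h2 := mul_inv_cancel₀ z2
  have h3 := mul_inv_cancel₀ z3
  linear_combination (exp := 1) (∏ i ∈ Icc 1 M, evenFact g (Z + (M + k) + a i)) *
    (∏ i ∈ Icc 1 M, evenFact g (Y + M - a i))⁻¹ *
    (∏ i ∈ Icc 1 (M + k), evenFact g (Y + M + b i)) *
    (∏ i ∈ Icc 1 (M + k), evenFact g (Z + (M + k) - b i))⁻¹ *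
    (vandermonde g M a * vandermonde g (M + k) b * (crossProd g M (M + k) a b)⁻¹) *
    (∏ i ∈ Icc (M + 1) (M + k), evenFact g (Z + (M + k) + (Y + i))) *
    (h1 * (G2 * G2⁻¹) * (G3 * G3⁻¹) + h2 * (G3 * G3⁻¹) + h3)

theorem prod_pairs {M : Type*} [CommMonoid M] (F : ℕ → M) (c k : ℕ) :
    (∏ r ∈ range k, F (c + k + r)) * ∏ r ∈ range k, F (c + r) =
      ∏ r ∈ range k, F (c + 2 * r) * F (c + 2 * r + 1) := by
  have h : ∀ k, ∏ r ∈ range (k + k), F (c + r) = ∏ r ∈ range k, F (c + 2 * r) * F (c + 2 * r + 1) := by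
    intro k
    induction k with
    | zero => simp
    | succ k ih =>
      rw [show k + 1 + (k + 1) = k + k + 1 + 1 by ring, prod_range_succ, prod_range_succ, ih,
        prod_range_succ, mul_assoc]
      congr 3 <;> ring
  rw [← h, prod_range_add, mul_comm]
  simp only [add_assoc]

end

/-- The forced particles fill a triangle. Its lines, indexed by the distance κ from its base, are
exchanged for coordinates along the other two directions: v = c + i + j and κ = i - j. -/
theorem prod_range_prod_triangle {M : Type*} [CommMonoid M] (w : ℤ → M) (c : ℤ) {s t N : ℕ}
    (hN : t ≤ s + N) :
    ∏ κ ∈ range N, ∏ v ∈ (Icc (c + 2 * s + 2 + κ) (c + 2 * t - κ)).filter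
        (fun v => Even (v + κ + c)), w v =
      ∏ i ∈ Icc (s + 1) t, ∏ j ∈ Icc (s + 1) i, w (c + i + j) := by
  rw [prod_sigma', prod_sigma']
  refine prod_bij' (fun x _ => ⟨((x.2 - c + x.1) / 2).toNat, ((x.2 - c - x.1) / 2).toNat⟩)
    (fun y _ => ⟨y.1 - y.2, c + y.1 + y.2⟩) ?_ ?_ ?_ ?_ ?_
  · rintro ⟨κ, v⟩ hx
    simp only [mem_sigma, mem_range, mem_filter, mem_Icc, Int.even_iff] at hx ⊢
    omega
  · rintro ⟨i, j⟩ hy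
    simp only [mem_sigma, mem_range, mem_filter, mem_Icc, Int.even_iff] at hy ⊢
    omega
  · rintro ⟨κ, v⟩ hx
    simp only [mem_sigma, mem_range, mem_filter, mem_Icc, Int.even_iff] at hx
    simp only [Sigma.mk.injEq, heq_eq_eq]
    omega
  · rintro ⟨i, j⟩ hy
    simp only [mem_sigma, mem_Icc] at hy
    simp only [Sigma.mk.injEq, heq_eq_eq]
    omega
  · rintro ⟨κ, v⟩ hx
    simp only [mem_sigma, mem_range, mem_filter, mem_Icc, Int.even_iff] at hx
    simp only
    congr 1
    omega

/-! ### The generating function in normal form -/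

/-- The triangular product by which the upper and the lower part differ. -/
def triangle (g : ℤ → K) (X m n : ℕ) : K :=
  (∏ i ∈ Icc (m + 1) n, ∏ j ∈ Icc (m + 1) i, g (2 * X + 1 + i + j)) *
    ∏ i ∈ Icc (n + 1) m, ∏ j ∈ Ico (n + 1) i, g (2 * X + 1 + i + j)

/-- The product formula without the powers of `2` and `q`, before cancellation. -/
def normalForm (g : ℤ → K) (X m n : ℕ) (l h : ℕ → ℕ) : K :=
  (vandermonde g m l * vandermonde g n h) / crossProd g m n l h *
    ((∏ i ∈ Icc 1 m, (fullFact g (2 * l i))⁻¹) * ∏ i ∈ Icc 1 n, (fullFact g (2 * h i - 1))⁻¹) *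
    ((∏ i ∈ Icc 1 m, evenFact g (X + n + 1 + l i) / evenFact g (X + m - l i)) *
      ∏ i ∈ Icc 1 n, evenFact g (X + m + h i) / evenFact g (X + n + 1 - h i)) *
    triangle g X m n

theorem prod_zpow_eq {c : K} (hc : c ≠ 0) {ι : Type*} (S : Finset ι) (f : ι → ℤ) :
    ∏ i ∈ S, c ^ f i = c ^ ∑ i ∈ S, f i := by
  classical
  induction S using Finset.induction_on with
  | empty => simp
  | insert a S ha ih => rw [prod_insert ha, sum_insert ha, ih, zpow_add₀ hc]

theorem balFact_eq (q : K) (t : ℕ) : balFact q t = 2 ^ t * fullFact (bal q) t := by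
  rw [balFact, fullFact, prod_mul_distrib, prod_const, card_range]

theorem crossProd_comm (g : ℤ → K) (m n : ℕ) (a b : ℕ → ℕ) :
    crossProd g m n a b = crossProd g n m b a := by
  rw [crossProd, prod_comm, crossProd]
  simp only [add_comm]

theorem balProd_eq_div {q : K} (hg : ∀ k : ℤ, 0 < k → bal q k ≠ 0) {L b : ℕ} (h : L + 1 ≤ b) :
    balProd q (2 * L + 1) (2 * b) = evenFact (bal q) (b + L) / evenFact (bal q) (b - L - 1) := by
  rw [eq_div_iff (evenFact_ne_zero hg _), mul_comm]
  obtain ⟨c, rfl⟩ := Nat.exists_eq_add_of_le h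
  rw [show L + 1 + c - L - 1 = c by omega, show L + 1 + c + L = c + (2 * L + 1) by ring, evenFact,
    evenFact, prod_range_add, balProd]
  congr 1
  refine prod_congr rfl fun r _ => ?_
  congr 1
  push_cast
  ring

theorem balProd_two_mul_self (q : K) (t : ℕ) :
    balProd q (2 * t) (2 * t + 1) = evenFact (bal q) (2 * t) := by
  rw [balProd, evenFact]
  refine prod_congr rfl fun r _ => ?_
  congr 1
  push_cast
  ring

/-- In this form the weights of the forced particles can be cancelled against products of
q-integers. -/
theorem vertWt_eq {q : K} [CharZero K] (hq : q ≠ 0) {v : ℤ} (hv : v ≠ 0) (h : bal q v ≠ 0) :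
    vertWt q v = bal q (2 * v) / (2 * bal q v) := by
  rw [vertWt, if_neg hv, fullWt, bal_two_mul hq]
  field_simp

/-- Row i of the triangle extends `evenFact` from 2X+1+M+i to 2X+1+2i. Together with the values at
2(X+i) these form a run of 2k consecutive arguments, and removing its lower half leaves the
right-hand side. -/
theorem prod_evenFact_mul_triangle {g : ℤ → K} (hg : ∀ k, 0 < k → g k ≠ 0) (X M k : ℕ) :
    (∏ i ∈ Icc (M + 1) (M + k), evenFact g (2 * (X + i))) *
      ∏ i ∈ Icc (M + 1) (M + k), ∏ j ∈ Icc (M + 1) i, g (2 * (2 * X + 1 + i + j)) =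
    ∏ i ∈ Icc (M + 1) (M + k), evenFact g (2 * X + 1 + (M + k) + i) := by
  have h1 : (∏ i ∈ Icc (M + 1) (M + k), evenFact g (2 * X + 1 + M + i)) *
      ∏ i ∈ Icc (M + 1) (M + k), ∏ j ∈ Icc (M + 1) i, g (2 * (2 * X + 1 + i + j)) =
      ∏ i ∈ Icc (M + 1) (M + k), evenFact g (2 * X + 1 + 2 * i) := by
    rw [← prod_mul_distrib]
    refine prod_congr rfl fun i hi => ?_
    obtain ⟨s, rfl⟩ := Nat.exists_eq_add_of_le (show M ≤ i by have := mem_Icc.mp hi; omega)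
    rw [evenFact_mul_prod_Icc (t' := 2 * X + 1 + 2 * (M + s)) _ (by push_cast; ring) (by ring)]
  have h2 := prod_pairs (evenFact g) (2 * X + 2 * M + 2) k
  have e1 : ∏ i ∈ Icc (M + 1) (M + k), evenFact g (2 * X + 1 + (M + k) + i) =
      ∏ r ∈ range k, evenFact g (2 * X + 2 * M + 2 + k + r) := by
    rw [prod_Icc_eq_prod_range]
    exact prod_congr rfl fun r _ => by congr 1; ring
  have e2 : ∏ i ∈ Icc (M + 1) (M + k), evenFact g (2 * X + 1 + M + i) =
      ∏ r ∈ range k, evenFact g (2 * X + 2 * M + 2 + r) := by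
    rw [prod_Icc_eq_prod_range]
    exact prod_congr rfl fun r _ => by congr 1; ring
  have e3 : (∏ i ∈ Icc (M + 1) (M + k), evenFact g (2 * (X + i))) *
      ∏ i ∈ Icc (M + 1) (M + k), evenFact g (2 * X + 1 + 2 * i) =
      ∏ r ∈ range k, evenFact g (2 * X + 2 * M + 2 + 2 * r) *
        evenFact g (2 * X + 2 * M + 2 + 2 * r + 1) := by
    rw [prod_Icc_eq_prod_range, prod_Icc_eq_prod_range, ← prod_mul_distrib]
    exact prod_congr rfl fun r _ => by congr 2 <;> ring
  have z : ∏ i ∈ Icc (M + 1) (M + k), evenFact g (2 * X + 1 + M + i) ≠ 0 :=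
    prod_ne_zero_iff.mpr fun i _ => evenFact_ne_zero hg _
  apply mul_left_cancel₀ z
  rw [mul_left_comm, h1, e3, ← h2, e1, e2, mul_comm]

section
variable {x u d m n : ℕ} {l h : ℕ → ℕ}

/-- The forced particles below the middle line are the triangle without its base; the second product
adds the base, which lies on the middle line. -/
theorem prod_lowExtra {X : ℕ} {M : Type*} [CommMonoid M] (w : ℤ → M)
    (hX : xTilde x u d m n = X) (hm : m ≤ d) :
    (∏ s ∈ range (2 * d + 1), ∏ v ∈ lowExtra x u d m n s, w v) *
      ∏ i ∈ Icc (n + 1) m, w (2 * (X + i) + 1) =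
    ∏ i ∈ Icc (n + 1) m, ∏ j ∈ Icc (n + 1) i, w (2 * X + 1 + i + j) := by
  have hE : southeastSide d m n = 2 * d - m + n + 1 := rfl
  have hSX : southSide x u d m n + d = X + m := by
    rw [← hX]; simp only [southSide, xTilde]; ring
  rw [← prod_range_prod_triangle w (2 * X + 1) (N := 2 * d + 1 + 1) (by omega),
    prod_range_succ' _ (2 * d + 1)]
  congr 1
  · rw [← prod_range_reflect]
    refine prod_congr rfl fun r hr => ?_
    have := mem_range.mp hr
    congr 1
    ext v
    simp only [lowExtra, lastPos, mem_filter, mem_Icc, Int.even_iff, hE]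
    push_cast
    omega
  · have he : (Icc (2 * (X : ℤ) + 1 + 2 * n + 2 + (0 : ℕ)) (2 * X + 1 + 2 * m - (0 : ℕ))).filter
        (fun v : ℤ => Even (v + (0 : ℕ) + (2 * X + 1))) =
        (Icc (n + 1) m).image (fun i : ℕ => 2 * ((X : ℤ) + i) + 1) := by
      ext v
      simp only [mem_filter, mem_Icc, Int.even_iff, mem_image]
      constructor
      · intro hv
        exact ⟨((v - 1) / 2 - X).toNat, by omega, by omega⟩
      · rintro ⟨i, hi, rfl⟩
        omega
    rw [he, prod_image fun i _ j _ hij => by omega]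

theorem prod_upExtra {X : ℕ} {M : Type*} [CommMonoid M] (w : ℤ → M)
    (hX : xTilde x u d m n = X) (hn : n ≤ u) :
    (∏ r ∈ range (2 * u), ∏ v ∈ upExtra x u d m n (westSide u d - r), w v) *
      ∏ i ∈ Icc (m + 1) n, w (2 * (X + i) + 1) =
    ∏ i ∈ Icc (m + 1) n, ∏ j ∈ Icc (m + 1) i, w (2 * X + 1 + i + j) := by
  have hE : southeastSide d m n = 2 * d - m + n + 1 := rfl
  have hW : westSide u d = 2 * u + 2 * d + 1 := rfl
  have hSX : southSide x u d m n + d = X + m := by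
    rw [← hX]; simp only [southSide, xTilde]; ring
  rw [← prod_range_prod_triangle w (2 * X + 1) (N := 2 * u + 1) (by omega),
    prod_range_succ' _ (2 * u)]
  congr 1
  · rw [← prod_range_reflect]
    refine prod_congr rfl fun r hr => ?_
    have := mem_range.mp hr
    congr 1
    ext v
    simp only [upExtra, lastPos, mem_filter, mem_Icc, Int.even_iff, hE, hW]
    push_cast
    omega
  · have he : (Icc (2 * (X : ℤ) + 1 + 2 * m + 2 + (0 : ℕ)) (2 * X + 1 + 2 * n - (0 : ℕ))).filter
        (fun v : ℤ => Even (v + (0 : ℕ) + (2 * X + 1))) =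
        (Icc (m + 1) n).image (fun i : ℕ => 2 * ((X : ℤ) + i) + 1) := by
      ext v
      simp only [mem_filter, mem_Icc, Int.even_iff, mem_image]
      constructor
      · intro hv
        exact ⟨((v - 1) / 2 - X).toNat, by omega, by omega⟩
      · rintro ⟨i, hi, rfl⟩
        omega
    rw [he, prod_image fun i _ j _ hij => by omega]

theorem prod_lowExtra_eq_one {M : Type*} [CommMonoid M] (w : ℤ → M) (hmn : m ≤ n) :
    ∏ s ∈ range (2 * d + 1), ∏ v ∈ lowExtra x u d m n s, w v = 1 := by
  have hE : southeastSide d m n = 2 * d - m + n + 1 := rfl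
  refine prod_eq_one fun s hs => ?_
  have := mem_range.mp hs
  rw [lowExtra, Icc_eq_empty, filter_empty, prod_empty]
  simp only [lastPos, hE]
  omega

theorem prod_upExtra_eq_one {M : Type*} [CommMonoid M] (w : ℤ → M) (hmn : n ≤ m) :
    ∏ r ∈ range (2 * u), ∏ v ∈ upExtra x u d m n (westSide u d - r), w v = 1 := by
  have hE : southeastSide d m n = 2 * d - m + n + 1 := rfl
  have hW : westSide u d = 2 * u + 2 * d + 1 := rfl
  refine prod_eq_one fun s hs => ?_
  have := mem_range.mp hs
  rw [upExtra, Icc_eq_empty, filter_empty, prod_empty]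
  simp only [lastPos, hE, hW]
  omega

theorem cauchyValue_eq {q : K} (hg : ∀ k : ℤ, 0 < k → bal q k ≠ 0) {N b : ℕ} {L H : ℕ → ℕ}
    (hL : ∀ i ∈ Icc 1 N, L i + 1 ≤ b) (hH : ∀ i ∈ Icc 1 N, 1 ≤ H i ∧ H i ≤ b) :
    cauchyValue q N L H (2 * b) =
      (∏ i ∈ Icc 1 N, evenFact (bal q) (b + L i) / evenFact (bal q) (b - 1 - L i)) *
      (∏ i ∈ Icc 1 N, evenFact (bal q) (b - 1 + H i) / evenFact (bal q) (b - H i)) *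
      ((vandermonde (bal q) N L * vandermonde (bal q) N H) / crossProd (bal q) N N L H) *
      ((∏ i ∈ Icc 1 N, (balFact q (2 * L i))⁻¹) * ∏ i ∈ Icc 1 N, (2 * balFact q (2 * H i - 1))⁻¹) := by
  have h1 : ∏ i ∈ Icc 1 N, balProd q (2 * L i + 1) (2 * b) / balFact q (2 * L i) =
      (∏ i ∈ Icc 1 N, evenFact (bal q) (b + L i) / evenFact (bal q) (b - 1 - L i)) *
      ∏ i ∈ Icc 1 N, (balFact q (2 * L i))⁻¹ := by
    rw [← prod_mul_distrib]
    refine prod_congr rfl fun i hi => ?_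
    rw [balProd_eq_div hg (hL i hi), div_eq_mul_inv _ (balFact _ _), Nat.sub_right_comm]
  have h2 : ∏ i ∈ Icc 1 N, balProd q (2 * H i - 1) (2 * b) / (2 * balFact q (2 * H i - 1)) =
      (∏ i ∈ Icc 1 N, evenFact (bal q) (b - 1 + H i) / evenFact (bal q) (b - H i)) *
      ∏ i ∈ Icc 1 N, (2 * balFact q (2 * H i - 1))⁻¹ := by
    rw [← prod_mul_distrib]
    refine prod_congr rfl fun i hi => ?_
    have := hH i hi
    rw [show 2 * H i - 1 = 2 * (H i - 1) + 1 by omega, balProd_eq_div hg (by omega),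
      div_eq_mul_inv _ (2 * balFact _ _), show b + (H i - 1) = b - 1 + H i by omega,
      show b - (H i - 1) - 1 = b - H i by omega]
  rw [cauchyValue, h1, h2]
  simp only [vandermonde, crossProd, mul_sub, mul_add]
  ring

end

/-! ### Powers of 2, and cancellation of the forced factors -/

theorem two_mul_sum_Icc (n : ℕ) : 2 * ∑ i ∈ Icc 1 n, (i : ℤ) = n * (n + 1) := by
  induction n with
  | zero => simp
  | succ n ih => rw [sum_Icc_succ_top (by omega), mul_add, ih]; push_cast; ring

theorem two_mul_sum_Icc_sub (m k : ℕ) (c : ℤ) :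
    2 * ∑ i ∈ Icc (m + 1) (m + k), ((i : ℤ) - m - c) = k * (k + 1 - 2 * c) := by
  induction k with
  | zero => simp
  | succ k ih => rw [← add_assoc, sum_Icc_succ_top (by omega), mul_add, ih]; push_cast; ring

/-- The exponent e counts the factors 2 in the denominators of the forced weights: with k = |n - m|
it is k(k+1)/2 for m ≤ n and k(k-1)/2 for n ≤ m, and the given expression covers both cases. -/
theorem prod_pow_two [CharZero K] {m n : ℕ} {l h : ℕ → ℕ} (hh : ∀ i ∈ Icc 1 n, 1 ≤ h i) (e : ℤ)
    (he : 2 * e = (n - m) * (n - m + 1)) :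
    (∏ i ∈ Icc 1 m, ((2 : K) ^ (2 * l i))⁻¹) * (∏ i ∈ Icc 1 n, (2 * (2 : K) ^ (2 * h i - 1))⁻¹) *
      2 ^ e = 2 ^ (-expF m n l h) := by
  have h2 : (2 : K) ≠ 0 := two_ne_zero
  have e1 : ∏ i ∈ Icc 1 m, ((2 : K) ^ (2 * l i))⁻¹ = ∏ i ∈ Icc 1 m, (2 : K) ^ (-(2 * (l i : ℤ))) := by
    refine prod_congr rfl fun i _ => ?_
    rw [zpow_neg, ← zpow_natCast]
    push_cast
    rfl
  have e2 : ∏ i ∈ Icc 1 n, (2 * (2 : K) ^ (2 * h i - 1))⁻¹ =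
      ∏ i ∈ Icc 1 n, (2 : K) ^ (-(2 * (h i : ℤ))) := by
    refine prod_congr rfl fun i hi => ?_
    have := hh i hi
    rw [zpow_neg, ← pow_succ', ← zpow_natCast]
    congr 2
    omega
  rw [e1, e2, prod_zpow_eq h2, prod_zpow_eq h2, ← zpow_add₀ h2, ← zpow_add₀ h2]
  congr 1
  have g1 := two_mul_sum_Icc m
  have g2 := two_mul_sum_Icc n
  simp only [expF, sum_sub_distrib, sum_neg_distrib]
  linarith

theorem prod_const_Icc {c : K} (hc : c ≠ 0) (m k : ℕ) :
    ∏ i ∈ Icc (m + 1) (m + k), ∏ _j ∈ Icc (m + 1) i, c =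
      c ^ ∑ i ∈ Icc (m + 1) (m + k), ((i : ℤ) - m - 0) := by
  rw [← prod_zpow_eq hc]
  refine prod_congr rfl fun i hi => ?_
  have := mem_Icc.mp hi
  rw [prod_const, Nat.card_Icc, ← zpow_natCast]
  congr 1
  omega

theorem prod_const_Ico {c : K} (hc : c ≠ 0) (m k : ℕ) :
    ∏ i ∈ Icc (m + 1) (m + k), ∏ _j ∈ Ico (m + 1) i, c =
      c ^ ∑ i ∈ Icc (m + 1) (m + k), ((i : ℤ) - m - 1) := by
  rw [← prod_zpow_eq hc]
  refine prod_congr rfl fun i hi => ?_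
  have := mem_Icc.mp hi
  rw [prod_const, Nat.card_Ico, ← zpow_natCast]
  congr 1
  omega

theorem prod_prod_vertWt {q : K} [CharZero K] (hq : q ≠ 0) (hs : ∀ k : ℤ, k ≠ 0 → bal q k ≠ 0)
    (X m n : ℕ) : ∏ i ∈ Icc (m + 1) n, ∏ j ∈ Icc (m + 1) i, vertWt q (2 * X + 1 + i + j) =
      (∏ i ∈ Icc (m + 1) n, ∏ j ∈ Icc (m + 1) i, bal q (2 * (2 * X + 1 + i + j))) /
        ∏ i ∈ Icc (m + 1) n, ∏ j ∈ Icc (m + 1) i, (2 * bal q (2 * X + 1 + i + j)) := by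
  rw [← prod_div_distrib]
  refine prod_congr rfl fun i _ => ?_
  rw [← prod_div_distrib]
  refine prod_congr rfl fun j _ => ?_
  rw [vertWt_eq hq (by positivity) (hs _ (by positivity))]

/-- Bookkeeping for the cancellation: D/T is the weight of the forced particles, V * B the diagonal
of the added functions, and V * D = E makes the surviving product of `prod_continued` disappear. -/
theorem eq_of_mul_div_mul_eq {M D T V B E R S S' : K} (hT : T ≠ 0) (hE : E ≠ 0) (hB : B ≠ 0)
    (h : V * D = E) (hM : M * (D / T * (V * B)) = R * E * (S * B * S')) : M = R * (S * S') * T := by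
  have h' : M * (V * D) * B = R * (S * S') * T * E * B := by
    field_simp at hM
    linear_combination B * hM
  rw [h] at h'
  exact mul_right_cancel₀ hE (mul_right_cancel₀ hB h')

section
variable {x u d m n : ℕ} {l h : ℕ → ℕ}

theorem tilingGF_eq_normalForm_of_le [CharZero K] {q : K} (hq : q ≠ 0)
    (hs : ∀ k : ℤ, k ≠ 0 → bal q k ≠ 0) (hm : m ≤ d) (hn : n ≤ u)
    (hl : ∀ i ∈ Set.Icc 1 m, l i ∈ Set.Icc 1 d) (hl_mono : StrictMonoOn l (Set.Icc 1 m))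
    (hh : ∀ i ∈ Set.Icc 1 n, h i ∈ Set.Icc 1 u) (hh_mono : StrictMonoOn h (Set.Icc 1 n)) {X : ℕ}
    (hX : xTilde x u d m n = X) (hmn : m ≤ n) :
    tilingGF (regionT x u d m n l h) (wt2 q) =
      2 ^ (-expF m n l h) * normalForm (bal q) X m n l h := by
  have hg : ∀ k : ℤ, 0 < k → bal q k ≠ 0 := fun k hk => hs k hk.ne'
  have hXd : d ≤ X + m := by have := xTilde_eq_max x u d m n; omega
  have hXu : u ≤ X + n + 1 := by have := xTilde_eq_max x u d m n; omega
  have hl' : ∀ i ∈ Icc 1 m, l i ≤ X + m := fun i hi => (hl i (by simpa using hi)).2.trans hXd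
  have hh' : ∀ i ∈ Icc 1 n, 1 ≤ h i ∧ h i ≤ X + n + 1 := fun i hi =>
    ⟨(hh i (by simpa using hi)).1, (hh i (by simpa using hi)).2.trans hXu⟩
  have hM := tilingGF_mul_of_le hq hs hm hn hl hl_mono hh hh_mono hX hmn
  rw [prod_lowExtra_eq_one _ hmn, one_mul, prod_mul_distrib, ← mul_assoc (∏ r ∈ range (2 * u), _),
    prod_upExtra _ hX hn, prod_prod_vertWt hq hs] at hM
  obtain ⟨k, rfl⟩ := Nat.exists_eq_add_of_le hmn
  have hLF : ∏ i ∈ Icc (m + 1) (m + k), lowFun q (2 * (X + i)) (2 * (X + i) + 1) =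
      (∏ i ∈ Icc (m + 1) (m + k), evenFact (bal q) (2 * (X + i))) *
        ∏ i ∈ Icc (m + 1) (m + k), (balFact q (2 * (X + i)))⁻¹ := by
    rw [← prod_mul_distrib]
    refine prod_congr rfl fun i _ => ?_
    have := balProd_two_mul_self q (X + i)
    push_cast at this
    rw [lowFun, this, div_eq_mul_inv]
  rw [hLF, show (2 * ((X : ℤ) + ((m + k : ℕ) : ℤ) + 1)) = 2 * ((X + (m + k) + 1 : ℕ) : ℤ) by
    push_cast; ring, cauchyValue_eq hg (fun i hi => ?_) fun i hi => hh' i hi] at hM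
  swap
  · rw [continued]
    have := mem_Icc.mp hi
    split_ifs with him
    · have := hl' i (mem_Icc.mpr ⟨this.1, him⟩)
      omega
    · omega
  have hC := prod_continued hg l h m k X (X + 1) hl'
  have r1 : X + (m + k) + 1 - 1 = X + (m + k) := by omega
  have r2 : X + 1 + (m + k) = X + (m + k) + 1 := by ring
  rw [r2] at hC
  rw [r1, hC] at hM
  have hLa : ∏ i ∈ Icc 1 (m + k), (balFact q (2 * continued m X l i))⁻¹ =
      (∏ i ∈ Icc 1 m, ((2 : K) ^ (2 * l i))⁻¹) * (∏ i ∈ Icc 1 m, (fullFact (bal q) (2 * l i))⁻¹) *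
        ∏ i ∈ Icc (m + 1) (m + k), (balFact q (2 * (X + i)))⁻¹ := by
    rw [prod_Icc_split, ← prod_mul_distrib]
    congr 1
    · refine prod_congr rfl fun i hi => ?_
      rw [continued, if_pos (mem_Icc.mp hi).2, balFact_eq, mul_inv]
    · refine prod_congr rfl fun i hi => ?_
      rw [continued, if_neg (by have := mem_Icc.mp hi; omega)]
  have hHb : ∏ i ∈ Icc 1 (m + k), (2 * balFact q (2 * h i - 1))⁻¹ =
      (∏ i ∈ Icc 1 (m + k), (2 * (2 : K) ^ (2 * h i - 1))⁻¹) *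
        ∏ i ∈ Icc 1 (m + k), (fullFact (bal q) (2 * h i - 1))⁻¹ := by
    rw [← prod_mul_distrib]
    refine prod_congr rfl fun i _ => ?_
    rw [balFact_eq, ← mul_assoc, mul_inv]
  have hEE : ∏ i ∈ Icc (m + 1) (m + k), evenFact (bal q) (X + (m + k) + 1 + (X + i)) =
      ∏ i ∈ Icc (m + 1) (m + k), evenFact (bal q) (2 * X + 1 + (m + k) + i) :=
    prod_congr rfl fun i _ => by congr 1; ring
  have hT := prod_evenFact_mul_triangle hg X m k
  have hT2 : ∏ i ∈ Icc (m + 1) (m + k), ∏ j ∈ Icc (m + 1) i, (2 * bal q (2 * X + 1 + i + j)) =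
      2 ^ (∑ i ∈ Icc (m + 1) (m + k), ((i : ℤ) - m - 0)) * triangle (bal q) X m (m + k) := by
    rw [← prod_const_Icc two_ne_zero, triangle, Icc_eq_empty (a := m + k + 1) (by omega), prod_empty,
      mul_one]
    simp only [prod_mul_distrib]
  rw [hLa, hHb, hEE] at hM
  rw [← prod_pow_two (fun i hi => (hh' i hi).1) _ (by
    rw [two_mul_sum_Icc_sub m k 0]; push_cast; ring), normalForm]
  have zT2 : ∏ i ∈ Icc (m + 1) (m + k), ∏ j ∈ Icc (m + 1) i, (2 * bal q (2 * X + 1 + i + j)) ≠ 0 :=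
    prod_ne_zero_iff.mpr fun i _ => prod_ne_zero_iff.mpr fun j _ =>
      mul_ne_zero two_ne_zero (hg _ (by positivity))
  have zE : ∏ i ∈ Icc (m + 1) (m + k), evenFact (bal q) (2 * X + 1 + (m + k) + i) ≠ 0 :=
    prod_ne_zero_iff.mpr fun i _ => evenFact_ne_zero hg _
  have zB : ∏ i ∈ Icc (m + 1) (m + k), (balFact q (2 * (X + i)))⁻¹ ≠ 0 :=
    prod_ne_zero_iff.mpr fun i _ => inv_ne_zero (balFact_ne_zero hs _)
  rw [eq_of_mul_div_mul_eq zT2 zE zB hT hM, hT2]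
  ring

theorem tilingGF_eq_normalForm_of_ge [CharZero K] {q : K} (hq : q ≠ 0)
    (hs : ∀ k : ℤ, k ≠ 0 → bal q k ≠ 0) (hm : m ≤ d) (hn : n ≤ u)
    (hl : ∀ i ∈ Set.Icc 1 m, l i ∈ Set.Icc 1 d) (hl_mono : StrictMonoOn l (Set.Icc 1 m))
    (hh : ∀ i ∈ Set.Icc 1 n, h i ∈ Set.Icc 1 u) (hh_mono : StrictMonoOn h (Set.Icc 1 n)) {X : ℕ}
    (hX : xTilde x u d m n = X) (hmn : n ≤ m) :
    tilingGF (regionT x u d m n l h) (wt2 q) =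
      2 ^ (-expF m n l h) * normalForm (bal q) X m n l h := by
  have hg : ∀ k : ℤ, 0 < k → bal q k ≠ 0 := fun k hk => hs k hk.ne'
  have hXd : d ≤ X + m := by have := xTilde_eq_max x u d m n; omega
  have hXu : u ≤ X + n + 1 := by have := xTilde_eq_max x u d m n; omega
  have hl' : ∀ i ∈ Icc 1 m, l i ≤ X + m := fun i hi => (hl i (by simpa using hi)).2.trans hXd
  have hh' : ∀ i ∈ Icc 1 n, 1 ≤ h i ∧ h i ≤ X + n + 1 := fun i hi =>
    ⟨(hh i (by simpa using hi)).1, (hh i (by simpa using hi)).2.trans hXu⟩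
  have hM := tilingGF_mul_of_ge hq hs hm hn hl hl_mono hh hh_mono hX hmn
  rw [prod_upExtra_eq_one _ hmn, mul_one, prod_mul_distrib,
    ← mul_assoc (∏ r ∈ range (2 * d + 1), _), prod_lowExtra _ hX hm, prod_prod_vertWt hq hs] at hM
  obtain ⟨k, rfl⟩ := Nat.exists_eq_add_of_le hmn
  -- In contrast to `lowFun`, the added functions `upFun` contribute the factor 2[2X+1+2i]. It
  -- cancels the diagonal j = i of the triangle, which explains the half-open interval in the second
  -- part of `triangle`.
  have hUF : ∏ i ∈ Icc (n + 1) (n + k), upFun q (2 * (X + i) + 1) (2 * (X + i) + 1) =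
      (∏ i ∈ Icc (n + 1) (n + k), (2 * bal q (2 * X + 1 + i + i))) *
      ((∏ i ∈ Icc (n + 1) (n + k), evenFact (bal q) (2 * (X + i))) *
        ∏ i ∈ Icc (n + 1) (n + k), (2 * balFact q (2 * (X + i) + 1))⁻¹) := by
    rw [← prod_mul_distrib, ← prod_mul_distrib]
    refine prod_congr rfl fun i _ => ?_
    have := balProd_two_mul_self q (X + i)
    push_cast at this
    have z := balFact_ne_zero hs (2 * (X + i) + 1)
    rw [upFun, this, show 2 * ((X : ℤ) + i) + 1 = 2 * X + 1 + i + i by ring]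
    field_simp
  rw [hUF, show (2 * ((X : ℤ) + ((n + k : ℕ) : ℤ) + 1)) = 2 * ((X + (n + k) + 1 : ℕ) : ℤ) by
    push_cast; ring, cauchyValue_eq hg (fun i hi => by have := hl' i hi; omega) fun i hi => ?_] at hM
  swap
  · rw [continued]
    have := mem_Icc.mp hi
    split_ifs with him
    · have := hh' i (mem_Icc.mpr ⟨this.1, him⟩)
      omega
    · omega
  have hC := prod_continued hg h l n k (X + 1) X (fun i hi => by have := hh' i hi; omega)
  have r1 : X + (n + k) + 1 - 1 = X + (n + k) := by omega
  have r2 : X + 1 + (n + k) = X + (n + k) + 1 := by ring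
  have r3 : X + 1 + n = X + n + 1 := by ring
  rw [r2, r3, mul_comm (∏ i ∈ Icc 1 (n + k), _ / _), mul_comm (vandermonde _ _ _), crossProd_comm,
    mul_comm (vandermonde _ n _), crossProd_comm _ n] at hC
  rw [r1, hC] at hM
  have hLa : ∏ i ∈ Icc 1 (n + k), (2 * balFact q (2 * continued n (X + 1) h i - 1))⁻¹ =
      (∏ i ∈ Icc 1 n, (2 * (2 : K) ^ (2 * h i - 1))⁻¹) *
        (∏ i ∈ Icc 1 n, (fullFact (bal q) (2 * h i - 1))⁻¹) *
        ∏ i ∈ Icc (n + 1) (n + k), (2 * balFact q (2 * (X + i) + 1))⁻¹ := by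
    rw [prod_Icc_split, ← prod_mul_distrib]
    congr 1
    · refine prod_congr rfl fun i hi => ?_
      rw [continued, if_pos (mem_Icc.mp hi).2, balFact_eq, ← mul_assoc, mul_inv]
    · refine prod_congr rfl fun i hi => ?_
      rw [continued, if_neg (by have := mem_Icc.mp hi; omega),
        show 2 * (X + 1 + i) - 1 = 2 * (X + i) + 1 by omega]
  have hHb : ∏ i ∈ Icc 1 (n + k), (balFact q (2 * l i))⁻¹ =
      (∏ i ∈ Icc 1 (n + k), ((2 : K) ^ (2 * l i))⁻¹) *
        ∏ i ∈ Icc 1 (n + k), (fullFact (bal q) (2 * l i))⁻¹ := by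
    rw [← prod_mul_distrib]
    refine prod_congr rfl fun i _ => ?_
    rw [balFact_eq, mul_inv]
  have hEE : ∏ i ∈ Icc (n + 1) (n + k), evenFact (bal q) (X + (n + k) + (X + 1 + i)) =
      ∏ i ∈ Icc (n + 1) (n + k), evenFact (bal q) (2 * X + 1 + (n + k) + i) :=
    prod_congr rfl fun i _ => by congr 1; ring
  have hT := prod_evenFact_mul_triangle hg X n k
  have hT1 : ∏ i ∈ Icc (n + 1) (n + k), ∏ j ∈ Icc (n + 1) i, (2 * bal q (2 * X + 1 + i + j)) =
      (∏ i ∈ Icc (n + 1) (n + k), ∏ j ∈ Ico (n + 1) i, (2 * bal q (2 * X + 1 + i + j))) *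
        ∏ i ∈ Icc (n + 1) (n + k), (2 * bal q (2 * X + 1 + i + i)) := by
    rw [← prod_mul_distrib]
    refine prod_congr rfl fun i hi => ?_
    rw [← Ico_insert_right (mem_Icc.mp hi).1, prod_insert right_notMem_Ico, mul_comm]
  have hT2 : ∏ i ∈ Icc (n + 1) (n + k), ∏ j ∈ Ico (n + 1) i, (2 * bal q (2 * X + 1 + i + j)) =
      2 ^ (∑ i ∈ Icc (n + 1) (n + k), ((i : ℤ) - n - 1)) * triangle (bal q) X (n + k) n := by
    rw [← prod_const_Ico two_ne_zero, triangle, Icc_eq_empty (a := n + k + 1) (by omega), prod_empty,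
      one_mul]
    simp only [prod_mul_distrib]
  rw [hLa, hHb, hEE, hT1] at hM
  rw [← prod_pow_two (fun i hi => (hh' i hi).1) _ (by
    rw [two_mul_sum_Icc_sub n k 1]; push_cast; ring), normalForm]
  have zT2 : ∏ i ∈ Icc (n + 1) (n + k), ∏ j ∈ Ico (n + 1) i, (2 * bal q (2 * X + 1 + i + j)) ≠ 0 :=
    prod_ne_zero_iff.mpr fun i _ => prod_ne_zero_iff.mpr fun j _ =>
      mul_ne_zero two_ne_zero (hg _ (by positivity))
  have zO : ∏ i ∈ Icc (n + 1) (n + k), (2 * bal q (2 * X + 1 + i + i)) ≠ 0 :=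
    prod_ne_zero_iff.mpr fun i _ => mul_ne_zero two_ne_zero (hg _ (by positivity))
  have zE : ∏ i ∈ Icc (n + 1) (n + k), evenFact (bal q) (2 * X + 1 + (n + k) + i) ≠ 0 :=
    prod_ne_zero_iff.mpr fun i _ => evenFact_ne_zero hg _
  have zB : ∏ i ∈ Icc (n + 1) (n + k), (2 * balFact q (2 * (X + i) + 1))⁻¹ ≠ 0 :=
    prod_ne_zero_iff.mpr fun i _ => inv_ne_zero (mul_ne_zero two_ne_zero (balFact_ne_zero hs _))
  have hO : ∀ D T O Z : K, O ≠ 0 → D / (T * O) * (O * Z) = D / T * Z := by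
    intro D T O Z hO
    rw [div_mul_eq_mul_div, mul_left_comm, mul_comm T, mul_div_mul_left _ _ hO, div_mul_eq_mul_div]
  rw [hO _ _ _ _ zO] at hM
  rw [eq_of_mul_div_mul_eq zT2 zE zB hT
    (hM.trans (congrArg _ (mul_comm _ _))), hT2]
  ring

theorem tilingGF_eq_normalForm [CharZero K] {q : K} (hq : q ≠ 0)
    (hs : ∀ k : ℤ, k ≠ 0 → bal q k ≠ 0) (hm : m ≤ d) (hn : n ≤ u)
    (hl : ∀ i ∈ Set.Icc 1 m, l i ∈ Set.Icc 1 d) (hl_mono : StrictMonoOn l (Set.Icc 1 m))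
    (hh : ∀ i ∈ Set.Icc 1 n, h i ∈ Set.Icc 1 u) (hh_mono : StrictMonoOn h (Set.Icc 1 n)) {X : ℕ}
    (hX : xTilde x u d m n = X) :
    tilingGF (regionT x u d m n l h) (wt2 q) =
      2 ^ (-expF m n l h) * normalForm (bal q) X m n l h := by
  rcases le_total m n with hmn | hmn
  · exact tilingGF_eq_normalForm_of_le hq hs hm hn hl hl_mono hh hh_mono hX hmn
  · exact tilingGF_eq_normalForm_of_ge hq hs hm hn hl hl_mono hh hh_mono hX hmn

end

/-! ### The product formula and the normal form -/

theorem prod_Icc_one_int {M : Type*} [CommMonoid M] (f : ℤ → M) (k : ℕ) :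
    ∏ j ∈ Icc (1 : ℤ) k, f j = ∏ r ∈ range k, f (r + 1) := by
  induction k with
  | zero => simp
  | succ k ih =>
    have : Icc (1 : ℤ) ((k + 1 : ℕ) : ℤ) = insert ((k : ℤ) + 1) (Icc (1 : ℤ) k) := by
      ext j; simp only [mem_insert, mem_Icc]; omega
    rw [this, prod_insert (by simp), prod_range_succ, ih, mul_comm]

theorem prod_Icc_one {M : Type*} [CommMonoid M] (f : ℕ → M) (k : ℕ) :
    ∏ i ∈ Icc 1 k, f i = ∏ r ∈ range k, f (r + 1) := by
  have h := prod_Icc_eq_prod_range f 0 k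
  simp only [zero_add] at h
  rw [h]
  exact prod_congr rfl fun r _ => by rw [add_comm]

/-- The product of the `k` consecutive values of `g` from `g(a)` on. -/
def segProd (g : ℤ → K) (a : ℤ) (k : ℕ) : K := ∏ r ∈ range k, g (a + r)

section
variable {g : ℤ → K}

theorem segProd_add (a b : ℤ) (k s : ℕ) (hb : b = a + k) :
    segProd g a (k + s) = segProd g a k * segProd g b s := by
  rw [segProd, prod_range_add, segProd, segProd]
  congr 1
  refine prod_congr rfl fun r _ => ?_
  rw [hb]
  congr 1
  push_cast
  ring

theorem segProd_two (a : ℤ) : segProd g a 2 = g a * g (a + 1) := by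
  simp [segProd, prod_range_succ]

theorem prod_pairs_descending (c : ℤ) (t : ℕ) :
    ∏ i ∈ Icc 1 t, segProd g (c - 2 * i) 2 = segProd g (c - 2 * t) (2 * t) := by
  induction t with
  | zero => simp [segProd]
  | succ t ih =>
    rw [prod_Icc_succ_top (by omega), ih, mul_add, mul_one, add_comm (2 * t),
      segProd_add _ (c - 2 * t) 2 (2 * t) (by push_cast; ring), mul_comm]

theorem prod_pairs_ascending (c : ℤ) (t : ℕ) :
    (∏ i ∈ Icc 1 t, g (c + 2 * i + 1)) * ∏ i ∈ Icc 1 t, g (c + 2 * i) = segProd g (c + 2) (2 * t) := by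
  induction t with
  | zero => simp [segProd]
  | succ t ih =>
    rw [prod_Icc_succ_top (by omega), prod_Icc_succ_top (by omega), mul_add, mul_one,
      segProd_add _ (c + 2 * ((t + 1 : ℕ) : ℤ)) (2 * t) 2 (by push_cast; ring), ← ih, segProd_two]
    ring

/-- Raising n by one lengthens every row by two factors at its upper end. These pairs are adjacent
and fill a single segment, completed for even n by the new row of length 1. -/
theorem halvedProd_succ (X n : ℕ) :
    (∏ i ∈ Icc 1 ((n + 1 + 1) / 2), segProd g (2 * X + 2 * i + 1) (2 * (n + 1) + 3 - 4 * i)) =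
    (∏ i ∈ Icc 1 ((n + 1) / 2), segProd g (2 * X + 2 * i + 1) (2 * n + 3 - 4 * i)) *
      segProd g (2 * X + n + 3) (n + 1) := by
  have hstep : ∏ i ∈ Icc 1 ((n + 1) / 2), segProd g (2 * X + 2 * i + 1) (2 * (n + 1) + 3 - 4 * i) =
      (∏ i ∈ Icc 1 ((n + 1) / 2), segProd g (2 * X + 2 * i + 1) (2 * n + 3 - 4 * i)) *
        segProd g (2 * X + 2 * n + 4 - 2 * ((n + 1) / 2 : ℕ)) (2 * ((n + 1) / 2)) := by
    rw [← prod_pairs_descending, ← prod_mul_distrib]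
    refine prod_congr rfl fun i hi => ?_
    have := mem_Icc.mp hi
    rw [show 2 * (n + 1) + 3 - 4 * i = 2 * n + 3 - 4 * i + 2 by omega,
      segProd_add _ (2 * X + 2 * n + 4 - 2 * i) _ 2 (by omega)]
  rcases Nat.even_or_odd' n with ⟨t, rfl | rfl⟩
  · rw [show (2 * t + 1) / 2 = t by omega] at hstep ⊢
    rw [show (2 * t + 1 + 1) / 2 = t + 1 by omega, prod_Icc_succ_top (by omega), hstep,
      show 2 * (2 * t + 1) + 3 - 4 * (t + 1) = 1 by omega, mul_assoc]
    congr 1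
    rw [add_comm (2 * t) 1, segProd_add _ (2 * X + 2 * ((2 * t : ℕ) : ℤ) + 4 - 2 * (t : ℤ)) 1 (2 * t)
      (by push_cast; ring), mul_comm]
    congr 2
  · rw [show (2 * t + 1 + 1) / 2 = t + 1 by omega] at hstep ⊢
    rw [show (2 * t + 1 + 1 + 1) / 2 = t + 1 by omega, hstep]
    congr 2
    push_cast
    ring

theorem prod_Icc_eq_segProd (c : ℤ) (a k : ℕ) :
    ∏ j ∈ Icc (a + 1) (a + k), g (c + j) = segProd g (c + a + 1) k := by
  rw [prod_Icc_eq_prod_range, segProd]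
  exact prod_congr rfl fun r _ => by congr 1; push_cast; ring

theorem triangle_zero_left (X n : ℕ) :
    triangle g X 0 n =
      ∏ i ∈ Icc 1 ((n + 1) / 2), segProd g (2 * X + 2 * i + 1) (2 * n + 3 - 4 * i) := by
  rw [triangle, Icc_eq_empty (a := n + 1) (by omega), prod_empty, mul_one]
  induction n with
  | zero => simp
  | succ n ih =>
    rw [halvedProd_succ, ← ih, prod_Icc_succ_top (by omega)]
    have := prod_Icc_eq_segProd (g := g) (2 * X + 1 + ((n + 1 : ℕ) : ℤ)) 0 (n + 1)
    rw [zero_add (n + 1)] at this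
    rw [this]
    congr 2
    push_cast
    ring

/-- Raising m removes the column j = m + 1 if m < n and adds the row i = m + 1 otherwise.
Cross-multiplication gives both cases the same form. -/
theorem triangle_succ_left (X m n : ℕ) :
    segProd g (2 * X + 2 * m + 3) (2 * n) * triangle g X (m + 1) n =
      segProd g (2 * X + n + m + 3) (n + m) * triangle g X m n := by
  rcases lt_or_ge m n with hmn | hmn
  · obtain ⟨k, rfl⟩ := Nat.exists_eq_add_of_le (Nat.succ_le_of_lt hmn)
    rw [triangle, triangle, Icc_eq_empty (a := m.succ + k + 1) (by omega),
      Icc_eq_empty (a := m.succ + k + 1) (by omega), prod_empty, mul_one, mul_one]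
    have h1 : ∏ i ∈ Icc (m + 1) (m.succ + k), ∏ j ∈ Icc (m + 1) i, g (2 * X + 1 + i + j) =
        segProd g (2 * X + 2 * m + 3) (k + 1) *
          ∏ i ∈ Icc (m + 1 + 1) (m.succ + k), ∏ j ∈ Icc (m + 1 + 1) i, g (2 * X + 1 + i + j) := by
      have h2 : ∏ i ∈ Icc (m + 1 + 1) (m.succ + k), ∏ j ∈ Icc (m + 1 + 1) i, g (2 * X + 1 + i + j) =
          ∏ i ∈ Icc (m + 1) (m.succ + k), ∏ j ∈ Icc (m + 1 + 1) i, g (2 * X + 1 + i + j) := by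
        refine prod_subset (Icc_subset_Icc_left (by omega)) fun i hi hi' => ?_
        rw [Icc_eq_empty, prod_empty]
        rw [mem_Icc] at hi hi'
        omega
      have h3 := prod_Icc_eq_segProd (g := g) (2 * X + 1 + ((m + 1 : ℕ) : ℤ)) m (k + 1)
      rw [h2, show (2 * X + 2 * m + 3 : ℤ) = 2 * X + 1 + ((m + 1 : ℕ) : ℤ) + m + 1 by
        push_cast; ring, ← h3, show m + (k + 1) = m.succ + k by omega, ← prod_mul_distrib]
      refine prod_congr rfl fun i hi => ?_
      have := mem_Icc.mp hi
      have h4 : Icc (m + 1) i = insert (m + 1) (Icc (m + 1 + 1) i) := by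
        ext j; simp only [mem_insert, mem_Icc]; omega
      rw [h4, prod_insert (by simp)]
      congr 2
      push_cast
      ring
    rw [h1, show 2 * (m.succ + k) = (k + 1) + (m.succ + k + m) by omega,
      segProd_add _ (2 * X + ((m.succ + k : ℕ) : ℤ) + m + 3) _ _ (by push_cast; ring)]
    ring
  · obtain ⟨k, rfl⟩ := Nat.exists_eq_add_of_le hmn
    rw [triangle, triangle, Icc_eq_empty (a := n + k + 1 + 1) (by omega),
      Icc_eq_empty (a := n + k + 1) (by omega), prod_empty, prod_empty, one_mul, one_mul,
      prod_Icc_succ_top (by omega)]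
    have h3 := prod_Icc_eq_segProd (g := g) (2 * X + 1 + ((n + k + 1 : ℕ) : ℤ)) n k
    have h4 : Ico (n + 1) (n + k + 1) = Icc (n + 1) (n + k) := by
      ext j; simp only [mem_Ico, mem_Icc]; omega
    rw [h4, h3, show n + (n + k) = k + 2 * n by ring,
      segProd_add _ (2 * X + 2 * ((n + k : ℕ) : ℤ) + 3) k (2 * n) (by push_cast; ring),
      show (2 * X + 1 + ((n + k + 1 : ℕ) : ℤ) + n + 1) = 2 * X + n + ((n + k : ℕ) : ℤ) + 3 by
        push_cast; ring]
    ring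

theorem evenFact_succ (t : ℕ) : evenFact g (t + 1) = evenFact g t * g (2 * (t + 1)) :=
  prod_range_succ _ _

theorem prod_evenFact_reflect (X m : ℕ) :
    ∏ i ∈ Icc 1 m, evenFact g (X + m - i) = ∏ r ∈ range m, evenFact g (X + r) := by
  rw [prod_Icc_one, ← prod_range_reflect]
  refine prod_congr rfl fun r hr => ?_
  have := mem_range.mp hr
  congr 1
  omega

/-- The minimal case l_i = i, h_j = j, which isolates the factors of the product that do not depend
on the positions. The induction on m uses `triangle_succ_left`. -/
theorem const_eq (hg : ∀ k, 0 < k → g k ≠ 0) (X m n : ℕ) :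
    (∏ i ∈ Icc 1 m, evenFact g (X + n + 1 + i) / evenFact g (X + m - i)) *
      (∏ i ∈ Icc 1 n, evenFact g (X + m + i) / evenFact g (X + n + 1 - i)) * triangle g X m n =
    (∏ i ∈ Icc 1 ((n + 1) / 2), segProd g (2 * X + 2 * i + 1) (2 * n + 3 - 4 * i)) *
      (∏ i ∈ Icc 1 m, g (2 * (X + n + i)) * g (2 * (X + n + i + 1))) *
      (∏ i ∈ Icc 1 m, segProd g (2 * X + n + i + 2) (n + i - 1)) *
      ∏ j ∈ Icc 1 m, ∏ i ∈ Icc 1 n, g (2 * (X + i + j - 1)) / g (2 * (X + i + j - 1) + 1) := by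
  induction m with
  | zero =>
    -- For m = 0 numerator and denominator contain the same factors in opposite order.
    have h1 : ∏ i ∈ Icc 1 n, evenFact g (X + 0 + i) / evenFact g (X + n + 1 - i) = 1 := by
      rw [prod_div_distrib, div_eq_one_iff_eq (prod_ne_zero_iff.mpr fun i _ => evenFact_ne_zero hg _)]
      have h2 := prod_evenFact_reflect (g := g) (X + 1) n
      rw [show ∏ i ∈ Icc 1 n, evenFact g (X + n + 1 - i) = ∏ i ∈ Icc 1 n, evenFact g (X + 1 + n - i) by
        rw [add_right_comm], h2, prod_Icc_one]
      exact prod_congr rfl fun r _ => by congr 1; ring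
    rw [h1, triangle_zero_left]
    simp
  | succ m ih =>
    rw [prod_div_distrib, prod_div_distrib] at ih ⊢
    rw [prod_evenFact_reflect] at ih ⊢
    rw [prod_range_succ, prod_Icc_succ_top (by omega), prod_Icc_succ_top (by omega),
      prod_Icc_succ_top (by omega), prod_Icc_succ_top (by omega), prod_div_distrib]
    have hB : ∏ i ∈ Icc 1 n, evenFact g (X + (m + 1) + i) =
        (∏ i ∈ Icc 1 n, evenFact g (X + m + i)) * ∏ i ∈ Icc 1 n, g (2 * X + 2 * m + 1 + 2 * i + 1) := by
      rw [← prod_mul_distrib]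
      refine prod_congr rfl fun i _ => ?_
      rw [show X + (m + 1) + i = X + m + i + 1 by ring, evenFact_succ]
      congr 2
      push_cast
      ring
    have hO : ∏ i ∈ Icc 1 n, g (2 * (X + i + ((m + 1 : ℕ) : ℤ) - 1) + 1) =
        ∏ i ∈ Icc 1 n, g (2 * X + 2 * m + 1 + 2 * i) :=
      prod_congr rfl fun i _ => by congr 1; push_cast; ring
    -- The new numerator consists of the new denominator `evenFact g (X + m)` and n + 2 further even
    -- values: n of them for the double product and two for the pair of factors with index m + 1.
    have hP : evenFact g (X + n + 1 + (m + 1)) =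
        evenFact g (X + m) * (∏ i ∈ Icc 1 n, g (2 * (X + i + ((m + 1 : ℕ) : ℤ) - 1))) *
        (g (2 * (X + n + ((m + 1 : ℕ) : ℤ))) * g (2 * (X + n + ((m + 1 : ℕ) : ℤ) + 1))) := by
      have h5 := evenFact_mul_prod_Icc (g := g) ((X : ℤ) + m) (t := X + m) (t' := X + m + n) (M := 0)
        (k := n) (by push_cast; ring) rfl
      rw [zero_add, zero_add] at h5
      have h6 : ∏ i ∈ Icc 1 n, g (2 * (X + i + ((m + 1 : ℕ) : ℤ) - 1)) =
          ∏ i ∈ Icc 1 n, g (2 * ((X : ℤ) + m + i)) :=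
        prod_congr rfl fun i _ => by congr 1; push_cast; ring
      rw [h6, h5, show X + n + 1 + (m + 1) = X + m + n + 1 + 1 by ring, evenFact_succ, evenFact_succ,
        mul_assoc]
      congr 3 <;> (push_cast; ring)
    have hT := triangle_succ_left (g := g) X m n
    have hA := prod_pairs_ascending (g := g) (2 * X + 2 * m + 1) n
    rw [show (2 * X + 2 * m + 1 + 2 : ℤ) = 2 * X + 2 * m + 3 by ring] at hA
    have hseg : segProd g (2 * X + n + ((m + 1 : ℕ) : ℤ) + 2) (n + (m + 1) - 1) =
        segProd g (2 * X + n + m + 3) (n + m) := by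
      rw [show n + (m + 1) - 1 = n + m by omega]
      congr 1
    rw [hB, hO, hP, hseg]
    rw [← hA] at hT
    have zO : ∏ i ∈ Icc 1 n, g (2 * X + 2 * m + 1 + 2 * i) ≠ 0 :=
      prod_ne_zero_iff.mpr fun i _ => hg _ (by positivity)
    have zP := evenFact_ne_zero hg (X + m)
    have z1 : ∏ r ∈ range m, evenFact g (X + r) ≠ 0 :=
      prod_ne_zero_iff.mpr fun i _ => evenFact_ne_zero hg _
    have z2 : ∏ i ∈ Icc 1 n, evenFact g (X + n + 1 - i) ≠ 0 :=
      prod_ne_zero_iff.mpr fun i _ => evenFact_ne_zero hg _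
    generalize (∏ i ∈ Icc 1 n, g (2 * X + 2 * m + 1 + 2 * i)) = O at *
    generalize (∏ i ∈ Icc 1 n, g (2 * X + 2 * m + 1 + 2 * i + 1)) = O' at *
    generalize segProd g (2 * X + n + m + 3) (n + m) = S at *
    generalize g (2 * (X + n + ((m + 1 : ℕ) : ℤ))) = s1 at *
    generalize g (2 * (X + n + ((m + 1 : ℕ) : ℤ) + 1)) = s2 at *
    generalize ∏ i ∈ Icc 1 n, g (2 * (X + i + ((m + 1 : ℕ) : ℤ) - 1)) = E at *
    generalize ∏ r ∈ range m, evenFact g (X + r) = R at *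
    generalize ∏ i ∈ Icc 1 n, evenFact g (X + n + 1 - i) = D at *
    generalize evenFact g (X + m) = P at *
    have hT' : O' * triangle g X (m + 1) n = S * triangle g X m n / O := by
      rw [eq_div_iff zO, ← hT]
      ring
    have hlhs : ∀ A B T : K, A * (P * E * (s1 * s2)) / (R * P) * (B * O' / D) * T =
        (A / R * (B / D)) * (E * (s1 * s2)) * (O' * T) := by
      intro A B T
      field_simp
    rw [hlhs, hT']
    linear_combination (E * (s1 * s2) * S / O) * ih

/-- Moving a bump from i to i + t adds t even values above in the numerator and removes t from the
denominator. This accounts for the last two double products of the formula. -/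
theorem evenFact_div (hg : ∀ k, 0 < k → g k ≠ 0) (a b t : ℕ) :
    evenFact g (a + t) / evenFact g b = evenFact g a / evenFact g (b + t) *
      ∏ j ∈ Icc (1 : ℤ) t, g (2 * (a + j)) * g (2 * (b + t + 1 - j)) := by
  rw [prod_mul_distrib, prod_Icc_one_int, prod_Icc_one_int]
  have h1 : evenFact g (a + t) = evenFact g a * ∏ r ∈ range t, g (2 * (a + ((r : ℤ) + 1))) := by
    rw [evenFact, prod_range_add]
    congr 1
  have h2 : evenFact g (b + t) = evenFact g b * ∏ r ∈ range t, g (2 * (b + t + 1 - ((r : ℤ) + 1))) := by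
    rw [evenFact, prod_range_add, ← prod_range_reflect (fun r => g (2 * (((b + r : ℕ) : ℤ) + 1)))]
    congr 1
    refine prod_congr rfl fun r hr => ?_
    have := mem_range.mp hr
    congr 1
    omega
  have z1 := evenFact_ne_zero hg b
  have z2 := evenFact_ne_zero hg (b + t)
  rw [h1]
  rw [div_mul_eq_mul_div, div_eq_div_iff z1 z2, h2]
  ring

/-- The product formula without the powers of `2` and `q`. -/
noncomputable def productForm (g : ℤ → K) (X : ℤ) (m n : ℕ) (l h : ℕ → ℕ) : K :=
  (((∏ j ∈ Icc 1 m, ∏ i ∈ Ico 1 j, g (2 * ((l j : ℤ) - l i)))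
          * ∏ j ∈ Icc 1 n, ∏ i ∈ Ico 1 j, g (2 * ((h j : ℤ) - h i)))
        / ((∏ i ∈ Icc 1 m, ∏ j ∈ Icc 1 n, g (2 * ((l i : ℤ) + h j)))
          * (∏ i ∈ Icc 1 m, ∏ k ∈ Icc 1 (2 * (l i : ℤ)), g k)
          * ∏ j ∈ Icc 1 n, ∏ k ∈ Icc 1 (2 * (h j : ℤ) - 1), g k))
    * (∏ i ∈ Icc 1 ((n + 1) / 2), ∏ j ∈ Icc (1 : ℤ) (2 * n - 4 * i + 3), g (2 * X + 2 * i + j))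
    * (∏ i ∈ Icc 1 m, g (2 * (X + n + i)) * g (2 * (X + n + i + 1)))
    * (∏ i ∈ Icc 1 m, ∏ j ∈ Icc (1 : ℤ) (n + i - 1), g (2 * X + n + i + j + 1))
    * (∏ i ∈ Icc 1 n, ∏ j ∈ Icc 1 m,
        g (2 * (X + i + j - 1)) / g (2 * (X + i + j - 1) + 1))
    * (∏ i ∈ Icc 1 m, ∏ j ∈ Icc (1 : ℤ) ((l i : ℤ) - i),
        g (2 * (X + i + j + n + 1)) * g (2 * (X - i - j + m + 1)))
    * (∏ i ∈ Icc 1 n, ∏ j ∈ Icc (1 : ℤ) ((h i : ℤ) - i),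
        g (2 * (X + i + j + m)) * g (2 * (X - i - j + n + 2)))

/-- Nothing about g is used but that it is nonzero at positive integers, so the identity applies
directly to the q-integers of the statement. -/
theorem productForm_eq_normalForm (hg : ∀ k, 0 < k → g k ≠ 0) (X m n : ℕ) (l h : ℕ → ℕ)
    (hl : ∀ i ∈ Icc 1 m, i ≤ l i ∧ l i ≤ X + m) (hh : ∀ i ∈ Icc 1 n, i ≤ h i ∧ h i ≤ X + n + 1) :
    productForm g X m n l h = normalForm g X m n l h := by
  have hL : ∏ i ∈ Icc 1 m, evenFact g (X + n + 1 + l i) / evenFact g (X + m - l i) =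
      (∏ i ∈ Icc 1 m, evenFact g (X + n + 1 + i) / evenFact g (X + m - i)) *
      ∏ i ∈ Icc 1 m, ∏ j ∈ Icc (1 : ℤ) ((l i : ℤ) - i),
        g (2 * (X + i + j + n + 1)) * g (2 * (X - i - j + m + 1)) := by
    rw [← prod_mul_distrib]
    refine prod_congr rfl fun i hi => ?_
    obtain ⟨h1, h2⟩ := hl i hi
    have key := evenFact_div hg (X + n + 1 + i) (X + m - l i) (l i - i)
    rw [show X + n + 1 + i + (l i - i) = X + n + 1 + l i by omega,
      show X + m - l i + (l i - i) = X + m - i by omega,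
      show ((l i - i : ℕ) : ℤ) = l i - i by omega] at key
    rw [key]
    congr 1
    refine prod_congr rfl fun j _ => ?_
    congr 2 <;> omega
  have hH : ∏ i ∈ Icc 1 n, evenFact g (X + m + h i) / evenFact g (X + n + 1 - h i) =
      (∏ i ∈ Icc 1 n, evenFact g (X + m + i) / evenFact g (X + n + 1 - i)) *
      ∏ i ∈ Icc 1 n, ∏ j ∈ Icc (1 : ℤ) ((h i : ℤ) - i),
        g (2 * (X + i + j + m)) * g (2 * (X - i - j + n + 2)) := by
    rw [← prod_mul_distrib]
    refine prod_congr rfl fun i hi => ?_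
    obtain ⟨h1, h2⟩ := hh i hi
    have key := evenFact_div hg (X + m + i) (X + n + 1 - h i) (h i - i)
    rw [show X + m + i + (h i - i) = X + m + h i by omega,
      show X + n + 1 - h i + (h i - i) = X + n + 1 - i by omega,
      show ((h i - i : ℕ) : ℤ) = h i - i by omega] at key
    rw [key]
    congr 1
    refine prod_congr rfl fun j _ => ?_
    congr 2 <;> omega
  have hFl : ∏ i ∈ Icc 1 m, ∏ k ∈ Icc 1 (2 * (l i : ℤ)), g k = ∏ i ∈ Icc 1 m, fullFact g (2 * l i) := by
    refine prod_congr rfl fun i _ => ?_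
    have := prod_Icc_one_int g (2 * l i)
    push_cast at this
    rw [this, fullFact]
  have hFh : ∏ i ∈ Icc 1 n, ∏ k ∈ Icc 1 (2 * (h i : ℤ) - 1), g k =
      ∏ i ∈ Icc 1 n, fullFact g (2 * h i - 1) := by
    refine prod_congr rfl fun i hi => ?_
    have h1 := (hh i hi).1
    have h2 := (mem_Icc.mp hi).1
    have := prod_Icc_one_int g (2 * h i - 1)
    rw [show ((2 * h i - 1 : ℕ) : ℤ) = 2 * h i - 1 by omega] at this
    rw [this, fullFact]
  have h1 : ∏ i ∈ Icc 1 ((n + 1) / 2), ∏ j ∈ Icc (1 : ℤ) (2 * n - 4 * i + 3), g (2 * X + 2 * i + j) =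
      ∏ i ∈ Icc 1 ((n + 1) / 2), segProd g (2 * X + 2 * i + 1) (2 * n + 3 - 4 * i) := by
    refine prod_congr rfl fun i hi => ?_
    have := mem_Icc.mp hi
    rw [show (2 * n - 4 * i + 3 : ℤ) = ((2 * n + 3 - 4 * i : ℕ) : ℤ) by omega, prod_Icc_one_int,
      segProd]
    exact prod_congr rfl fun r _ => by congr 1; ring
  have h2 : ∏ i ∈ Icc 1 m, ∏ j ∈ Icc (1 : ℤ) (n + i - 1), g (2 * X + n + i + j + 1) =
      ∏ i ∈ Icc 1 m, segProd g (2 * X + n + i + 2) (n + i - 1) := by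
    refine prod_congr rfl fun i hi => ?_
    have := mem_Icc.mp hi
    rw [show (n + i - 1 : ℤ) = ((n + i - 1 : ℕ) : ℤ) by omega, prod_Icc_one_int, segProd]
    exact prod_congr rfl fun r _ => by congr 1; ring
  have hc := const_eq hg X m n
  rw [normalForm, productForm, hL, hH, hFl, hFh, h1, h2,
    prod_comm (s := Icc 1 n) (t := Icc 1 m)]
  simp only [prod_inv_distrib]
  generalize (∏ i ∈ Icc 1 m, ∏ j ∈ Icc (1 : ℤ) ((l i : ℤ) - i),
    g (2 * (X + i + j + n + 1)) * g (2 * (X - i - j + m + 1))) = Z1 at *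
  generalize (∏ i ∈ Icc 1 n, ∏ j ∈ Icc (1 : ℤ) ((h i : ℤ) - i),
    g (2 * (X + i + j + m)) * g (2 * (X - i - j + n + 2))) = Z2 at *
  rw [mul_mul_mul_comm _ Z1 _ Z2, vandermonde, vandermonde, crossProd]
  linear_combination (-((∏ j ∈ Icc 1 m, ∏ i ∈ Ico 1 j, g (2 * ((l j : ℤ) - l i))) *
    (∏ j ∈ Icc 1 n, ∏ i ∈ Ico 1 j, g (2 * ((h j : ℤ) - h i))) /
    (∏ i ∈ Icc 1 m, ∏ j ∈ Icc 1 n, g (2 * ((l i : ℤ) + h j))) *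
    ((∏ i ∈ Icc 1 m, fullFact g (2 * l i))⁻¹ * (∏ i ∈ Icc 1 n, fullFact g (2 * h i - 1))⁻¹)) *
    Z1 * Z2) * hc

end

/-! ### The power of `q` -/

theorem prod_eq_zpow_mul {q : K} (hq : q ≠ 0) {ι : Type*} (S : Finset ι) (f g : ι → K) (e : ι → ℤ)
    (h : ∀ i ∈ S, f i = q ^ e i * g i) : ∏ i ∈ S, f i = q ^ (∑ i ∈ S, e i) * ∏ i ∈ S, g i := by
  rw [prod_congr rfl h, prod_mul_distrib, prod_zpow_eq hq]

theorem fullFact_qInt {q : K} (hq : q ≠ 0) (t : ℕ) {e : ℤ} (he : 2 * e = t * (t - 1)) :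
    fullFact (qInt (q ^ 2)) t = q ^ e * fullFact (bal q) t := by
  rw [fullFact, prod_eq_zpow_mul hq _ _ (fun r : ℕ => bal q ((r : ℤ) + 1)) (fun r : ℕ => (r : ℤ))
    fun r _ => by rw [qInt_sq_eq hq (by positivity), add_sub_cancel_right], fullFact]
  congr 2
  have h : ∀ t : ℕ, 2 * ∑ r ∈ range t, (r : ℤ) = t * (t - 1) := by
    intro t
    induction t with
    | zero => simp
    | succ t ih => rw [sum_range_succ, mul_add, ih]; push_cast; ring
  have := h t
  omega

theorem evenFact_qInt {q : K} (hq : q ≠ 0) (t : ℕ) :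
    evenFact (qInt (q ^ 2)) t = q ^ ((t : ℤ) ^ 2) * evenFact (bal q) t := by
  rw [evenFact, prod_eq_zpow_mul hq _ _ (fun r : ℕ => bal q (2 * ((r : ℤ) + 1)))
    (fun r : ℕ => 2 * ((r : ℤ) + 1) - 1) fun r _ => qInt_sq_eq hq (by positivity), evenFact]
  congr 2
  induction t with
  | zero => simp
  | succ t ih => rw [sum_range_succ, ih]; push_cast; ring

theorem vandermonde_qInt {q : K} (hq : q ≠ 0) (n : ℕ) {a : ℕ → ℕ}
    (ha : StrictMonoOn a (Set.Icc 1 n)) : vandermonde (qInt (q ^ 2)) n a =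
      q ^ (∑ j ∈ Icc 1 n, ∑ i ∈ Ico 1 j, (2 * ((a j : ℤ) - a i) - 1)) * vandermonde (bal q) n a := by
  refine prod_eq_zpow_mul hq _ _ _ _ fun j hj => prod_eq_zpow_mul hq _ _ _ _ fun i hi => ?_
  have h1 := mem_Icc.mp hj
  have h2 := mem_Ico.mp hi
  have := ha ⟨h2.1, by omega⟩ ⟨h1.1, h1.2⟩ h2.2
  exact qInt_sq_eq hq (by omega)

theorem crossProd_qInt {q : K} (hq : q ≠ 0) (m n : ℕ) (a b : ℕ → ℕ) :
    crossProd (qInt (q ^ 2)) m n a b =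
      q ^ (∑ i ∈ Icc 1 m, ∑ j ∈ Icc 1 n, (2 * ((a i : ℤ) + b j) - 1)) * crossProd (bal q) m n a b :=
  prod_eq_zpow_mul hq _ _ _ _ fun i _ => prod_eq_zpow_mul hq _ _ _ _ fun j _ =>
    qInt_sq_eq hq (by positivity)

theorem triangle_qInt {q : K} (hq : q ≠ 0) (X m n : ℕ) :
    triangle (qInt (q ^ 2)) X m n =
      q ^ ((∑ i ∈ Icc (m + 1) n, ∑ j ∈ Icc (m + 1) i, (2 * (X : ℤ) + 1 + i + j - 1)) +
        ∑ i ∈ Icc (n + 1) m, ∑ j ∈ Ico (n + 1) i, (2 * (X : ℤ) + 1 + i + j - 1)) *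
      triangle (bal q) X m n := by
  rw [zpow_add₀ hq, triangle, triangle, mul_mul_mul_comm]
  congr 1 <;>
  exact prod_eq_zpow_mul hq _ _ _ _ fun i _ => prod_eq_zpow_mul hq _ _ _ _ fun j _ =>
    qInt_sq_eq hq (by positivity)

theorem two_mul_sum_Icc_add (m t : ℕ) (c : ℤ) :
    2 * ∑ j ∈ Icc (m + 1) (m + t), (c + j - 1) = t * (2 * c + 2 * m + t - 1) := by
  induction t with
  | zero => simp
  | succ t ih => rw [← add_assoc, sum_Icc_succ_top (by omega), mul_add, ih]; push_cast; ring

theorem two_mul_sum_triangle (X m n : ℕ) :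
    2 * ((∑ i ∈ Icc (m + 1) n, ∑ j ∈ Icc (m + 1) i, (2 * (X : ℤ) + 1 + i + j - 1)) +
        ∑ i ∈ Icc (n + 1) m, ∑ j ∈ Ico (n + 1) i, (2 * (X : ℤ) + 1 + i + j - 1)) =
      (n - m) * (n - m + 1) * (2 * X + m + n + 1) := by
  have h1 : ∀ m k : ℕ, 2 * ∑ i ∈ Icc (m + 1) (m + k), ∑ j ∈ Icc (m + 1) i,
      (2 * (X : ℤ) + 1 + i + j - 1) = k * (k + 1) * (2 * X + 2 * m + k + 1) := by
    intro m k
    induction k with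
    | zero => simp
    | succ k ih =>
      rw [← add_assoc, sum_Icc_succ_top (by omega), mul_add, ih, add_assoc m k 1,
        two_mul_sum_Icc_add]
      push_cast
      ring
  have h2 : ∀ m k : ℕ, 2 * ∑ i ∈ Icc (m + 1) (m + k), ∑ j ∈ Ico (m + 1) i,
      (2 * (X : ℤ) + 1 + i + j - 1) = k * (k - 1) * (2 * X + 2 * m + k + 1) := by
    intro m k
    induction k with
    | zero => simp
    | succ k ih =>
      have h4 : Ico (m + 1) (m + k + 1) = Icc (m + 1) (m + k) := by
        ext j; simp only [mem_Ico, mem_Icc]; omega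
      rw [← add_assoc, sum_Icc_succ_top (by omega), mul_add, ih, h4, two_mul_sum_Icc_add]
      push_cast
      ring
  rcases le_total m n with h | h
  · obtain ⟨k, rfl⟩ := Nat.exists_eq_add_of_le h
    rw [Icc_eq_empty (a := m + k + 1) (by omega), sum_empty, add_zero, h1]
    push_cast
    ring
  · obtain ⟨k, rfl⟩ := Nat.exists_eq_add_of_le h
    rw [Icc_eq_empty (a := n + k + 1) (by omega), sum_empty, zero_add, h2]
    push_cast
    ring

theorem two_mul_sum_vandermonde (n : ℕ) (a : ℕ → ℤ) :
    2 * ∑ j ∈ Icc 1 n, ∑ i ∈ Ico 1 j, (2 * (a j - a i) - 1) =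
      (∑ i ∈ Icc 1 n, a i * (8 * i - 4 * n - 4)) - n * (n - 1) := by
  induction n with
  | zero => simp
  | succ n ih =>
    have hI : Ico 1 (n + 1) = Icc 1 n := rfl
    rw [sum_Icc_succ_top (by omega), sum_Icc_succ_top (by omega), mul_add, ih, hI]
    have h1 : ∑ i ∈ Icc 1 n, (2 * (a (n + 1) - a i) - 1) =
        n * (2 * a (n + 1) - 1) - 2 * ∑ i ∈ Icc 1 n, a i := by
      rw [mul_sum, sum_congr rfl fun i _ => show 2 * (a (n + 1) - a i) - 1 =
        (2 * a (n + 1) - 1) - 2 * a i by ring, sum_sub_distrib, sum_const, Nat.card_Icc]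
      simp
    have h2 : ∑ i ∈ Icc 1 n, a i * (8 * i - 4 * ((n + 1 : ℕ) : ℤ) - 4) =
        (∑ i ∈ Icc 1 n, a i * (8 * i - 4 * n - 4)) - 4 * ∑ i ∈ Icc 1 n, a i := by
      rw [mul_sum, ← sum_sub_distrib]
      exact sum_congr rfl fun i _ => by push_cast; ring
    rw [h1, h2]
    push_cast
    ring

theorem two_mul_sum_crossProd (m n : ℕ) (a b : ℕ → ℤ) :
    2 * ∑ i ∈ Icc 1 m, ∑ j ∈ Icc 1 n, (2 * (a i + b j) - 1) =
      4 * n * (∑ i ∈ Icc 1 m, a i) + 4 * m * (∑ j ∈ Icc 1 n, b j) - 2 * m * n := by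
  have h : ∀ i, ∑ j ∈ Icc 1 n, (2 * (a i + b j) - 1) =
      n * (2 * a i - 1) + 2 * ∑ j ∈ Icc 1 n, b j := by
    intro i
    rw [mul_sum, sum_congr rfl fun j _ => show 2 * (a i + b j) - 1 = (2 * a i - 1) + 2 * b j by ring,
      sum_add_distrib, sum_const, Nat.card_Icc]
    simp
  simp only [h]
  rw [sum_add_distrib, ← mul_sum, sum_sub_distrib, ← mul_sum, sum_const, sum_const, Nat.card_Icc]
  simp only [add_tsub_cancel_right, nsmul_eq_mul]
  ring

theorem two_mul_sum_quadratic (n : ℕ) (a b : ℤ) :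
    2 * ∑ i ∈ Icc 1 n, (a + i * b + 3 * (i : ℤ) ^ 2) =
      2 * a * n + b * (n * (n + 1)) + n * (n + 1) * (2 * n + 1) := by
  induction n with
  | zero => simp
  | succ n ih => rw [sum_Icc_succ_top (by omega), mul_add, ih]; push_cast; ring

theorem two_mul_bracket {a b : ℤ} (h : a ≤ b + 1) : 2 * bracket b a = (b - a + 1) * (a + b) := by
  obtain ⟨k, hk⟩ := Int.eq_ofNat_of_zero_le (show 0 ≤ b + 1 - a by omega)
  obtain rfl : b = a + k - 1 := by omega
  clear h hk
  rw [bracket]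
  induction k with
  | zero => simp
  | succ k ih =>
    have : Icc a (a + ((k + 1 : ℕ) : ℤ) - 1) = insert (a + k) (Icc a (a + k - 1)) := by
      ext j; simp only [mem_insert, mem_Icc]; omega
    rw [this, sum_insert (by simp), mul_add, ih]
    push_cast
    ring

/-- The exponent by which the normal form changes when `q`-integers are balanced. -/
noncomputable def normalExp (X m n : ℕ) (l h : ℕ → ℕ) : ℤ :=
  (∑ j ∈ Icc 1 m, ∑ i ∈ Ico 1 j, (2 * ((l j : ℤ) - l i) - 1)) +
  (∑ j ∈ Icc 1 n, ∑ i ∈ Ico 1 j, (2 * ((h j : ℤ) - h i) - 1)) -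
  (∑ i ∈ Icc 1 m, ∑ j ∈ Icc 1 n, (2 * ((l i : ℤ) + h j) - 1)) +
  ((∑ i ∈ Icc 1 m, -((l i : ℤ) * (2 * l i - 1))) +
    ∑ i ∈ Icc 1 n, -((2 * (h i : ℤ) - 1) * (h i - 1))) +
  ((∑ i ∈ Icc 1 m, (((X : ℤ) + n + 1 + l i) ^ 2 - ((X : ℤ) + m - l i) ^ 2)) +
    ∑ i ∈ Icc 1 n, (((X : ℤ) + m + h i) ^ 2 - ((X : ℤ) + n + 1 - h i) ^ 2)) +
  ((∑ i ∈ Icc (m + 1) n, ∑ j ∈ Icc (m + 1) i, (2 * (X : ℤ) + 1 + i + j - 1)) +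
    ∑ i ∈ Icc (n + 1) m, ∑ j ∈ Ico (n + 1) i, (2 * (X : ℤ) + 1 + i + j - 1))

/-- Each factor [k]_{q²} becomes q^(k-1) times a balanced q-integer. The bounds on l and h keep all
arguments in the range where this holds and make the truncated subtractions exact. -/
theorem normalForm_qInt {q : K} (hq : q ≠ 0) {X m n : ℕ} {l h : ℕ → ℕ}
    (hl : ∀ i ∈ Icc 1 m, l i ≤ X + m) (hl_mono : StrictMonoOn l (Set.Icc 1 m))
    (hh : ∀ i ∈ Icc 1 n, 1 ≤ h i ∧ h i ≤ X + n + 1) (hh_mono : StrictMonoOn h (Set.Icc 1 n)) :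
    normalForm (qInt (q ^ 2)) X m n l h =
      q ^ normalExp X m n l h * normalForm (bal q) X m n l h := by
  have hFl : ∏ i ∈ Icc 1 m, (fullFact (qInt (q ^ 2)) (2 * l i))⁻¹ =
      q ^ (∑ i ∈ Icc 1 m, -((l i : ℤ) * (2 * l i - 1))) *
        ∏ i ∈ Icc 1 m, (fullFact (bal q) (2 * l i))⁻¹ := by
    refine prod_eq_zpow_mul hq _ _ _ _ fun i _ => ?_
    rw [fullFact_qInt hq (2 * l i) (e := (l i : ℤ) * (2 * l i - 1)) (by push_cast; ring), mul_inv,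
      zpow_neg]
  have hFh : ∏ i ∈ Icc 1 n, (fullFact (qInt (q ^ 2)) (2 * h i - 1))⁻¹ =
      q ^ (∑ i ∈ Icc 1 n, -((2 * (h i : ℤ) - 1) * (h i - 1))) *
        ∏ i ∈ Icc 1 n, (fullFact (bal q) (2 * h i - 1))⁻¹ := by
    refine prod_eq_zpow_mul hq _ _ _ _ fun i hi => ?_
    have := (hh i hi).1
    rw [fullFact_qInt hq (2 * h i - 1) (e := (2 * (h i : ℤ) - 1) * (h i - 1)) ?_, mul_inv, zpow_neg]
    rw [show ((2 * h i - 1 : ℕ) : ℤ) = 2 * h i - 1 by omega]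
    ring
  have hL : ∏ i ∈ Icc 1 m, evenFact (qInt (q ^ 2)) (X + n + 1 + l i) /
        evenFact (qInt (q ^ 2)) (X + m - l i) =
      q ^ (∑ i ∈ Icc 1 m, (((X : ℤ) + n + 1 + l i) ^ 2 - ((X : ℤ) + m - l i) ^ 2)) *
        ∏ i ∈ Icc 1 m, evenFact (bal q) (X + n + 1 + l i) / evenFact (bal q) (X + m - l i) := by
    refine prod_eq_zpow_mul hq _ _ _ _ fun i hi => ?_
    have := hl i hi
    rw [evenFact_qInt hq, evenFact_qInt hq, zpow_sub₀ hq, mul_div_mul_comm,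
      show ((X + m - l i : ℕ) : ℤ) = X + m - l i by omega]
    push_cast
    rfl
  have hH : ∏ i ∈ Icc 1 n, evenFact (qInt (q ^ 2)) (X + m + h i) /
        evenFact (qInt (q ^ 2)) (X + n + 1 - h i) =
      q ^ (∑ i ∈ Icc 1 n, (((X : ℤ) + m + h i) ^ 2 - ((X : ℤ) + n + 1 - h i) ^ 2)) *
        ∏ i ∈ Icc 1 n, evenFact (bal q) (X + m + h i) / evenFact (bal q) (X + n + 1 - h i) := by
    refine prod_eq_zpow_mul hq _ _ _ _ fun i hi => ?_
    have := (hh i hi).2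
    rw [evenFact_qInt hq, evenFact_qInt hq, zpow_sub₀ hq, mul_div_mul_comm,
      show ((X + n + 1 - h i : ℕ) : ℤ) = X + n + 1 - h i by omega]
    push_cast
    rfl
  rw [normalForm, hFl, hFh, hL, hH, vandermonde_qInt hq m hl_mono, vandermonde_qInt hq n hh_mono,
    crossProd_qInt hq, triangle_qInt hq, normalForm, normalExp]
  rw [zpow_add₀ hq (_ + (_ + _)), zpow_add₀ hq (_ + (_ + _)), zpow_add₀ hq (_ - _), zpow_sub₀ hq,
    zpow_add₀ hq (∑ j ∈ Icc 1 m, _), zpow_add₀ hq (∑ i ∈ Icc 1 m, _),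
    zpow_add₀ hq (∑ i ∈ Icc 1 m, _)]
  ring

/-- With t'_1 + 2d = 2x̃ + 2m + 1 and t'_2 + 2u = 2x̃ + 2n + 2 both sides become polynomial sums in
which all terms involving l_i or h_i cancel index by index. The remainder consists of power sums in
i. The factor 4 clears the halves from `f`, `bracket` and these sums. -/
theorem normalExp_eq_expE {x u d m n X : ℕ} {l h : ℕ → ℕ} (hX : xTilde x u d m n = X)
    (hl : ∀ i ∈ Icc 1 m, i ≤ l i) (hh : ∀ i ∈ Icc 1 n, i ≤ h i) :
    normalExp X m n l h = expE x u d m n l h := by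
  have ht1 : t1 x u d m n + 2 * d = 2 * X + 2 * m + 1 := by
    rw [← hX]; simp only [t1, xTilde]; ring
  have ht2 : t2 x u d m n + 2 * u = 2 * X + 2 * n + 2 := by
    rw [← hX]; simp only [t2, xTilde]; ring
  have hbl : 2 * ∑ i ∈ Icc 1 m, bracket (t1 x u d m n + 2 * d - m - (m - i + 1))
        (t1 x u d m n + 2 * (d - l i) - 2 * (m - i)) =
      ∑ i ∈ Icc 1 m, (2 * (l i : ℤ) - i) * (4 * X + 1 + 3 * i - 2 * l i) := by
    rw [mul_sum]
    refine sum_congr rfl fun i hi => ?_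
    have := hl i hi
    rw [show t1 x u d m n + 2 * d - m - (m - i + 1) = 2 * X + i by rw [ht1]; ring,
      show t1 x u d m n + 2 * (d - l i) - 2 * (m - i) = 2 * X + 1 + 2 * i - 2 * l i by
        linear_combination ht1, two_mul_bracket (by omega)]
    ring
  have hbh : 2 * ∑ i ∈ Icc 1 n, bracket (t2 x u d m n + 2 * u - n - (n - i + 1))
        (t2 x u d m n + 2 * (u - h i) - 2 * (n - i)) =
      ∑ i ∈ Icc 1 n, (2 * (h i : ℤ) - i) * (4 * X + 3 + 3 * i - 2 * h i) := by
    rw [mul_sum]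
    refine sum_congr rfl fun i hi => ?_
    have := hh i hi
    rw [show t2 x u d m n + 2 * u - n - (n - i + 1) = 2 * X + 1 + i by rw [ht2]; ring,
      show t2 x u d m n + 2 * (u - h i) - 2 * (n - i) = 2 * X + 2 + 2 * i - 2 * h i by
        linear_combination ht2, two_mul_bracket (by omega)]
    ring
  have hf := two_mul_f (t1 x u d m n + 2 * d - m) (n + 1) m
  rw [ht1] at hf
  have hV := two_mul_sum_vandermonde m (fun i => (l i : ℤ))
  have hV' := two_mul_sum_vandermonde n (fun i => (h i : ℤ))
  have hC := two_mul_sum_crossProd m n (fun i => (l i : ℤ)) (fun i => (h i : ℤ))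
  have hT := two_mul_sum_triangle X m n
  have hsl : (∑ i ∈ Icc 1 m, (l i : ℤ) * (8 * i - 4 * m - 4)) - 4 * n * (∑ i ∈ Icc 1 m, (l i : ℤ)) +
      2 * (∑ i ∈ Icc 1 m, -((l i : ℤ) * (2 * l i - 1))) +
      2 * (∑ i ∈ Icc 1 m, (((X : ℤ) + n + 1 + l i) ^ 2 - ((X : ℤ) + m - l i) ^ 2)) -
      ∑ i ∈ Icc 1 m, (2 * (l i : ℤ) - i) * (4 * X + 1 + 3 * i - 2 * l i) =
      ∑ i ∈ Icc 1 m, (2 * (n + 1 - m) * (2 * X + n + m + 1) + i * (4 * X + 1) + 3 * (i : ℤ) ^ 2) := by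
    rw [mul_sum, mul_sum, mul_sum, ← sum_sub_distrib, ← sum_add_distrib, ← sum_add_distrib,
      ← sum_sub_distrib]
    exact sum_congr rfl fun i _ => by ring
  have hsh : (∑ i ∈ Icc 1 n, (h i : ℤ) * (8 * i - 4 * n - 4)) - 4 * m * (∑ i ∈ Icc 1 n, (h i : ℤ)) +
      2 * (∑ i ∈ Icc 1 n, -((2 * (h i : ℤ) - 1) * (h i - 1))) +
      2 * (∑ i ∈ Icc 1 n, (((X : ℤ) + m + h i) ^ 2 - ((X : ℤ) + n + 1 - h i) ^ 2)) -
      ∑ i ∈ Icc 1 n, (2 * (h i : ℤ) - i) * (4 * X + 3 + 3 * i - 2 * h i) =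
      ∑ i ∈ Icc 1 n, (2 * (m - n - 1) * (2 * X + m + n + 1) - 2 + i * (4 * X + 3) +
        3 * (i : ℤ) ^ 2) := by
    rw [mul_sum, mul_sum, mul_sum, ← sum_sub_distrib, ← sum_add_distrib, ← sum_add_distrib,
      ← sum_sub_distrib]
    exact sum_congr rfl fun i _ => by ring
  have hql := two_mul_sum_quadratic m (2 * (n + 1 - m) * (2 * X + n + m + 1)) (4 * X + 1)
  have hqh := two_mul_sum_quadratic n (2 * (m - n - 1) * (2 * X + m + n + 1) - 2) (4 * X + 3)
  have h4 : (4 : ℤ) ≠ 0 := by norm_num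
  apply mul_left_cancel₀ h4
  rw [normalExp, expE, ht1]
  rw [ht1] at hbl
  linear_combination 2 * hV + 2 * hV' - 2 * hC + 2 * hT + 2 * hsl + 2 * hsh + hql + hqh - 2 * hf -
    2 * hbl - 2 * hbh

/-! ### Assembly -/

theorem Q_eq_productForm (q : K) (x u d m n : ℕ) (l h : ℕ → ℕ) :
    Q q x u d m n l h = 2 ^ (-expF m n l h) * q ^ (-expE x u d m n l h) *
      productForm (qInt (q ^ 2)) (xTilde x u d m n) m n l h := by
  simp only [Q, productForm, qFact, mul_assoc]

theorem le_of_strictMonoOn {a : ℕ → ℕ} {n : ℕ} (h0 : ∀ i ∈ Set.Icc 1 n, 1 ≤ a i)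
    (ha : StrictMonoOn a (Set.Icc 1 n)) : ∀ i ∈ Icc 1 n, i ≤ a i := by
  intro i hi
  rw [mem_Icc] at hi
  obtain ⟨h1, h2⟩ := hi
  induction i, h1 using Nat.le_induction with
  | base => exact h0 1 ⟨le_rfl, h2⟩
  | succ i h1 ih =>
    have := ih (by omega)
    have := ha ⟨h1, by omega⟩ ⟨by omega, h2⟩ (Nat.lt_succ_self i)
    omega

/-- The geometry yields the normal form in balanced q-integers, the formula its analogue in
[k]_{q²}; they differ by a power of q, which the prefactor q^(-E') removes. -/
theorem tilingGF_eq_Q [CharZero K] {q : K} (hq0 : q ≠ 0)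
    (hq : ∀ k : ℤ, 0 < k → qInt (q ^ 2) k ≠ 0) {x u d m n : ℕ} (hm : m ≤ d) (hn : n ≤ u)
    {l h : ℕ → ℕ} (hl : ∀ i ∈ Set.Icc 1 m, l i ∈ Set.Icc 1 d) (hl_mono : StrictMonoOn l (Set.Icc 1 m))
    (hh : ∀ j ∈ Set.Icc 1 n, h j ∈ Set.Icc 1 u) (hh_mono : StrictMonoOn h (Set.Icc 1 n)) :
    tilingGF (regionT x u d m n l h) (wt2 q) = Q q x u d m n l h := by
  have hs : ∀ k : ℤ, k ≠ 0 → bal q k ≠ 0 := fun k hk => bal_ne_zero hq0 hq hk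
  obtain ⟨X, hX⟩ := Int.eq_ofNat_of_zero_le (xTilde_nonneg (x := x) hm hn)
  have hXd : d ≤ X + m := by have := xTilde_eq_max x u d m n; omega
  have hXu : u ≤ X + n + 1 := by have := xTilde_eq_max x u d m n; omega
  have hl' : ∀ i ∈ Icc 1 m, l i ≤ X + m := fun i hi =>
    (hl i (by simpa using hi)).2.trans hXd
  have hh' : ∀ i ∈ Icc 1 n, h i ≤ X + n + 1 := fun i hi =>
    (hh i (by simpa using hi)).2.trans hXu
  have hli := le_of_strictMonoOn (fun i hi => (hl i hi).1) hl_mono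
  have hhi := le_of_strictMonoOn (fun i hi => (hh i hi).1) hh_mono
  rw [tilingGF_eq_normalForm hq0 hs hm hn hl hl_mono hh hh_mono hX, Q_eq_productForm, hX,
    productForm_eq_normalForm hq X m n l h (fun i hi => ⟨hli i hi, hl' i hi⟩)
      (fun i hi => ⟨hhi i hi, hh' i hi⟩),
    normalForm_qInt hq0 hl' hl_mono (fun i hi => ⟨(hh i (by simpa using hi)).1, hh' i hi⟩) hh_mono,
    normalExp_eq_expE hX hli hhi, zpow_neg, zpow_neg, mul_assoc, ← mul_assoc (q ^ _)⁻¹,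
    inv_mul_cancel₀ (zpow_ne_zero _ hq0), one_mul]

end HalvedHexagon

theorem mainTheorem2 {K : Type*} [Field K] [CharZero K] (q : K) (hq0 : q ≠ 0)
    (hq : ∀ k : ℤ, 0 < k → HalvedHexagon.qInt (q ^ 2) k ≠ 0)
    (x u d m n : ℕ) (hm : m ≤ d) (hn : n ≤ u) (l h : ℕ → ℕ)
    (hl : ∀ i ∈ Set.Icc 1 m, l i ∈ Set.Icc 1 d) (hl_mono : StrictMonoOn l (Set.Icc 1 m))
    (hh : ∀ j ∈ Set.Icc 1 n, h j ∈ Set.Icc 1 u) (hh_mono : StrictMonoOn h (Set.Icc 1 n)) :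
    HalvedHexagon.tilingGF (HalvedHexagon.regionT x u d m n l h) (HalvedHexagon.wt2 q)
      = HalvedHexagon.Q q x u d m n l h :=
  HalvedHexagon.tilingGF_eq_Q hq0 hq hm hn hl hl_mono hh hh_mono
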